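/- For $\lambda=(\lambda_1,\lambda_2,\lambda_3)\in\mathbb{R}^3$, $\alpha\in\mathbb{R}\setminus\mathbb{Q}$ and $\theta\in\mathbb{T}:=\mathbb{R}/\mathbb{Z}$, let $H_{\theta;\lambda,\alpha}$ be the extended Harper operator, i.e. the bounded operator on $\ell^2(\mathbb{Z})=\ell^2(\mathbb{Z};\mathbb{C})$ given by $$(H_{\theta;\lambda,\alpha}\psi)_k = v(\theta+\alpha k)\,\psi_k + c_\lambda(\theta+\alpha k)\,\psi_{k+1} + \overline{c_\lambda(\theta+\alpha(k-1))}\,\psi_{k-1},\qquad k\in\mathbb{Z},$$ where $$v(\theta)=2\cos(2\pi\theta),\qquad c_\lambda(\theta)=\lambda_1 e^{-2\pi i(\theta+\frac{\alpha}{2})}+\lambda_2+\lambda_3 e^{2\pi i(\theta+\frac{\alpha}{2})}.$$ Let $\mu$ be the Haar probability measure on $\mathbb{T}$, and let $\mathcal{SD}=\mathrm{III}\cup\mathrm{L}_{\mathrm{II}}\subset\mathbb{R}^3$ be the self-dual region, where $$\mathrm{III}=\{\lambda:\ \max\{1,\lambda_2\}\le\lambda_1+\lambda_3,\ \lambda_2>0\},\qquad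 \mathrm{L}_{\mathrm{II}}=\{\lambda:\ 0\le\lambda_1+\lambda_3\le 1,\ \lambda_2=1\}.$$ **Theorem 1.2.** For every irrational $\alpha$ and every $\lambda\in\mathcal{SD}$, the operator $H_{\theta;\lambda,\alpha}$ has empty point spectrum (that is, it has no eigenvalues with eigenvectors in $\ell^2(\mathbb{Z})$) for $\mu$-a.e. $\theta\in\mathbb{T}$. -/

import Mathlib

noncomputable section

namespace ExtendedHarper

/-- The Hilbert space `ℓ²(ℤ)` of square-summable complex sequences. -/
abbrev EllTwo : Type := lp (fun _ : ℤ => ℂ) 2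

/-- The coupling triple `λ = (λ₁, λ₂, λ₃) ∈ ℝ³`. -/
structure Coupling where
  l1 : ℝ
  l2 : ℝ
  l3 : ℝ

/-- Region III: `max {1, λ₂} ≤ λ₁ + λ₃` and `λ₂ > 0`. -/
def regionIII : Set Coupling :=
  {lam | max 1 lam.l2 ≤ lam.l1 + lam.l3 ∧ 0 < lam.l2}

/-- The line segment `L_II`: `0 ≤ λ₁ + λ₃ ≤ 1` and `λ₂ = 1`. -/
def segmentLII : Set Coupling :=
  {lam | 0 ≤ lam.l1 + lam.l3 ∧ lam.l1 + lam.l3 ≤ 1 ∧ lam.l2 = 1}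

/-- The self-dual region `SD = III ∪ L_II`. -/
def selfDualRegion : Set Coupling := regionIII ∪ segmentLII

theorem potential_periodic :
    Function.Periodic (fun x : ℝ => 2 * Real.cos (2 * Real.pi * x)) 1 := by
  intro x
  simp only [mul_add, mul_one, Real.cos_add_two_pi]

/-- The potential `v(θ) = 2 cos(2πθ)` on `𝕋 = ℝ/ℤ`. -/
def potential : UnitAddCircle → ℝ := potential_periodic.lift

/-- The formula for the hopping function at a real representative `x` of the phase. -/
def hoppingReal (lam : Coupling) (α x : ℝ) : ℂ :=
  lam.l1 * Complex.exp (-(2 * Real.pi * Complex.I * ((x + α / 2 : ℝ) : ℂ))) + lam.l2 +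
    lam.l3 * Complex.exp (2 * Real.pi * Complex.I * ((x + α / 2 : ℝ) : ℂ))

theorem hoppingReal_periodic (lam : Coupling) (α : ℝ) :
    Function.Periodic (hoppingReal lam α) 1 := by
  intro x
  have h1 : (2 * Real.pi * Complex.I * ((x + 1 + α / 2 : ℝ) : ℂ)) =
      2 * Real.pi * Complex.I * ((x + α / 2 : ℝ) : ℂ) + 2 * Real.pi * Complex.I := by
    push_cast; ring
  simp only [hoppingReal, h1, neg_add, Complex.exp_add, Complex.exp_neg,
    Complex.exp_two_pi_mul_I, inv_one, mul_one]

/-- The hopping function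
`c_λ(θ) = λ₁ exp(-2πi(θ + α/2)) + λ₂ + λ₃ exp(2πi(θ + α/2))` on `𝕋 = ℝ/ℤ`. -/
def hopping (lam : Coupling) (α : ℝ) : UnitAddCircle → ℂ := (hoppingReal_periodic lam α).lift

theorem norm_potential_le (θ : UnitAddCircle) : ‖((potential θ : ℝ) : ℂ)‖ ≤ 2 := by
  induction θ using QuotientAddGroup.induction_on with
  | H x =>
    have h : potential (x : UnitAddCircle) = 2 * Real.cos (2 * Real.pi * x) := rfl
    have h2 := Real.abs_cos_le_one (2 * Real.pi * x)
    rw [Complex.norm_real, h, Real.norm_eq_abs, abs_mul, abs_two]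
    linarith

theorem norm_hopping_le (lam : Coupling) (α : ℝ) (θ : UnitAddCircle) :
    ‖hopping lam α θ‖ ≤ |lam.l1| + |lam.l2| + |lam.l3| := by
  induction θ using QuotientAddGroup.induction_on with
  | H x =>
    change ‖hoppingReal lam α x‖ ≤ _
    have e1 : ‖Complex.exp (2 * Real.pi * Complex.I * ((x + α / 2 : ℝ) : ℂ))‖ = 1 := by
      simp [Complex.norm_exp]
    have e2 : ‖Complex.exp (-(2 * Real.pi * Complex.I * ((x + α / 2 : ℝ) : ℂ)))‖ = 1 := by
      simp [Complex.norm_exp]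
    unfold hoppingReal
    refine (norm_add₃_le).trans (le_of_eq ?_)
    rw [norm_mul, norm_mul, e1, e2, Complex.norm_real, Complex.norm_real, Complex.norm_real]
    simp

/-- A bounded weight times a translate of a square-summable sequence is square-summable. -/
theorem memℓp_weightedShift {w : ℤ → ℂ} {C : ℝ} (hw : ∀ k, ‖w k‖ ≤ C) (m : ℤ) (ψ : EllTwo) :
    Memℓp (fun k => w k * ψ (k + m)) 2 := by
  have hs : Memℓp (fun k => ψ (k + m)) 2 := by
    refine memℓp_gen ?_
    exact (Equiv.addRight m).summable_iff.mpr ((lp.memℓp ψ).summable (by norm_num))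
  have hC := hs.const_mul (C : ℂ)
  refine hC.mono' (fun k => ?_)
  have hC0 : 0 ≤ C := (norm_nonneg _).trans (hw 0)
  rw [norm_mul, norm_mul, Complex.norm_real, Real.norm_of_nonneg hC0]
  exact mul_le_mul_of_nonneg_right (hw k) (norm_nonneg _)

theorem norm_weightedShift_le {w : ℤ → ℂ} {C : ℝ} (hw : ∀ k, ‖w k‖ ≤ C) (m : ℤ) (ψ : EllTwo) :
    ‖(⟨fun k => w k * ψ (k + m), memℓp_weightedShift hw m ψ⟩ : EllTwo)‖ ≤ C * ‖ψ‖ := by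
  have hC0 : 0 ≤ C := (norm_nonneg _).trans (hw 0)
  have hp : 0 < (2 : ENNReal).toReal := by norm_num
  have hsum := (lp.memℓp ψ).summable hp
  have hshift : Summable fun k : ℤ => ‖ψ (k + m)‖ ^ (2 : ENNReal).toReal :=
    (Equiv.addRight m).summable_iff.mpr hsum
  have hle : ∀ k : ℤ, ‖w k * ψ (k + m)‖ ^ (2 : ENNReal).toReal ≤
      C ^ (2 : ENNReal).toReal * ‖ψ (k + m)‖ ^ (2 : ENNReal).toReal := by
    intro k
    rw [← Real.mul_rpow hC0 (norm_nonneg _)]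
    refine Real.rpow_le_rpow (norm_nonneg _) ?_ hp.le
    rw [norm_mul]
    exact mul_le_mul_of_nonneg_right (hw k) (norm_nonneg _)
  refine lp.norm_le_of_tsum_le hp (mul_nonneg hC0 (norm_nonneg _)) ?_
  rw [Real.mul_rpow hC0 (norm_nonneg _), lp.norm_rpow_eq_tsum hp ψ]
  refine (((memℓp_weightedShift hw m ψ).summable hp).tsum_le_tsum hle
    (hshift.mul_left _)).trans (le_of_eq ?_)
  rw [tsum_mul_left]
  congr 1
  exact (Equiv.addRight m).tsum_eq (fun k : ℤ => ‖ψ k‖ ^ (2 : ENNReal).toReal)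

/-- The point `θ + α k` of the orbit of `θ` under the rotation by `α`. -/
def orbit (α : ℝ) (θ : UnitAddCircle) (k : ℤ) : UnitAddCircle :=
  θ + ((α * k : ℝ) : UnitAddCircle)

/-- The difference expression
`(H_{θ;λ,α} ψ)_k = v(θ + αk) ψ_k + c_λ(θ + αk) ψ_{k+1} + conj(c_λ(θ + α(k-1))) ψ_{k-1}`. -/
def differenceExpr (lam : Coupling) (α : ℝ) (θ : UnitAddCircle) (ψ : ℤ → ℂ) : ℤ → ℂ := fun k =>
  (potential (orbit α θ k) : ℂ) * ψ k + hopping lam α (orbit α θ k) * ψ (k + 1) +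
    (starRingEnd ℂ) (hopping lam α (orbit α θ (k - 1))) * ψ (k - 1)

theorem norm_conj_hopping_le (lam : Coupling) (α : ℝ) (θ : UnitAddCircle) :
    ‖(starRingEnd ℂ) (hopping lam α θ)‖ ≤ |lam.l1| + |lam.l2| + |lam.l3| := by
  rw [RCLike.norm_conj]
  exact norm_hopping_le lam α θ

theorem memℓp_differenceExpr (lam : Coupling) (α : ℝ) (θ : UnitAddCircle) (ψ : EllTwo) :
    Memℓp (differenceExpr lam α θ ψ) 2 := by
  have h1 := memℓp_weightedShift (fun k => norm_potential_le (orbit α θ k)) 0 ψ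
  have h2 := memℓp_weightedShift (fun k => norm_hopping_le lam α (orbit α θ k)) 1 ψ
  have h3 := memℓp_weightedShift (fun k => norm_conj_hopping_le lam α (orbit α θ (k - 1))) (-1) ψ
  convert (h1.add h2).add h3 using 1
  funext k
  simp [differenceExpr, sub_eq_add_neg]

/-- The extended Harper operator as a linear map of `ℓ²(ℤ)`. -/
def harperLinear (lam : Coupling) (α : ℝ) (θ : UnitAddCircle) : EllTwo →ₗ[ℂ] EllTwo where
  toFun ψ := ⟨differenceExpr lam α θ ψ, memℓp_differenceExpr lam α θ ψ⟩
  map_add' ψ φ := by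
    ext k
    simp only [differenceExpr, lp.coeFn_add, Pi.add_apply]
    ring
  map_smul' a ψ := by
    ext k
    simp only [differenceExpr, lp.coeFn_smul, Pi.smul_apply, smul_eq_mul, RingHom.id_apply]
    ring

theorem norm_harperLinear_le (lam : Coupling) (α : ℝ) (θ : UnitAddCircle) (ψ : EllTwo) :
    ‖harperLinear lam α θ ψ‖ ≤ (2 + 2 * (|lam.l1| + |lam.l2| + |lam.l3|)) * ‖ψ‖ := by
  have b1 := fun k => norm_potential_le (orbit α θ k)
  have b2 := fun k => norm_hopping_le lam α (orbit α θ k)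
  have b3 := fun k => norm_conj_hopping_le lam α (orbit α θ (k - 1))
  have h1 := norm_weightedShift_le b1 0 ψ
  have h2 := norm_weightedShift_le b2 1 ψ
  have h3 := norm_weightedShift_le b3 (-1) ψ
  have key : harperLinear lam α θ ψ =
      (⟨_, memℓp_weightedShift b1 0 ψ⟩ : EllTwo) + (⟨_, memℓp_weightedShift b2 1 ψ⟩ : EllTwo) +
        (⟨_, memℓp_weightedShift b3 (-1) ψ⟩ : EllTwo) := by
    ext k
    simp [harperLinear, differenceExpr, sub_eq_add_neg]
    rfl
  rw [key]
  refine norm_add₃_le.trans ?_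
  linarith

/-- The extended Harper operator `H_{θ;λ,α}`, a bounded operator on `ℓ²(ℤ)`. -/
def harper (lam : Coupling) (α : ℝ) (θ : UnitAddCircle) : EllTwo →L[ℂ] EllTwo :=
  (harperLinear lam α θ).mkContinuous _ (norm_harperLinear_le lam α θ)

theorem harper_apply (lam : Coupling) (α : ℝ) (θ : UnitAddCircle) (ψ : EllTwo) (k : ℤ) :
    harper lam α θ ψ k =
      (potential (orbit α θ k) : ℂ) * ψ k + hopping lam α (orbit α θ k) * ψ (k + 1) +
        (starRingEnd ℂ) (hopping lam α (orbit α θ (k - 1))) * ψ (k - 1) := rfl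

/-- The point spectrum of a bounded operator on `ℓ²(ℤ)`: the set of its eigenvalues, that is, of
those `E` such that `T ψ = E ψ` for some nonzero `ψ ∈ ℓ²(ℤ)`. -/
def pointSpectrum (T : EllTwo →L[ℂ] EllTwo) : Set ℂ :=
  {E | Module.End.HasEigenvalue (T : Module.End ℂ EllTwo) E}

end ExtendedHarper

end

open MeasureTheory AddCircle Filter Topology

/-! ### Discrepancy of arithmetic progressions modulo one -/

/-! Aubry duality: the function `u` on the circle whose Fourier coefficients are an `ℓ²` eigenvector
solves, for a.e. `x`, the eigenvalue equation of the dual coupling along `x + nα`, twisted by the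
phase `θ` (`exists_solvesDual`). The dual coupling is again self-dual. Its current is a.e. constant:
integrating it shows that the energy is real, and ergodicity of the rotation does the rest
(`ae_current_eq_const`). Each value of the constant forces a limit statement about `θ` in which
neither the energy nor `u` appears, and each such statement holds only on a null set of `θ`.

Let `Π_n` be the product of `n` hopping values and `ρ` the geometric mean of the hopping modulus.
Take `q_n → ∞` with `q_n α → 0` and `|Π_{q_n}| ≤ K ρ ^ q_n` uniformly in `x`.

Nonzero current: `u` and its conjugate give two independent sections of the transfer cocycle, so the
trace over `q_n` steps is `e^{2πi q_n θ} Π(x) + e^{-2πi q_n θ} conj Π(x - α)` up to `o(ρ ^ q_n)` in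
`L¹`. Comparing extreme Fourier coefficients gives `a_n + b_n e^{2πi q_n θ} + c_n e^{-2πi q_n θ} →
0` (`tendsto_of_current_ne_zero`). On a set of positive measure this makes all three coefficients
tend to zero (`tendsto_zero_of_fourier_tendsto_zero`), but self-duality keeps one of them away from
zero (`dichotomy`, `exists_le_norm_trace_div`).

Zero current: the imaginary part of `e^{2πi q_n θ} Π_{q_n} / ρ ^ q_n` tends to zero in `L²`
(`tendsto_integral_sq_of_current_eq_zero`). Its squared norm is a trigonometric expression in `θ`
whose constant term stays away from zero, so the same oscillation lemma applies.

The uniform bound, for every irrational `α`, is `exists_bounded_products`. It reduces to `∏_{j<q} |2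
sin π(x + jα)|` for denominators `q` of nearly record approximation quality. Comparing with the
roots of unity leaves a cotangent sum whose slope is the inverse of `p` modulo `q`. The record
property makes this slope badly approximable, at exactly the rate that the smallness of `α - p/q`
compensates. -/

theorem injOn_toNat_emod {m : ℕ} (hm : 0 < m) {a : ℤ} (ha : IsCoprime a (m : ℤ)) (n : ℤ) :
    Set.InjOn (fun k : ℕ => ((n + k * a) % m).toNat) (Finset.range m) := by
  intro i hi j hj h
  have hm' : (m : ℤ) ≠ 0 := by positivity
  have h1 : (n + i * a) % m = (n + j * a) % m := by
    have h2 := congrArg (Nat.cast : ℕ → ℤ) h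
    simpa [Int.toNat_of_nonneg (Int.emod_nonneg _ hm')] using h2
  have h3 : (m : ℤ) ∣ (i - j) * a := by
    have := Int.ModEq.dvd (show (n + j * a) ≡ (n + i * a) [ZMOD m] from h1.symm)
    convert this using 1; ring
  have h4 : (m : ℤ) ∣ (i - j : ℤ) := ha.symm.dvd_of_dvd_mul_right h3
  simp only [Finset.coe_range, Set.mem_Iio] at hi hj
  have := Int.eq_zero_of_abs_lt_dvd h4 (by rw [abs_lt]; constructor <;> omega)
  omega

theorem image_toNat_emod {m : ℕ} (hm : 0 < m) {a : ℤ} (ha : IsCoprime a (m : ℤ)) (n : ℤ) :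
    (Finset.range m).image (fun k : ℕ => ((n + k * a) % m).toNat) = Finset.range m := by
  have hm' : (m : ℤ) ≠ 0 := by positivity
  apply Finset.eq_of_subset_of_card_le
  · intro j hj
    obtain ⟨k, -, rfl⟩ := Finset.mem_image.1 hj
    have h1 := Int.emod_lt_of_pos (n + k * a) (show (0 : ℤ) < m by positivity)
    have h2 := Int.emod_nonneg (n + k * a) hm'
    rw [Finset.mem_range]; omega
  · rw [Finset.card_image_of_injOn (injOn_toNat_emod hm ha n)]

theorem prod_toNat_emod {M : Type*} [CommMonoid M] {m : ℕ} (hm : 0 < m) {a : ℤ}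
    (ha : IsCoprime a (m : ℤ)) (n : ℤ) (g : ℕ → M) :
    ∏ k ∈ Finset.range m, g ((n + k * a) % m).toNat = ∏ k ∈ Finset.range m, g k := by
  conv_rhs => rw [← image_toNat_emod hm ha n]
  rw [Finset.prod_image (injOn_toNat_emod hm ha n)]

theorem sum_toNat_emod {m : ℕ} (hm : 0 < m) {a : ℤ}
    (ha : IsCoprime a (m : ℤ)) (n : ℤ) (g : ℕ → ℝ) :
    ∑ k ∈ Finset.range m, g ((n + k * a) % m).toNat = ∑ k ∈ Finset.range m, g k := by
  conv_rhs => rw [← image_toNat_emod hm ha n]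
  rw [Finset.sum_image (injOn_toNat_emod hm ha n)]

theorem sum_range_cast_real (m : ℕ) : ∑ k ∈ Finset.range m, (k : ℝ) = m * (m - 1) / 2 := by
  induction m with
  | zero => simp
  | succ m ih => rw [Finset.sum_range_succ, ih]; push_cast; ring

/-- The residues of `⌊m y⌋ + k a` modulo `m` form a complete system, so the fractional parts
contribute a fixed total and `y` enters only through `⌊m y⌋`. -/
theorem sum_floor_add_mul_div {m : ℕ} (hm : 0 < m) {a : ℤ} (ha : IsCoprime a (m : ℤ)) (y : ℝ) :
    ∑ k ∈ Finset.range m, (⌊y + k * (a / m : ℝ)⌋ : ℝ) = ⌊m * y⌋ + (a - 1) * (m - 1) / 2 := by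
  have hm' : (m : ℤ) ≠ 0 := by positivity
  have hmr : (m : ℝ) ≠ 0 := by positivity
  have key : ∀ k : ℕ, (⌊y + k * (a / m : ℝ)⌋ : ℝ) =
      (⌊m * y⌋ + k * a) / m - (((⌊m * y⌋ + k * a) % m).toNat : ℝ) / m := by
    intro k
    have h1 : ⌊y + k * (a / m : ℝ)⌋ = (⌊m * y⌋ + k * a) / m := by
      have : y + k * (a / m : ℝ) = (m * y + (k * a : ℤ)) / (m : ℕ) := by
        push_cast; field_simp
      rw [this, Int.floor_div_natCast, Int.floor_add_intCast]
    rw [h1]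
    have h2 := Int.emod_add_mul_ediv (⌊m * y⌋ + k * a) m
    have h3 : ((((⌊m * y⌋ + k * a) % m).toNat : ℤ)) = (⌊m * y⌋ + k * a) % m :=
      Int.toNat_of_nonneg (Int.emod_nonneg _ hm')
    rw [← h3] at h2
    have h4 := congrArg (Int.cast : ℤ → ℝ) h2
    push_cast at h4
    rw [← sub_div, eq_div_iff hmr]
    linarith
  simp_rw [key]
  rw [Finset.sum_sub_distrib, ← Finset.sum_div, ← Finset.sum_div,
    sum_toNat_emod hm ha _ (fun k => (k : ℝ)), Finset.sum_add_distrib, ← Finset.sum_mul,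
    sum_range_cast_real]
  simp only [Finset.sum_const, Finset.card_range, nsmul_eq_mul]
  field_simp
  ring

/-- Within one block `k β` and `k a / m` differ by at most `1 / m`. Moving `y` by `±1 / m` changes
`⌊m y⌋` by exactly one, which sandwiches the sum of floors between two exactly computable sums. -/
theorem abs_sum_fract_block_le {m : ℕ} (hm : 0 < m) {a : ℤ} (ha : IsCoprime a (m : ℤ)) {β : ℝ}
    (hβ : |β - a / m| ≤ 1 / (m : ℝ) ^ 2) (y : ℝ) :
    |∑ k ∈ Finset.range m, (Int.fract (y + k * β) - 1 / 2)| ≤ 3 := by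
  have hmr : (0 : ℝ) < m := by positivity
  have hkb : ∀ k ∈ Finset.range m, |(k : ℝ) * β - k * (a / m)| ≤ 1 / m := by
    intro k hk
    have hk' : (k : ℝ) ≤ m := by exact_mod_cast (Finset.mem_range.1 hk).le
    rw [← mul_sub, abs_mul, Nat.abs_cast]
    calc (k : ℝ) * |β - a / m| ≤ m * (1 / (m : ℝ) ^ 2) := by gcongr
      _ = 1 / m := by field_simp
  have hup : ∑ k ∈ Finset.range m, (⌊y + k * β⌋ : ℝ) ≤ ⌊m * y⌋ + 1 + (a - 1) * (m - 1) / 2 := by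
    have h1 := sum_floor_add_mul_div hm ha (y + 1 / m)
    have h2 : (m : ℝ) * (y + 1 / m) = m * y + 1 := by field_simp
    rw [h2, Int.floor_add_one] at h1
    push_cast at h1
    rw [← h1]
    refine Finset.sum_le_sum fun k hk => ?_
    have := (abs_le.1 (hkb k hk)).2
    exact Int.cast_le.2 (Int.floor_le_floor (by linarith))
  have hlo : ⌊m * y⌋ - 1 + (a - 1) * (m - 1) / 2 ≤ ∑ k ∈ Finset.range m, (⌊y + k * β⌋ : ℝ) := by
    have h1 := sum_floor_add_mul_div hm ha (y - 1 / m)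
    have h2 : (m : ℝ) * (y - 1 / m) = m * y - 1 := by field_simp
    rw [h2, Int.floor_sub_one] at h1
    push_cast at h1
    rw [← h1]
    refine Finset.sum_le_sum fun k hk => ?_
    have := (abs_le.1 (hkb k hk)).1
    exact Int.cast_le.2 (Int.floor_le_floor (by linarith))
  have hs : ∑ k ∈ Finset.range m, (Int.fract (y + k * β) - 1 / 2) =
      m * y + β * (m * (m - 1) / 2) - m / 2 - ∑ k ∈ Finset.range m, (⌊y + k * β⌋ : ℝ) := by
    simp_rw [Int.fract]
    rw [Finset.sum_sub_distrib, Finset.sum_sub_distrib, Finset.sum_add_distrib, ← Finset.sum_mul,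
      sum_range_cast_real]
    simp only [Finset.sum_const, Finset.card_range, nsmul_eq_mul]
    ring
  have hf0 := Int.floor_le (m * y)
  have hf1 := Int.lt_floor_add_one (m * y)
  have hb : |β * (m * (m - 1) / 2) - a * (m - 1) / 2| ≤ 1 / 2 := by
    have h1 : (1 : ℝ) ≤ m := by exact_mod_cast hm
    have : β * (m * (m - 1) / 2) - a * (m - 1) / 2 = (β - a / m) * (m * (m - 1) / 2) := by
      field_simp
    rw [this, abs_mul, abs_of_nonneg (a := (m : ℝ) * (m - 1) / 2) (by nlinarith)]
    calc |β - a / m| * (m * (m - 1) / 2) ≤ 1 / (m : ℝ) ^ 2 * (m * m / 2) := by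
          gcongr; linarith
      _ = 1 / 2 := by field_simp
  rw [abs_le] at hb ⊢
  rw [hs]
  constructor <;> linarith [hb.1, hb.2]

/-- Full blocks of length `m` cost at most 3 each, and an incomplete block at most its length.
Peeling off the first block translates `y`, so the induction runs over all `y`. -/
theorem abs_sum_fract_le_of_approx {m : ℕ} (hm : 0 < m) {a : ℤ} (ha : IsCoprime a (m : ℤ)) {β : ℝ}
    (hβ : |β - a / m| ≤ 1 / (m : ℝ) ^ 2) (N : ℕ) (y : ℝ) :
    |∑ k ∈ Finset.range N, (Int.fract (y + k * β) - 1 / 2)| ≤ 3 * N / m + m := by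
  have hmr : (0 : ℝ) < m := by positivity
  induction N using Nat.strong_induction_on generalizing y with
  | _ N ih =>
    rcases lt_or_ge N m with h | h
    · have hterm : ∀ k ∈ Finset.range N, |Int.fract (y + k * β) - 1 / 2| ≤ 1 := by
        intro k _
        rw [abs_le]
        constructor <;> linarith [Int.fract_nonneg (y + k * β), Int.fract_lt_one (y + k * β)]
      calc _ ≤ ∑ k ∈ Finset.range N, |Int.fract (y + k * β) - 1 / 2| :=
            Finset.abs_sum_le_sum_abs _ _
        _ ≤ ∑ k ∈ Finset.range N, (1 : ℝ) := Finset.sum_le_sum hterm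
        _ = N := by simp
        _ ≤ m := by exact_mod_cast h.le
        _ ≤ _ := by linarith [show 0 ≤ 3 * (N : ℝ) / m by positivity]
    · obtain ⟨M, rfl⟩ := Nat.exists_eq_add_of_le h
      rw [Finset.sum_range_add]
      have h1 := abs_sum_fract_block_le hm ha hβ y
      have h2 := ih M (by omega) (y + m * β)
      have h3 : ∀ k : ℕ, y + ((m + k : ℕ) : ℝ) * β = y + m * β + k * β := by
        intro k; push_cast; ring
      simp_rw [h3]
      refine (abs_add_le _ _).trans ?_
      calc _ ≤ 3 + (3 * (M : ℝ) / m + m) := add_le_add h1 h2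
        _ = _ := by push_cast; field_simp; ring

/-- A square-root discrepancy bound for a slope that is badly approximable at the scale `q`. -/
theorem abs_sum_fract_le_sqrt {q : ℕ} {β κ : ℝ} (hκ : 0 < κ) (hκ1 : κ ≤ 1)
    (hβ : ∀ k : ℕ, 0 < k → k < q → ∀ r : ℤ, κ ≤ k * |k * β - r|) {N : ℕ} (hN : N < q) (y : ℝ) :
    |∑ k ∈ Finset.range N, (Int.fract (y + k * β) - 1 / 2)| ≤ 4 / κ * √N := by
  rcases Nat.eq_zero_or_pos N with rfl | hN0
  · simp
  -- Dirichlet at scale `√N` balances the two terms `N / m` and `m`: the denominator is at most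
  -- `√N`, and bad approximability makes it at least `κ √N`.
  have hQ : 0 < Nat.sqrt N := Nat.sqrt_pos.2 hN0
  obtain ⟨r, hr1, hr2⟩ := Real.exists_rat_abs_sub_le_and_den_le β hQ
  have hm : 0 < r.den := r.den_pos
  have hmr : (0 : ℝ) < r.den := by positivity
  have hrq : (r : ℝ) = r.num / r.den := by
    exact_mod_cast (Rat.num_div_den r).symm
  rw [hrq] at hr1
  have hcop : IsCoprime r.num (r.den : ℤ) := by
    rw [Int.isCoprime_iff_gcd_eq_one]; exact r.reduced
  have hmQ : (r.den : ℝ) ≤ Nat.sqrt N := by exact_mod_cast hr2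
  have hβ' : |β - r.num / r.den| ≤ 1 / (r.den : ℝ) ^ 2 := by
    refine hr1.trans ?_
    rw [sq]
    gcongr
    linarith
  refine (abs_sum_fract_le_of_approx hm hcop hβ' N y).trans ?_
  have hlow : κ * (Nat.sqrt N + 1) ≤ r.den := by
    have h1 := hβ r.den hm (lt_of_le_of_lt (hr2.trans (Nat.sqrt_le_self N)) hN) r.num
    have h2 : |(r.den : ℝ) * β - r.num| ≤ 1 / (Nat.sqrt N + 1) := by
      have : (r.den : ℝ) * β - r.num = r.den * (β - r.num / r.den) := by field_simp
      rw [this, abs_mul, abs_of_pos hmr]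
      calc _ ≤ (r.den : ℝ) * (1 / ((Nat.sqrt N + 1) * r.den)) := by gcongr
        _ = _ := by field_simp
    have h3 : κ ≤ r.den * (1 / (Nat.sqrt N + 1)) := h1.trans (by gcongr)
    rw [mul_one_div, le_div_iff₀ (by positivity)] at h3
    exact h3
  have hs1 : √(N : ℝ) ≤ Nat.sqrt N + 1 := by
    exact_mod_cast Real.real_sqrt_le_nat_sqrt_succ
  have hs2 : (Nat.sqrt N : ℝ) ≤ √N := Real.nat_sqrt_le_real_sqrt
  have hsN : 0 < √(N : ℝ) := Real.sqrt_pos.2 (by exact_mod_cast hN0)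
  have h4 : κ * √(N : ℝ) ≤ r.den := le_trans (by gcongr) hlow
  have h5 : 3 * (N : ℝ) / r.den ≤ 3 / κ * √N := by
    rw [div_mul_eq_mul_div, div_le_div_iff₀ hmr hκ]
    have : (N : ℝ) = √N * √N := (Real.mul_self_sqrt (by positivity)).symm
    calc 3 * (N : ℝ) * κ = 3 * √N * (κ * √N) := by nlinarith
      _ ≤ 3 * √N * r.den := by gcongr
  have h6 : (r.den : ℝ) ≤ 1 / κ * √N := by
    have : 1 ≤ 1 / κ := by rw [le_div_iff₀ hκ]; linarith
    nlinarith
  calc _ ≤ 3 / κ * √N + 1 / κ * √N := add_le_add h5 h6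
    _ = _ := by ring

/-! ### Trigonometric products along a rotation -/

/-- Abel summation: against nonnegative decreasing weights, a sequence whose partial sums are
dominated by `γ` does no worse than the increments of `γ`. -/
theorem abs_sum_mul_le_of_antitone {w b γ : ℕ → ℝ} {h : ℕ} (hw0 : ∀ k < h, 0 ≤ w k)
    (hw : ∀ k, k + 1 < h → w (k + 1) ≤ w k) (hγ0 : γ 0 = 0)
    (hb : ∀ N ≤ h, |∑ k ∈ Finset.range N, b k| ≤ γ N) :
    |∑ k ∈ Finset.range h, w k * b k| ≤ ∑ k ∈ Finset.range h, w k * (γ (k + 1) - γ k) := by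
  rcases h with _ | h
  · simp
  -- Removing the boundary term of the Abel summation leaves only terms weighted by `w k - w (k +
  -- 1)`, which is what makes an induction possible.
  have key : ∀ n ≤ h, |∑ k ∈ Finset.range (n + 1), w k * b k -
      w n * ∑ k ∈ Finset.range (n + 1), b k| ≤
      ∑ k ∈ Finset.range (n + 1), w k * (γ (k + 1) - γ k) - w n * γ (n + 1) := by
    intro n hn
    induction n with
    | zero => simp [hγ0]
    | succ n ih =>
      have h1 := ih (by omega)
      have h2 := hb (n + 1) (by omega)
      have h3 := hw n (by omega)
      rw [Finset.sum_range_succ _ (n + 1), Finset.sum_range_succ (fun k => b k) (n + 1),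
        Finset.sum_range_succ _ (n + 1)]
      have e : ∑ k ∈ Finset.range (n + 1), w k * b k + w (n + 1) * b (n + 1) -
          w (n + 1) * (∑ k ∈ Finset.range (n + 1), b k + b (n + 1)) =
          (∑ k ∈ Finset.range (n + 1), w k * b k - w n * ∑ k ∈ Finset.range (n + 1), b k) +
            (w n - w (n + 1)) * ∑ k ∈ Finset.range (n + 1), b k := by ring
      rw [e]
      refine (abs_add_le _ _).trans ?_
      rw [abs_mul, abs_of_nonneg (sub_nonneg.2 h3)]
      have h4 := mul_le_mul_of_nonneg_left h2 (sub_nonneg.2 h3)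
      linarith
  have h1 := key h le_rfl
  have h2 := hb (h + 1) le_rfl
  have h3 : |w h * ∑ k ∈ Finset.range (h + 1), b k| ≤ w h * γ (h + 1) := by
    rw [abs_mul, abs_of_nonneg (hw0 h (by omega))]
    exact mul_le_mul_of_nonneg_left h2 (hw0 h (by omega))
  calc _ = |(∑ k ∈ Finset.range (h + 1), w k * b k - w h * ∑ k ∈ Finset.range (h + 1), b k) +
        w h * ∑ k ∈ Finset.range (h + 1), b k| := by congr 1; ring
    _ ≤ _ := (abs_add_le _ _).trans (by linarith)

/-- The terms after the first telescope: with `a = √k` and `b = √(k + 1)`, `(b - a) / b² ≤ 1 / a - 1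
/ b`. -/
theorem sum_sqrt_diff_div_le (h : ℕ) :
    ∑ k ∈ Finset.range h, (√((k : ℝ) + 1) - √k) / (k + 1) ≤ 2 := by
  suffices H : ∀ n : ℕ, ∑ k ∈ Finset.range (n + 1), (√((k : ℝ) + 1) - √k) / (k + 1) ≤
      2 - 1 / √((n : ℝ) + 1) by
    rcases h with _ | h
    · simp
    · have := H h
      have h2 : 0 ≤ 1 / √((h : ℝ) + 1) := by positivity
      linarith
  intro n
  induction n with
  | zero => norm_num
  | succ n ih =>
    rw [Finset.sum_range_succ]
    push_cast at ih ⊢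
    set a := √((n : ℝ) + 1) with ha
    set b := √((n : ℝ) + 1 + 1) with hb
    have ha0 : 0 < a := by positivity
    have hb0 : 0 < b := by positivity
    have hab : a ≤ b := Real.sqrt_le_sqrt (by linarith)
    have hb2 : (n : ℝ) + 1 + 1 = b * b := (Real.mul_self_sqrt (by positivity)).symm
    have h1 : (b - a) / ((n : ℝ) + 1 + 1) ≤ 1 / a - 1 / b := by
      rw [hb2, div_sub_div _ _ ha0.ne' hb0.ne', div_le_div_iff₀ (by positivity) (by positivity)]
      nlinarith [mul_nonneg (mul_nonneg (sub_nonneg.2 hab) hb0.le) (sub_nonneg.2 hab)]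
    linarith

theorem cot_le_cot {x y : ℝ} (hx : 0 < x) (hxy : x ≤ y) (hy : y < Real.pi) :
    Real.cot y ≤ Real.cot x := by
  have h1 := Real.sin_pos_of_pos_of_lt_pi hx (by linarith)
  have h2 := Real.sin_pos_of_pos_of_lt_pi (by linarith : 0 < y) hy
  rw [Real.cot_eq_cos_div_sin, Real.cot_eq_cos_div_sin, div_le_div_iff₀ h2 h1]
  have := Real.sin_nonneg_of_nonneg_of_le_pi (sub_nonneg.2 hxy) (by linarith)
  rw [Real.sin_sub] at this
  linarith

theorem cot_le_inv {x : ℝ} (hx : 0 < x) (hx' : x < Real.pi) : Real.cot x ≤ 1 / x := by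
  have h1 := Real.sin_pos_of_pos_of_lt_pi hx hx'
  rw [Real.cot_eq_cos_div_sin, div_le_div_iff₀ h1 hx]
  rcases lt_or_ge x (Real.pi / 2) with h | h
  · have h2 := Real.lt_tan hx h
    have h3 := Real.cos_pos_of_mem_Ioo ⟨by linarith, h⟩
    rw [Real.tan_eq_sin_div_cos, lt_div_iff₀ h3] at h2
    linarith
  · have h3 := Real.cos_nonpos_of_pi_div_two_le_of_le h (by linarith)
    nlinarith

/-- This is the tangent line inequality for the concave function `log sin`, exponentiated. In the
proof, `φ` has derivative of the sign of `sin (a - t)`, hence its maximum at `a`. -/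
theorem sin_le_sin_mul_exp_cot {a b : ℝ} (ha : 0 < a) (ha' : a < Real.pi) (hb : 0 < b)
    (hb' : b < Real.pi) : Real.sin b ≤ Real.sin a * Real.exp (Real.cot a * (b - a)) := by
  have hsa := Real.sin_pos_of_pos_of_lt_pi ha ha'
  set φ : ℝ → ℝ := fun t => Real.sin t * Real.exp (-(Real.cot a * t)) with hφ
  have hd : ∀ t, HasDerivAt φ (Real.sin (a - t) / Real.sin a * Real.exp (-(Real.cot a * t))) t := by
    intro t
    have h1 : HasDerivAt (fun t : ℝ => -(Real.cot a * t)) (-(Real.cot a)) t := by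
      simpa [neg_mul] using (hasDerivAt_id' t).const_mul (-Real.cot a)
    refine ((Real.hasDerivAt_sin t).mul h1.exp).congr_deriv ?_
    rw [Real.sin_sub, Real.cot_eq_cos_div_sin]
    field_simp
    ring
  have hc : Continuous φ := by fun_prop
  have key : φ b ≤ φ a := by
    rcases le_total b a with h | h
    · refine (monotoneOn_of_deriv_nonneg (convex_Icc b a) hc.continuousOn
        (fun t _ => (hd t).differentiableAt.differentiableWithinAt) ?_)
        (Set.left_mem_Icc.2 h) (Set.right_mem_Icc.2 h) h
      intro t ht
      rw [interior_Icc] at ht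
      rw [(hd t).deriv]
      have := Real.sin_nonneg_of_nonneg_of_le_pi (x := a - t) (by linarith [ht.2])
        (by linarith [ht.1])
      positivity
    · refine (antitoneOn_of_deriv_nonpos (convex_Icc a b) hc.continuousOn
        (fun t _ => (hd t).differentiableAt.differentiableWithinAt) ?_)
        (Set.left_mem_Icc.2 h) (Set.right_mem_Icc.2 h) h
      intro t ht
      rw [interior_Icc] at ht
      rw [(hd t).deriv]
      have := Real.sin_nonneg_of_nonneg_of_le_pi (x := t - a) (by linarith [ht.1])
        (by linarith [ht.2])
      have h2 : Real.sin (a - t) = - Real.sin (t - a) := by rw [← Real.sin_neg]; ring_nf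
      rw [h2, neg_div, neg_mul]
      have : 0 ≤ Real.sin (t - a) / Real.sin a * Real.exp (-(Real.cot a * t)) := by positivity
      linarith
  simp only [hφ] at key
  rw [Real.exp_neg, Real.exp_neg, ← div_eq_mul_inv, ← div_eq_mul_inv,
    div_le_div_iff₀ (Real.exp_pos _) (Real.exp_pos _)] at key
  rw [mul_sub, Real.exp_sub, mul_div_assoc', le_div_iff₀ (Real.exp_pos _)]
  exact key

theorem norm_one_sub_exp (t : ℝ) :
    ‖1 - Complex.exp (2 * Real.pi * Complex.I * t)‖ = |2 * Real.sin (Real.pi * t)| := by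
  have h : Complex.exp (2 * Real.pi * Complex.I * t) =
      Complex.exp (((2 * (Real.pi * t) : ℝ) : ℂ) * Complex.I) := by
    congr 1; push_cast; ring
  rw [h, Complex.exp_mul_I, ← Complex.ofReal_cos, ← Complex.ofReal_sin]
  rw [← abs_norm, ← sq_eq_sq_iff_abs_eq_abs, ← Complex.normSq_eq_norm_sq, Complex.normSq_apply]
  simp only [Complex.sub_re, Complex.sub_im, Complex.add_re, Complex.add_im, Complex.mul_re,
    Complex.mul_im, Complex.ofReal_re, Complex.ofReal_im, Complex.I_re, Complex.I_im,
    Complex.one_re, Complex.one_im]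
  rw [Real.cos_two_mul, Real.sin_two_mul]
  nlinarith [Real.sin_sq_add_cos_sq (Real.pi * t)]

/-- Take norms in `∏ (1 - ζ ^ k) = n + 1` over the nontrivial powers of a primitive root of unity
`ζ`. -/
theorem prod_two_mul_sin (n : ℕ) :
    ∏ k ∈ Finset.range n, (2 * Real.sin (Real.pi * ((k + 1 : ℝ) / (n + 1)))) = n + 1 := by
  have h := (Complex.isPrimitiveRoot_exp (n + 1) (by omega)).prod_one_sub_pow_eq_order
  have h2 := congrArg norm h
  rw [norm_prod] at h2
  have h3 : ‖((n : ℂ) + 1)‖ = n + 1 := by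
    have : ((n : ℂ) + 1) = ((n + 1 : ℕ) : ℂ) := by push_cast; ring
    rw [this, Complex.norm_natCast]; push_cast; ring
  rw [h3] at h2
  refine Eq.trans ?_ h2
  refine Finset.prod_congr rfl fun k hk => ?_
  have hk' : (k : ℝ) + 1 < n + 1 := by exact_mod_cast Nat.succ_lt_succ (Finset.mem_range.1 hk)
  have e : Complex.exp (2 * Real.pi * Complex.I / ((n + 1 : ℕ) : ℂ)) ^ (k + 1) =
      Complex.exp (2 * Real.pi * Complex.I * (((k + 1 : ℝ) / (n + 1) : ℝ) : ℂ)) := by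
    rw [← Complex.exp_nat_mul]
    congr 1; push_cast; ring
  have h0 : 0 ≤ Real.pi * ((k + 1 : ℝ) / (n + 1)) := by positivity
  rw [e, norm_one_sub_exp, abs_of_nonneg]
  refine mul_nonneg zero_le_two (Real.sin_nonneg_of_nonneg_of_le_pi h0 ?_)
  have : (k + 1 : ℝ) / (n + 1) ≤ 1 := by rw [div_le_one (by positivity)]; exact hk'.le
  nlinarith [Real.pi_pos]

/-- Goodness of the approximation `p / q` of `α` in comparison with smaller denominators is
inherited by the inverse `b` of `p` modulo `q`. -/
theorem le_mul_abs_of_inverse {α A : ℝ} {q : ℕ} {p b : ℤ} (hq : 0 < q) (hA : 1 ≤ A)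
    (hpb : (q : ℤ) ∣ p * b - 1) (hε1 : |α - p / q| * q ^ 2 ≤ 1)
    (hgood : ∀ m : ℕ, 0 < m → m < q → ∀ r : ℤ, |α - p / q| * q ^ 2 ≤ A * (m * |m * α - r|))
    {k : ℕ} (hk : 0 < k) (hkq : k < q) (r : ℤ) :
    |α - p / q| * q ^ 2 / (2 * A) ≤ k * |k * (b / q : ℝ) - r| := by
  have hqr : (0 : ℝ) < q := by positivity
  have hkr : (1 : ℝ) ≤ k := by exact_mod_cast hk
  set ε := |α - p / q| * q ^ 2 with hε
  have hε0 : 0 ≤ ε := by positivity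
  -- `i` is the numerator of `k b / q - r`. Since `p i ≡ k` modulo `q`, a small `i` is a denominator
  -- for which `i α` is close to an integer, and this is limited by `hgood`.
  set i : ℤ := k * b - r * q with hi
  have e1 : (k : ℝ) * (b / q : ℝ) - r = i / q := by
    rw [hi]; push_cast; field_simp
  rw [e1, abs_div, Nat.abs_cast]
  have hA' : ε / (2 * A) ≤ 1 := by
    rw [div_le_one (by linarith)]; linarith
  rcases le_or_gt (q : ℤ) |i| with h | h
  · have h1 : (q : ℝ) ≤ |(i : ℝ)| := by exact_mod_cast h
    have h2 : 1 ≤ |(i : ℝ)| / q := by rw [le_div_iff₀ hqr]; linarith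
    nlinarith
  · obtain ⟨t, ht⟩ : (q : ℤ) ∣ p * i - k := by
      have : p * i - k = k * (p * b - 1) - p * r * q := by rw [hi]; ring
      rw [this]
      exact dvd_sub (Dvd.dvd.mul_left hpb _) (Dvd.intro_left _ rfl)
    have hi0 : i ≠ 0 := by
      intro h0
      rw [h0, mul_zero, zero_sub] at ht
      have h3 : (q : ℤ) ∣ k := ⟨-t, by linarith⟩
      have := Int.le_of_dvd (by exact_mod_cast hk) h3
      omega
    have hm0 : 0 < i.natAbs := Int.natAbs_pos.2 hi0
    have hmq : i.natAbs < q := by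
      have := Int.abs_eq_natAbs i
      omega
    have htr : (p : ℝ) * i - k = q * t := by exact_mod_cast ht
    -- The factor 2 comes from `k / q` plus the error of replacing `α` by `p / q`, which is at most
    -- `1 / q ≤ k / q`.
    have hbound : |(i : ℝ) * α - t| ≤ 2 * k / q := by
      have e2 : (i : ℝ) * α - t = k / q + i * (α - p / q) := by
        have : (t : ℝ) = (p * i - k) / q := by rw [htr]; field_simp
        rw [this]; field_simp; ring
      have hiq : |(i : ℝ)| ≤ q := by exact_mod_cast h.le
      rw [e2]
      calc |(k : ℝ) / q + i * (α - p / q)| ≤ |(k : ℝ) / q| + |(i : ℝ) * (α - p / q)| :=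
            abs_add_le _ _
        _ = k / q + |(i : ℝ)| * |α - p / q| := by
            rw [abs_mul, abs_of_nonneg (by positivity : (0 : ℝ) ≤ k / q)]
        _ ≤ k / q + q * |α - p / q| := by gcongr
        _ = k / q + ε / q := by rw [hε]; field_simp
        _ ≤ k / q + k / q := by gcongr; linarith
        _ = _ := by ring
    have hcast : (i.natAbs : ℝ) = |(i : ℝ)| := by
      rw [Nat.cast_natAbs, Int.cast_abs]
    have hfin : ε ≤ A * (|(i : ℝ)| * (2 * k / q)) := by
      rcases lt_or_gt_of_ne hi0 with hneg | hpos
      · have h1 := hgood i.natAbs hm0 hmq (-t)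
        have e3 : |(i.natAbs : ℝ) * α - (-t : ℤ)| = |(i : ℝ) * α - t| := by
          rw [hcast, abs_of_neg (by exact_mod_cast hneg : (i : ℝ) < 0), ← abs_neg]
          congr 1; push_cast; ring
        rw [e3, hcast] at h1
        exact h1.trans (by gcongr)
      · have h1 := hgood i.natAbs hm0 hmq t
        have e3 : |(i.natAbs : ℝ) * α - t| = |(i : ℝ) * α - t| := by
          rw [hcast, abs_of_pos (by exact_mod_cast hpos : (0 : ℝ) < i)]
        rw [e3, hcast] at h1
        exact h1.trans (by gcongr)
    rw [div_le_iff₀ (by linarith)]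
    calc ε ≤ A * (|(i : ℝ)| * (2 * k / q)) := hfin
      _ = _ := by field_simp

theorem abs_sum_fract_sub_fract_le {q : ℕ} {β κ : ℝ} (hκ : 0 < κ) (hκ1 : κ ≤ 1)
    (hβ : ∀ k : ℕ, 0 < k → k < q → ∀ r : ℤ, κ ≤ k * |k * β - r|) {N : ℕ} (hN : N < q) (y : ℝ) :
    |∑ k ∈ Finset.range N, (Int.fract (y + (k + 1) * β) - Int.fract (y - (k + 1) * β))| ≤
      8 / κ * √N := by
  have h1 := abs_sum_fract_le_sqrt hκ hκ1 hβ hN (y + β)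
  have hβ' : ∀ k : ℕ, 0 < k → k < q → ∀ r : ℤ, κ ≤ k * |k * (-β) - r| := by
    intro k hk hkq r
    have := hβ k hk hkq (-r)
    rw [← abs_neg] at this
    convert this using 3
    push_cast; ring
  have h2 := abs_sum_fract_le_sqrt hκ hκ1 hβ' hN (y - β)
  have e : ∑ k ∈ Finset.range N, (Int.fract (y + (k + 1) * β) - Int.fract (y - (k + 1) * β)) =
      ∑ k ∈ Finset.range N, (Int.fract (y + β + k * β) - 1 / 2) -
        ∑ k ∈ Finset.range N, (Int.fract (y - β + k * (-β)) - 1 / 2) := by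
    rw [← Finset.sum_sub_distrib]
    refine Finset.sum_congr rfl fun k _ => ?_
    have a1 : y + (k + 1) * β = y + β + k * β := by ring
    have a2 : y - (k + 1) * β = y - β + k * (-β) := by ring
    rw [a1, a2]; ring
  rw [e]
  refine (abs_sub _ _).trans ((add_le_add h1 h2).trans (le_of_eq ?_))
  ring

/-- A cotangent sum of Dedekind type for a badly approximable slope. -/
theorem abs_sum_cot_mul_fract_le {n : ℕ} {β κ : ℝ} (hκ : 0 < κ) (hκ1 : κ ≤ 1)
    (hβ : ∀ k : ℕ, 0 < k → k < n + 1 → ∀ r : ℤ, κ ≤ k * |k * β - r|) (y : ℝ) (b : ℤ)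
    (hb : ((n : ℝ) + 1) * β = b) :
    |∑ k ∈ Finset.range n,
      Real.cot (Real.pi * ((k + 1 : ℝ) / (n + 1))) * Int.fract (y + (k + 1) * β)| ≤
      16 / κ * ((n + 1) / Real.pi) := by
  have hpi := Real.pi_pos
  set ang : ℕ → ℝ := fun k => Real.pi * ((k + 1 : ℝ) / (n + 1)) with hang
  -- Since the cotangent is odd about `π / 2`, the sum folds onto its positive part, which is
  -- decreasing and hence fit for Abel summation.
  set w : ℕ → ℝ := fun k => max (Real.cot (ang k)) 0 with hw
  have hang0 : ∀ k, 0 < ang k := fun k => by simp only [hang]; positivity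
  have hang1 : ∀ k < n, ang k < Real.pi := by
    intro k hk
    have : (k + 1 : ℝ) / (n + 1) < 1 := by
      rw [div_lt_one (by positivity)]
      exact_mod_cast Nat.succ_lt_succ hk
    simp only [hang]
    nlinarith
  have hrefl : ∀ k < n, ang (n - 1 - k) = Real.pi - ang k := by
    intro k hk
    simp only [hang]
    have : ((n - 1 - k : ℕ) : ℝ) = n - 1 - k := by
      rw [Nat.sub_sub, Nat.cast_sub (by omega)]; push_cast; ring
    rw [this]; field_simp; ring
  have hcot : ∀ k < n, Real.cot (ang k) = w k - w (n - 1 - k) := by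
    intro k hk
    simp only [hw]
    rw [hrefl k hk]
    have : Real.cot (Real.pi - ang k) = - Real.cot (ang k) := by
      rw [Real.cot_eq_cos_div_sin, Real.cot_eq_cos_div_sin, Real.cos_pi_sub, Real.sin_pi_sub]; ring
    rw [this]
    rcases le_total (Real.cot (ang k)) 0 with h | h
    · rw [max_eq_right h, max_eq_left (by linarith)]; ring
    · rw [max_eq_left h, max_eq_right (by linarith)]; ring
  -- Reflecting `k` replaces `(k + 1) β` by `-(k + 1) β` modulo one, because `(n + 1) β` is an
  -- integer.
  have hsum : ∑ k ∈ Finset.range n, Real.cot (ang k) * Int.fract (y + (k + 1) * β) =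
      ∑ k ∈ Finset.range n, w k *
        (Int.fract (y + (k + 1) * β) - Int.fract (y - (k + 1) * β)) := by
    have h1 : ∑ k ∈ Finset.range n, w (n - 1 - k) * Int.fract (y + (k + 1) * β) =
        ∑ k ∈ Finset.range n, w k * Int.fract (y - (k + 1) * β) := by
      rw [← Finset.sum_range_reflect]
      refine Finset.sum_congr rfl fun k hk => ?_
      have hk' := Finset.mem_range.1 hk
      have e1 : n - 1 - (n - 1 - k) = k := by omega
      have e2 : ((n - 1 - k : ℕ) : ℝ) = n - 1 - k := by
        rw [Nat.sub_sub, Nat.cast_sub (by omega)]; push_cast; ring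
      have e3 : y + ((n : ℝ) - 1 - k + 1) * β = y - (k + 1) * β + b := by rw [← hb]; ring
      rw [e1, e2, e3, Int.fract_add_intCast]
    simp_rw [mul_sub]
    rw [Finset.sum_sub_distrib, ← h1, ← Finset.sum_sub_distrib]
    refine Finset.sum_congr rfl fun k hk => ?_
    rw [hcot k (Finset.mem_range.1 hk)]; ring
  rw [hsum]
  have hγ : ∀ N ≤ n, |∑ k ∈ Finset.range N,
      (Int.fract (y + (k + 1) * β) - Int.fract (y - (k + 1) * β))| ≤ 8 / κ * √N := fun N hN =>
    abs_sum_fract_sub_fract_le hκ hκ1 hβ (by omega) y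
  refine (abs_sum_mul_le_of_antitone (γ := fun N : ℕ => 8 / κ * √(N : ℝ))
    (fun k _ => le_max_right _ _) ?_ (by simp) hγ).trans ?_
  · intro k hk
    refine max_le_max (cot_le_cot (hang0 k) ?_ (hang1 _ hk)) le_rfl
    simp only [hang]
    gcongr
    linarith
  -- The weights are at most `(n + 1) / (π (k + 1))`, so square-root cancellation leaves a
  -- convergent sum and no logarithm.
  · have hwle : ∀ k ∈ Finset.range n, w k * (8 / κ * √((k + 1 : ℕ) : ℝ) - 8 / κ * √(k : ℝ)) ≤
        8 / κ * ((n + 1) / Real.pi) * ((√((k : ℝ) + 1) - √k) / (k + 1)) := by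
      intro k hk
      have h1 : w k ≤ 1 / ang k := max_le (cot_le_inv (hang0 k) (hang1 k (Finset.mem_range.1 hk)))
        (by have := hang0 k; positivity)
      have h2 : 0 ≤ √((k : ℝ) + 1) - √k := sub_nonneg.2 (Real.sqrt_le_sqrt (by linarith))
      push_cast
      rw [← mul_sub]
      calc w k * (8 / κ * (√((k : ℝ) + 1) - √k)) ≤
            1 / ang k * (8 / κ * (√((k : ℝ) + 1) - √k)) := by gcongr
        _ = _ := by simp only [hang]; field_simp
    refine (Finset.sum_le_sum hwle).trans ?_
    rw [← Finset.mul_sum]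
    have := sum_sqrt_diff_div_le n
    calc _ ≤ 8 / κ * ((n + 1) / Real.pi) * 2 := by gcongr
      _ = _ := by ring

theorem sum_cot_eq_zero (n : ℕ) :
    ∑ k ∈ Finset.range n, Real.cot (Real.pi * ((k + 1 : ℝ) / (n + 1))) = 0 := by
  have h : ∑ k ∈ Finset.range n, Real.cot (Real.pi * ((k + 1 : ℝ) / (n + 1))) =
      - ∑ k ∈ Finset.range n, Real.cot (Real.pi * ((k + 1 : ℝ) / (n + 1))) := by
    conv_lhs => rw [← Finset.sum_range_reflect]
    rw [← Finset.sum_neg_distrib]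
    refine Finset.sum_congr rfl fun k hk => ?_
    have hk' := Finset.mem_range.1 hk
    have e2 : ((n - 1 - k : ℕ) : ℝ) = n - 1 - k := by
      rw [Nat.sub_sub, Nat.cast_sub (by omega)]; push_cast; ring
    have e3 : Real.pi * (((n - 1 - k : ℕ) : ℝ) + 1) / (n + 1) =
      Real.pi - Real.pi * ((k + 1 : ℝ) / (n + 1)) := by rw [e2]; field_simp; ring
    rw [← mul_div_assoc, e3, Real.cot_eq_cos_div_sin, Real.cot_eq_cos_div_sin, Real.cos_pi_sub,
      Real.sin_pi_sub]
    ring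
  linarith

/-- Modulo one the orbit consists of small perturbations `k / q + t_k` of the multiples of `1 / q`.
The tangent bound for `log sin` turns the perturbations into `∑ cot (πk/q) t_k`. The constant part
of `t_k` cancels, and the rest is `α - p/q` times a Dedekind-type sum of slope `b / q`, where `b`
inverts `p` modulo `q`. -/
theorem prod_abs_sin_le_of_nonneg {α A : ℝ} {q : ℕ} {p : ℤ} (hq : 0 < q) (hA : 1 ≤ A)
    (hp : IsCoprime p (q : ℤ)) (hδ : 0 < α - p / q) (hε1 : |α - p / q| * q ^ 2 ≤ 1)
    (hgood : ∀ m : ℕ, 0 < m → m < q → ∀ r : ℤ, |α - p / q| * q ^ 2 ≤ A * (m * |m * α - r|))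
    (x : ℝ) :
    ∏ j ∈ Finset.range q, |2 * Real.sin (Real.pi * (x + j * α))| ≤
      2 * Real.pi * Real.exp (32 * A) := by
  have hpi := Real.pi_pos
  obtain ⟨b, c, hbc⟩ := hp
  have hpb : (q : ℤ) ∣ p * b - 1 := ⟨-c, by linarith⟩
  have hb : IsCoprime b (q : ℤ) := ⟨p, c, by linarith⟩
  have hinv := fun k (hk : 0 < k) (hkq : k < q) r =>
    le_mul_abs_of_inverse hq hA hpb hε1 hgood hk hkq r
  obtain ⟨n, rfl⟩ : ∃ n, q = n + 1 := ⟨q - 1, by omega⟩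
  set δ := α - p / ((n + 1 : ℕ) : ℝ) with hδd
  rw [abs_of_pos hδ] at hε1 hinv
  set κ : ℝ := δ * ((n + 1 : ℕ) : ℝ) ^ 2 / (2 * A) with hκd
  have hqr : (0 : ℝ) < (n + 1 : ℝ) := by positivity
  have hκ : 0 < κ := by positivity
  have hκ1 : κ ≤ 1 := by rw [hκd, div_le_one (by linarith)]; linarith
  -- Rounding up gives `s ∈ (-1, 0]`. As the drift `τ k * δ` lies in `[0, 1/q)`, every `t k` stays
  -- in `(-1/q, 1/q)`.
  set n0 : ℤ := ⌈((n + 1 : ℕ) : ℝ) * x⌉ with hn0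
  set s : ℝ := ((n + 1 : ℕ) : ℝ) * x - n0 with hs
  have hs0 : s ≤ 0 := by have := Int.le_ceil (((n + 1 : ℕ) : ℝ) * x); linarith
  have hs1 : -1 < s := by have := Int.ceil_lt_add_one (((n + 1 : ℕ) : ℝ) * x); linarith
  -- `τ k` is the time at which the orbit point is nearest to `k / q`, that is, `τ k * p ≡ k - n0`
  -- modulo `q`.
  set τ : ℕ → ℕ := fun k => ((-n0 * b + k * b) % ((n + 1 : ℕ) : ℤ)).toNat with hτ
  have hnz : ((n + 1 : ℕ) : ℤ) ≠ 0 := by positivity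
  have hτz : ∀ k, ((τ k : ℕ) : ℤ) = (-n0 * b + k * b) % ((n + 1 : ℕ) : ℤ) := fun k =>
    Int.toNat_of_nonneg (Int.emod_nonneg _ hnz)
  have hτn : ∀ k, (τ k : ℝ) ≤ n := by
    intro k
    have h1 := Int.emod_lt_of_pos (-n0 * b + k * b) (show (0 : ℤ) < ((n + 1 : ℕ) : ℤ) by positivity)
    rw [← hτz] at h1
    have h2 : τ k ≤ n := by omega
    exact_mod_cast h2
  have hτfract : ∀ k, (τ k : ℝ) = (n + 1) *
      Int.fract (((-n0 * b : ℤ) : ℝ) / (n + 1) + k * ((b : ℝ) / (n + 1))) := by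
    intro k
    have h1 : ((-n0 * b : ℤ) : ℝ) / (n + 1) + k * ((b : ℝ) / (n + 1)) =
        ((-n0 * b + k * b : ℤ) : ℝ) / ((n + 1 : ℕ) : ℝ) := by push_cast; field_simp
    rw [h1, Int.fract_div_intCast_eq_div_intCast_mod, ← hτz]
    push_cast; field_simp
  have hτδ : ∀ k, (τ k : ℝ) * δ < 1 / (n + 1) := by
    intro k
    have h1 : (τ k : ℝ) * δ ≤ n * δ := mul_le_mul_of_nonneg_right (hτn k) hδ.le
    refine lt_of_le_of_lt h1 ?_
    rw [lt_div_iff₀ hqr]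
    push_cast at hε1
    nlinarith
  set t : ℕ → ℝ := fun k => s / (n + 1) + τ k * δ with ht
  rw [← prod_toNat_emod hq hb (-n0 * b) (fun j => |2 * Real.sin (Real.pi * (x + j * α))|)]
  have hterm : ∀ k : ℕ, |2 * Real.sin (Real.pi * (x + τ k * α))| =
      |2 * Real.sin (Real.pi * (k / (n + 1) + t k))| := by
    intro k
    obtain ⟨u, hu⟩ : ∃ u : ℤ, (τ k : ℤ) * p = k - n0 + u * ((n + 1 : ℕ) : ℤ) := by
      have h1 := Int.emod_add_mul_ediv (-n0 * b + k * b) ((n + 1 : ℕ) : ℤ)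
      rw [← hτz] at h1
      obtain ⟨v, hv⟩ := hpb
      refine ⟨(k - n0) * v - ((-n0 * b + k * b) / ((n + 1 : ℕ) : ℤ)) * p, ?_⟩
      linear_combination p * h1 + (k - n0) * hv
    have hur := congrArg (Int.cast : ℤ → ℝ) hu
    push_cast at hur
    have e : x + τ k * α = k / (n + 1) + t k + u := by
      have h2 : α = p / (n + 1) + δ := by rw [hδd]; push_cast; ring
      rw [h2]
      simp only [ht, hs]
      push_cast
      field_simp
      linear_combination hur
    rw [e, mul_add Real.pi _ (u : ℝ), mul_comm Real.pi (u : ℝ), Real.sin_add_int_mul_pi]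
    rw [abs_mul, abs_mul, abs_mul, abs_zpow]
    simp
  have hprod : ∏ k ∈ Finset.range (n + 1), |2 * Real.sin (Real.pi * (x +
      (((-n0 * b + k * b) % ((n + 1 : ℕ) : ℤ)).toNat : ℕ) * α))| =
      ∏ k ∈ Finset.range (n + 1), |2 * Real.sin (Real.pi * (k / (n + 1) + t k))| :=
    Finset.prod_congr rfl fun k _ => hterm k
  rw [hprod, Finset.prod_range_succ']
  have htlo : ∀ k, -(1 / ((n : ℝ) + 1)) < t k := by
    intro k
    have h1 : -(1 / ((n : ℝ) + 1)) < s / (n + 1) := by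
      rw [← neg_div]; gcongr
    have h2 : 0 ≤ (τ k : ℝ) * δ := by positivity
    simp only [ht]; linarith
  have hthi : ∀ k, t k < 1 / ((n : ℝ) + 1) := by
    intro k
    have h1 : s / ((n : ℝ) + 1) ≤ 0 := div_nonpos_of_nonpos_of_nonneg hs0 hqr.le
    have := hτδ k
    simp only [ht]; linarith
  -- The factor near the zero of the sine is of order `1 / q`; it absorbs the `q` coming from the
  -- product over the nontrivial roots of unity.
  have hzero : |2 * Real.sin (Real.pi * ((0 : ℕ) / (n + 1) + t 0))| ≤ 2 * Real.pi / (n + 1) := by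
    rw [abs_mul, abs_two, Nat.cast_zero, zero_div, zero_add, mul_div_assoc]
    gcongr
    refine Real.abs_sin_le_abs.trans ?_
    rw [abs_mul, abs_of_pos hpi, div_eq_mul_one_div]
    gcongr
    exact abs_le.2 ⟨(htlo 0).le, (hthi 0).le⟩
  have hmain : ∏ k ∈ Finset.range n, |2 * Real.sin (Real.pi * (((k + 1 : ℕ) : ℝ) / (n + 1) +
      t (k + 1)))| ≤ (n + 1) * Real.exp (32 * A) := by
    have hfac : ∀ k ∈ Finset.range n, |2 * Real.sin (Real.pi * (((k + 1 : ℕ) : ℝ) / (n + 1) +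
        t (k + 1)))| ≤ (2 * Real.sin (Real.pi * ((k + 1 : ℝ) / (n + 1)))) *
          Real.exp (Real.cot (Real.pi * ((k + 1 : ℝ) / (n + 1))) * (Real.pi * t (k + 1))) := by
      intro k hk
      have hk' : (k : ℝ) + 1 + 1 ≤ n + 1 := by exact_mod_cast Nat.succ_lt_succ (Finset.mem_range.1 hk)
      push_cast
      have a0 : 0 < (k + 1 : ℝ) / (n + 1) := by positivity
      have a1 : (k + 1 : ℝ) / (n + 1) < 1 := by rw [div_lt_one hqr]; linarith
      have b0 : 0 < (k + 1 : ℝ) / (n + 1) + t (k + 1) := by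
        have h1 := htlo (k + 1)
        have h2 : 1 / ((n : ℝ) + 1) ≤ (k + 1 : ℝ) / (n + 1) := by gcongr; linarith
        linarith
      have b1 : (k + 1 : ℝ) / (n + 1) + t (k + 1) < 1 := by
        have h1 := hthi (k + 1)
        have h2 : (k + 1 : ℝ) / (n + 1) + 1 / (n + 1) ≤ 1 := by
          rw [← add_div, div_le_one hqr]; exact hk'
        linarith
      have h3 := sin_le_sin_mul_exp_cot (mul_pos hpi a0) (by nlinarith) (mul_pos hpi b0)
        (by nlinarith)
      have h4 := Real.sin_pos_of_pos_of_lt_pi (mul_pos hpi b0) (by nlinarith)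
      rw [abs_of_pos (by positivity)]
      have h5 : Real.pi * ((k + 1 : ℝ) / (n + 1) + t (k + 1)) - Real.pi * ((k + 1 : ℝ) / (n + 1)) =
        Real.pi * t (k + 1) := by ring
      rw [h5] at h3
      linarith
    refine (Finset.prod_le_prod (fun _ _ => abs_nonneg _) hfac).trans ?_
    rw [Finset.prod_mul_distrib, prod_two_mul_sin, ← Real.exp_sum]
    gcongr
    have hsplit : ∑ k ∈ Finset.range n, Real.cot (Real.pi * ((k + 1 : ℝ) / (n + 1))) *
        (Real.pi * t (k + 1)) = Real.pi * (s / (n + 1)) *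
          ∑ k ∈ Finset.range n, Real.cot (Real.pi * ((k + 1 : ℝ) / (n + 1))) +
        Real.pi * δ * (n + 1) * ∑ k ∈ Finset.range n, Real.cot (Real.pi * ((k + 1 : ℝ) / (n + 1))) *
          Int.fract (((-n0 * b : ℤ) : ℝ) / (n + 1) + (k + 1) * ((b : ℝ) / (n + 1))) := by
      rw [Finset.mul_sum, Finset.mul_sum, ← Finset.sum_add_distrib]
      refine Finset.sum_congr rfl fun k _ => ?_
      simp only [ht]
      rw [hτfract (k + 1)]
      push_cast
      ring
    rw [hsplit, sum_cot_eq_zero, mul_zero, zero_add]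
    have hc := abs_sum_cot_mul_fract_le (n := n) (β := (b : ℝ) / (n + 1)) hκ hκ1
      (fun k hk hkn r => by simpa using hinv k hk hkn r)
      (((-n0 * b : ℤ) : ℝ) / (n + 1)) b (by field_simp)
    calc _ ≤ Real.pi * δ * (n + 1) * (16 / κ * ((n + 1) / Real.pi)) := by
          gcongr
          exact (le_abs_self _).trans hc
      -- `κ` was chosen proportional to `δ q²`, so `δ` and `q` cancel.
      _ = 32 * A := by rw [hκd]; push_cast; field_simp; ring
  calc _ ≤ ((n + 1) * Real.exp (32 * A)) * (2 * Real.pi / (n + 1)) := by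
        gcongr
    _ = _ := by field_simp

/-- The sign of `α - p/q` is immaterial: `(α, p, x)` may be replaced by `(-α, -p, -x)`. -/
theorem prod_abs_sin_le {α A : ℝ} {q : ℕ} {p : ℤ} (hα : Irrational α) (hq : 0 < q) (hA : 1 ≤ A)
    (hp : IsCoprime p (q : ℤ)) (hε1 : |α - p / q| * q ^ 2 ≤ 1)
    (hgood : ∀ m : ℕ, 0 < m → m < q → ∀ r : ℤ, |α - p / q| * q ^ 2 ≤ A * (m * |m * α - r|))
    (x : ℝ) :
    ∏ j ∈ Finset.range q, |2 * Real.sin (Real.pi * (x + j * α))| ≤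
      2 * Real.pi * Real.exp (32 * A) := by
  have hne : α - p / q ≠ 0 := by
    have := hα.sub_ratCast ((p : ℚ) / q)
    push_cast at this
    exact this.ne_zero
  rcases lt_or_gt_of_ne hne with h | h
  · have hneg : -α - ((-p : ℤ) : ℝ) / q = -(α - p / q) := by push_cast; ring
    have h1 := prod_abs_sin_le_of_nonneg (α := -α) (p := -p) hq hA hp.neg_left
      (by rw [hneg]; linarith) (by rw [hneg, abs_neg]; exact hε1)
      (fun m hm hmq r => by
        rw [hneg, abs_neg]
        have e : |(m : ℝ) * -α - r| = |(m : ℝ) * α - ((-r : ℤ) : ℝ)| := by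
          rw [← abs_neg]; congr 1; push_cast; ring
        rw [e]
        exact hgood m hm hmq (-r)) (-x)
    refine le_trans (le_of_eq (Finset.prod_congr rfl fun j _ => ?_)) h1
    have e : Real.pi * (-x + j * -α) = -(Real.pi * (x + j * α)) := by ring
    rw [e, Real.sin_neg, mul_neg, abs_neg]
  · exact prod_abs_sin_le_of_nonneg hq hA hp h hε1 hgood x

/-! ### Denominators of nearly record approximation quality -/

theorem exists_pos_le_mul_abs_sub_int {α : ℝ} (hα : Irrational α) (Q : ℕ) :
    ∃ η > 0, η ≤ 1 ∧ ∀ m : ℕ, 0 < m → m ≤ Q → ∀ r : ℤ, η ≤ m * |m * α - r| := by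
  induction Q with
  | zero => exact ⟨1, one_pos, le_rfl, fun m h1 h2 => by omega⟩
  | succ Q ih =>
    obtain ⟨η, h0, h1, h2⟩ := ih
    have hpos : 0 < ((Q + 1 : ℕ) : ℝ) * |((Q + 1 : ℕ) : ℝ) * α - round (((Q + 1 : ℕ) : ℝ) * α)| := by
      have := ((hα.natCast_mul (Nat.succ_ne_zero Q)).sub_intCast
        (round (((Q + 1 : ℕ) : ℝ) * α))).ne_zero
      positivity
    refine ⟨min η (((Q + 1 : ℕ) : ℝ) * |((Q + 1 : ℕ) : ℝ) * α - round (((Q + 1 : ℕ) : ℝ) * α)|),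
      lt_min h0 hpos, (min_le_left _ _).trans h1, fun m hm hmQ r => ?_⟩
    rcases Nat.lt_or_ge Q m with h | h
    · obtain rfl : m = Q + 1 := by omega
      refine (min_le_right _ _).trans ?_
      exact mul_le_mul_of_nonneg_left (round_le (((Q + 1 : ℕ) : ℝ) * α) r) (Nat.cast_nonneg _)
    · exact (min_le_left _ _).trans (h2 m hm h r)

theorem abs_sub_div_mul_sq (α : ℝ) {q : ℕ} (hq : 0 < q) (p : ℤ) :
    |α - p / q| * (q : ℝ) ^ 2 = q * |q * α - p| := by
  have hqr : (0 : ℝ) < q := by positivity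
  have : (q : ℝ) * α - p = q * (α - p / q) := by field_simp
  rw [this, abs_mul, abs_of_pos hqr]; ring

/-- Every irrational has arbitrarily large denominators whose quality of approximation is, up to a
constant, a record. -/
theorem exists_record_approximations {α : ℝ} (hα : Irrational α) :
    ∃ A : ℝ, 1 ≤ A ∧ ∀ Q : ℕ, ∃ q : ℕ, ∃ p : ℤ, Q ≤ q ∧ 0 < q ∧ IsCoprime p (q : ℤ) ∧
      |α - p / q| * (q : ℝ) ^ 2 ≤ 1 ∧
      ∀ m : ℕ, 0 < m → m < q → ∀ r : ℤ, |α - p / q| * (q : ℝ) ^ 2 ≤ A * (m * |m * α - r|) := by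
  by_cases h : ∃ κ > 0, ∀ m : ℕ, 0 < m → ∀ r : ℤ, κ ≤ m * |m * α - r|
  -- Badly approximable `α`: every Dirichlet denominator is a record up to the factor `1 / κ`, and
  -- the lower bound `κ` forces these denominators to grow.
  · obtain ⟨κ, hκ, h⟩ := h
    refine ⟨max 1 (1 / κ), le_max_left _ _, fun Q => ?_⟩
    obtain ⟨n, hn⟩ := exists_nat_ge (Q / κ)
    obtain ⟨r, hr1, hr2⟩ := Real.exists_rat_abs_sub_le_and_den_le α (Nat.succ_pos n)
    have hm : 0 < r.den := r.den_pos
    have hmr : (0 : ℝ) < r.den := by positivity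
    have hrq : (r : ℝ) = r.num / r.den := by exact_mod_cast (Rat.num_div_den r).symm
    rw [hrq] at hr1
    have hε : |α - r.num / r.den| * (r.den : ℝ) ^ 2 ≤ r.den / ((n + 1 : ℕ) + 1) := by
      calc _ ≤ 1 / ((((n + 1 : ℕ) : ℝ) + 1) * r.den) * (r.den : ℝ) ^ 2 := by gcongr
        _ = _ := by field_simp
    have hε1 : |α - r.num / r.den| * (r.den : ℝ) ^ 2 ≤ 1 := by
      refine hε.trans ?_
      rw [div_le_one (by positivity)]
      have : (r.den : ℝ) ≤ (n + 1 : ℕ) := by exact_mod_cast hr2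
      linarith
    refine ⟨r.den, r.num, ?_, hm, ?_, hε1, ?_⟩
    · have h1 := h r.den hm r.num
      rw [← abs_sub_div_mul_sq α hm] at h1
      have h2 := h1.trans hε
      rw [le_div_iff₀ (by positivity)] at h2
      rw [div_le_iff₀ hκ] at hn
      have : (Q : ℝ) ≤ r.den := by push_cast at h2; nlinarith
      exact_mod_cast this
    · rw [Int.isCoprime_iff_gcd_eq_one]; exact r.reduced
    · intro m hm hmq s
      have h1 := h m hm s
      calc _ ≤ 1 := hε1
        _ = 1 / κ * κ := by field_simp
        _ ≤ max 1 (1 / κ) * (m * |m * α - s|) := by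
            gcongr
            exact le_max_right _ _
  · push Not at h
    refine ⟨1, le_rfl, fun Q => ?_⟩
    obtain ⟨η, hη0, hη1, hη⟩ := exists_pos_le_mul_abs_sub_int hα Q
    -- Otherwise the first denominator with quality below `η` is a genuine record, so `A = 1`
    -- serves. The choice of `η` forces it to exceed `Q`.
    have hex : ∃ m : ℕ, 0 < m ∧ ∃ r : ℤ, m * |m * α - r| < η := by
      obtain ⟨m, hm, r, hr⟩ := h η hη0
      exact ⟨m, hm, r, hr⟩
    classical
    obtain ⟨hq, p, hp⟩ := Nat.find_spec hex
    have hmin := fun m hm => Nat.find_min hex (m := m) hm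
    set q := Nat.find hex with hqdef
    refine ⟨q, p, ?_, hq, ?_, ?_, ?_⟩
    · by_contra hlt
      exact absurd (hη q hq (by omega) p) (not_le.2 hp)
    · rw [Int.isCoprime_iff_gcd_eq_one]
      set d := Int.gcd p q with hd
      have hd0 : 0 < d := Int.gcd_pos_of_ne_zero_right _ (by positivity)
      obtain ⟨p', hp'⟩ : (d : ℤ) ∣ p := Int.gcd_dvd_left ..
      obtain ⟨q', hq'⟩ : d ∣ q := by exact_mod_cast (Int.gcd_dvd_right .. : (d : ℤ) ∣ (q : ℤ))
      have hq'0 : 0 < q' := Nat.pos_of_ne_zero (by rintro rfl; omega)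
      -- Removing a common factor `d` divides the quality `q |qα - p|` by `d²`, contradicting
      -- minimality of `q`.
      have hle : q ≤ q' := by
        by_contra hlt
        refine hmin q' (by omega) ⟨hq'0, p', lt_of_le_of_lt ?_ hp⟩
        have h1 : (q : ℝ) * |q * α - p| = d ^ 2 * (q' * |q' * α - p'|) := by
          rw [hp', hq']; push_cast
          have : (d : ℝ) * q' * α - d * p' = d * (q' * α - p') := by ring
          rw [this, abs_mul, Nat.abs_cast]; ring
        rw [h1]
        have h2 : (1 : ℝ) ≤ d ^ 2 := one_le_pow₀ (by exact_mod_cast hd0)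
        exact le_mul_of_one_le_left (by positivity) h2
      have : d * q' ≤ 1 * q' := by omega
      have := Nat.le_of_mul_le_mul_right this hq'0
      omega
    · rw [abs_sub_div_mul_sq α hq]; linarith
    · intro m hm hmq r
      rw [abs_sub_div_mul_sq α hq, one_mul]
      by_contra hlt
      exact hmin m hmq ⟨hm, r, by linarith [not_le.1 hlt]⟩

/-! ### Bounded products on the circle -/

/-- The product is a polynomial in `a`, so the maximum principle reduces the closed disc to its
boundary circle. -/
theorem norm_prod_one_sub_le_of_norm_le_one {q : ℕ} {C : ℝ} {z : ℕ → ℂ}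
    (h : ∀ a : ℂ, ‖a‖ = 1 → ∏ j ∈ Finset.range q, ‖1 - a * z j‖ ≤ C) {a : ℂ} (ha : ‖a‖ ≤ 1) :
    ∏ j ∈ Finset.range q, ‖1 - a * z j‖ ≤ C := by
  have hd : Differentiable ℂ fun a : ℂ => ∏ j ∈ Finset.range q, (1 - a * z j) := by fun_prop
  have := Complex.norm_le_of_forall_mem_frontier_norm_le (U := Metric.ball (0 : ℂ) 1) (C := C)
    Metric.isBounded_ball hd.diffContOnCl (fun w hw => by
      rw [frontier_ball _ one_ne_zero, mem_sphere_zero_iff_norm] at hw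
      rw [norm_prod]; exact h w hw) (z := a) (by
      rw [closure_ball _ one_ne_zero, mem_closedBall_zero_iff]; exact ha)
  rwa [norm_prod] at this

theorem fourier_one_add (x y : UnitAddCircle) :
    fourier 1 (x + y) = fourier 1 x * fourier 1 y := by
  simp only [fourier_one, AddCircle.toCircle_add, Circle.coe_mul]

theorem norm_fourier_one (x : UnitAddCircle) : ‖fourier 1 x‖ = 1 := by
  rw [fourier_one]; exact Circle.norm_coe _

theorem exists_fourier_one_eq {a : ℂ} (ha : ‖a‖ = 1) : ∃ y : ℝ, fourier 1 (y : UnitAddCircle) = a := by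
  refine ⟨Complex.arg a / (2 * Real.pi), ?_⟩
  rw [fourier_coe_apply]
  conv_rhs => rw [← Complex.norm_mul_exp_arg_mul_I a, ha]
  have := Real.pi_ne_zero
  push_cast
  rw [one_mul]
  congr 1
  have : (Real.pi : ℂ) ≠ 0 := by exact_mod_cast this
  field_simp

theorem exists_bounded_products {α : ℝ} (hα : Irrational α) :
    ∃ C > 0, ∃ q : ℕ → ℕ, Tendsto q atTop atTop ∧
      Tendsto (fun n => q n • (α : UnitAddCircle)) atTop (𝓝 0) ∧
      ∀ n, ∀ a : ℂ, ‖a‖ ≤ 1 → ∀ x : UnitAddCircle,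
        ∏ j ∈ Finset.range (q n), ‖1 - a * fourier 1 (x + j • (α : UnitAddCircle))‖ ≤ C := by
  obtain ⟨A, hA, h⟩ := exists_record_approximations hα
  choose q p hQ hq0 hcop hε hgood using h
  have hqt : Tendsto q atTop atTop := tendsto_atTop_mono hQ tendsto_id
  refine ⟨2 * Real.pi * Real.exp (32 * A), by positivity, q, hqt, ?_, ?_⟩
  · have hreal : Tendsto (fun n => q n * α - p n) atTop (𝓝 0) := by
      rw [tendsto_zero_iff_abs_tendsto_zero]
      have h1 : Tendsto (fun n => 1 / (q n : ℝ)) atTop (𝓝 0) :=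
        tendsto_one_div_atTop_nhds_zero_nat.comp hqt
      refine squeeze_zero (fun _ => abs_nonneg _) (fun n => ?_) h1
      have h2 := hε n
      rw [abs_sub_div_mul_sq α (hq0 n)] at h2
      have : (0 : ℝ) < q n := by exact_mod_cast hq0 n
      rw [le_div_iff₀ this, Function.comp]
      linarith
    have hc : Continuous (fun t : ℝ => (t : UnitAddCircle)) := AddCircle.continuous_mk' 1
    have h3 := (hc.tendsto 0).comp hreal
    rw [AddCircle.coe_zero] at h3
    refine h3.congr fun n => ?_
    have : ((p n : ℝ) : UnitAddCircle) = 0 := by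
      rw [AddCircle.coe_eq_zero_iff]
      exact ⟨p n, by simp⟩
    simp only [Function.comp]
    rw [AddCircle.coe_sub, this, sub_zero, ← nsmul_eq_mul, AddCircle.coe_nsmul]
  · intro n a ha x
    refine norm_prod_one_sub_le_of_norm_le_one (fun a ha => ?_) ha
    obtain ⟨y, rfl⟩ := exists_fourier_one_eq ha
    induction x using QuotientAddGroup.induction_on with
    | H x =>
      refine le_trans (le_of_eq (Finset.prod_congr rfl fun j _ => ?_))
        (prod_abs_sin_le hα (hq0 n) hA (hcop n) (hε n) (hgood n) (y + x))
      rw [← norm_one_sub_exp, ← fourier_one_add, ← AddCircle.coe_nsmul]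
      change ‖1 - fourier 1 ((y : UnitAddCircle) + ((x : UnitAddCircle) + ((j • α : ℝ) : UnitAddCircle)))‖ = _
      rw [← AddCircle.coe_add, ← AddCircle.coe_add, fourier_coe_apply]
      congr 3
      push_cast [nsmul_eq_mul]
      ring

/-! ### Analysis on the circle -/

theorem haarAddCircle_eq_volume : (haarAddCircle : Measure UnitAddCircle) = volume := by
  rw [volume_eq_smul_haarAddCircle]; simp

theorem addOrderOf_coe_irrational {α : ℝ} (hα : Irrational α) :
    addOrderOf (α : UnitAddCircle) = 0 := by
  rw [addOrderOf_eq_zero_iff, isOfFinAddOrder_iff_nsmul_eq_zero]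
  rintro ⟨n, hn, h⟩
  rw [← AddCircle.coe_nsmul, AddCircle.coe_eq_zero_iff] at h
  obtain ⟨m, hm⟩ := h
  have := (hα.natCast_mul hn.ne').ne_int m
  simp only [zsmul_eq_mul, mul_one, nsmul_eq_mul] at hm
  exact this hm.symm

theorem ergodic_add_irrational {α : ℝ} (hα : Irrational α) :
    Ergodic (fun x : UnitAddCircle => x + (α : UnitAddCircle)) haarAddCircle := by
  rw [haarAddCircle_eq_volume]
  exact AddCircle.ergodic_add_right.2 (addOrderOf_coe_irrational hα)

/-- Riemann–Lebesgue for an indicator function, read off from the square-summability of its Fourier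
coefficients. -/
theorem tendsto_setIntegral_fourier (S : Set UnitAddCircle) (hS : MeasurableSet S) :
    Tendsto (fun n : ℤ => ∫ x in S, fourier n x ∂(haarAddCircle : Measure UnitAddCircle))
      cofinite (𝓝 0) := by
  have hmem : MemLp (S.indicator fun _ => (1 : ℂ)) 2 (haarAddCircle : Measure UnitAddCircle) :=
    memLp_indicator_const 2 hS 1 (Or.inr (measure_ne_top _ _))
  have h1 := (hasSum_sq_fourierCoeff hmem.toLp).summable.tendsto_cofinite_zero
  have h2 : Tendsto (fun n : ℤ => ‖fourierCoeff (hmem.toLp) n‖) cofinite (𝓝 0) := by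
    have := h1.sqrt
    simpa using this
  rw [← tendsto_zero_iff_norm_tendsto_zero] at h2
  have h3 : Tendsto (fun n : ℤ => -n) cofinite cofinite :=
    (neg_injective (G := ℤ)).tendsto_cofinite
  refine (h2.comp h3).congr fun n => ?_
  simp only [Function.comp]
  rw [fourierCoeff_congr_ae hmem.coeFn_toLp, fourierCoeff, ← integral_indicator hS, neg_neg]
  refine integral_congr_ae (ae_of_all _ fun x => ?_)
  by_cases hx : x ∈ S <;> simp [hx]

/-- A trigonometric expression with three rapidly oscillating terms can tend to zero on a set of
positive measure only if all its coefficients do. -/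
theorem tendsto_zero_of_fourier_tendsto_zero {m : ℕ → ℤ} (hm : Tendsto m atTop atTop)
    {a b c : ℕ → ℂ} {K : ℝ} (ha : ∀ n, ‖a n‖ ≤ K) (hb : ∀ n, ‖b n‖ ≤ K) (hc : ∀ n, ‖c n‖ ≤ K)
    (hS : (haarAddCircle : Measure UnitAddCircle) {θ | Tendsto (fun n => a n +
      b n * fourier (m n) θ + c n * fourier (-(m n)) θ) atTop (𝓝 0)} ≠ 0) :
    Tendsto a atTop (𝓝 0) ∧ Tendsto b atTop (𝓝 0) ∧ Tendsto c atTop (𝓝 0) := by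
  set g : ℕ → UnitAddCircle → ℂ := fun n θ => a n +
      b n * fourier (m n) θ + c n * fourier (-(m n)) θ with hg
  set S : Set UnitAddCircle := {θ | Tendsto (fun n => g n θ) atTop (𝓝 0)} with hSd
  have hgc : ∀ n, Continuous (g n) := fun n => by fun_prop
  have hSm : MeasurableSet S := measurableSet_tendsto _ fun n => (hgc n).measurable
  set s : ℝ := (haarAddCircle : Measure UnitAddCircle).real S with hs
  have hs0 : (s : ℂ) ≠ 0 := by
    exact_mod_cast (measureReal_ne_zero_iff (measure_ne_top _ _)).2 hS
  have hf1 : ∀ (k : ℤ) (x : UnitAddCircle), ‖fourier k x‖ = 1 := fun k x => by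
    rw [fourier_apply]; exact Circle.norm_coe _
  have hint : ∀ k : ℤ, IntegrableOn (fun x : UnitAddCircle => fourier k x) S haarAddCircle :=
    fun k => ((map_continuous (fourier k)).integrable_of_hasCompactSupport
      (HasCompactSupport.of_compactSpace _)).integrableOn
  have hdct : ∀ k : ℕ → ℤ, Tendsto (fun n => ∫ x in S, g n x * fourier (k n) x ∂haarAddCircle)
      atTop (𝓝 0) := by
    intro k
    rw [← integral_zero UnitAddCircle ℂ (μ := haarAddCircle.restrict S)]
    refine tendsto_integral_of_dominated_convergence (fun _ => K + K + K)
      (fun n => ((hgc n).mul (map_continuous _)).aestronglyMeasurable)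
      (integrable_const _) (fun n => ae_of_all _ fun x => ?_) ?_
    · rw [norm_mul, hf1, mul_one]
      refine norm_add₃_le.trans ?_
      rw [norm_mul, norm_mul, hf1, hf1, mul_one, mul_one]
      gcongr <;> solve_by_elim
    · filter_upwards [ae_restrict_mem hSm] with x hx
      rw [tendsto_zero_iff_norm_tendsto_zero]
      have : Tendsto (fun n => ‖g n x‖) atTop (𝓝 0) := tendsto_zero_iff_norm_tendsto_zero.1 hx
      refine this.congr fun n => ?_
      rw [norm_mul, hf1, mul_one]
  -- Multiplying by the character of index `0`, `-m n` or `m n` puts one coefficient at frequency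
  -- zero, where it is weighted by the measure of `S`; the other two are killed by Riemann–Lebesgue.
  have hexp : ∀ k : ℕ → ℤ, ∀ n, ∫ x in S, g n x * fourier (k n) x ∂haarAddCircle =
      a n * (∫ x in S, fourier (k n) x ∂haarAddCircle) +
      b n * (∫ x in S, fourier (m n + k n) x ∂haarAddCircle) +
      c n * (∫ x in S, fourier (-(m n) + k n) x ∂haarAddCircle) := by
    intro k n
    have hi : Integrable (fun x => a n * fourier (k n) x + b n * fourier (m n + k n) x)
        (haarAddCircle.restrict S) := ((hint _).const_mul _).add ((hint _).const_mul _)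
    rw [← integral_const_mul, ← integral_const_mul, ← integral_const_mul,
      ← integral_add ((hint _).const_mul _) ((hint _).const_mul _),
      ← integral_add hi ((hint _).const_mul _)]
    refine integral_congr_ae (ae_of_all _ fun x => ?_)
    simp only [hg, fourier_add]
    ring
  have hzero : ∫ x in S, fourier 0 x ∂haarAddCircle = (s : ℂ) := by
    simp [hs]
  have hRL : ∀ k : ℕ → ℤ, Tendsto k atTop cofinite →
      Tendsto (fun n => ∫ x in S, fourier (k n) x ∂haarAddCircle) atTop (𝓝 0) :=
    fun k hk => (tendsto_setIntegral_fourier S hSm).comp hk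
  have hbdd : ∀ (d : ℕ → ℂ) (e : ℕ → ℂ), (∀ n, ‖d n‖ ≤ K) → Tendsto e atTop (𝓝 0) →
      Tendsto (fun n => d n * e n) atTop (𝓝 0) := by
    intro d e hd he
    rw [tendsto_zero_iff_norm_tendsto_zero] at he ⊢
    have h2 : Tendsto (fun n => K * ‖e n‖) atTop (𝓝 0) := by simpa using he.const_mul K
    refine squeeze_zero (fun _ => norm_nonneg _) (fun n => ?_) h2
    rw [norm_mul]
    exact mul_le_mul_of_nonneg_right (hd n) (norm_nonneg _)
  have hfin : ∀ d : ℕ → ℂ, Tendsto (fun n => d n * s) atTop (𝓝 0) → Tendsto d atTop (𝓝 0) := by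
    intro d hd
    have := hd.mul_const ((s : ℂ)⁻¹)
    simpa [mul_assoc, hs0] using this
  have hm1 : Tendsto m atTop cofinite := hm.mono_right atTop_le_cofinite
  have hm2 : Tendsto (fun n => -(m n)) atTop cofinite :=
    (neg_injective (G := ℤ)).tendsto_cofinite.comp hm1
  have hm3 : Tendsto (fun n => m n + m n) atTop cofinite :=
    (hm.atTop_add_atTop hm).mono_right atTop_le_cofinite
  have hm4 : Tendsto (fun n => -(m n) + -(m n)) atTop cofinite :=
    ((neg_injective (G := ℤ)).tendsto_cofinite.comp hm3).congr fun n => by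
      simp only [Function.comp]; ring
  refine ⟨hfin a ?_, hfin b ?_, hfin c ?_⟩
  · have h1 := (hdct fun _ => 0).congr (hexp _)
    simp only [add_zero, hzero] at h1
    have h2 := (h1.sub (hbdd b _ hb (hRL m hm1))).sub (hbdd c _ hc (hRL _ hm2))
    simp only [sub_zero] at h2
    exact h2.congr fun n => by ring
  · have h1 := (hdct fun n => -(m n)).congr (hexp _)
    simp only [add_neg_cancel, hzero] at h1
    have h2 := (h1.sub (hbdd a _ ha (hRL _ hm2))).sub (hbdd c _ hc (hRL _ hm4))
    simp only [sub_zero] at h2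
    exact h2.congr fun n => by ring
  · have h1 := (hdct m).congr (hexp m)
    simp only [neg_add_cancel, hzero] at h1
    have h2 := (h1.sub (hbdd a _ ha (hRL _ hm1))).sub (hbdd b _ hb (hRL _ hm3))
    simp only [sub_zero] at h2
    exact h2.congr fun n => by ring

/-- Mean value property. Applied to polynomials in `fourier 1 x`, it extracts extreme Fourier
coefficients as constant terms. -/
theorem integral_eval_fourier_one (p : Polynomial ℂ) :
    ∫ x : UnitAddCircle, p.eval (fourier 1 x) ∂haarAddCircle = p.eval 0 := by
  have hpow : ∀ (n : ℕ) (x : UnitAddCircle), fourier 1 x ^ n = fourier (n : ℤ) x := by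
    intro n x
    induction n with
    | zero => simp
    | succ n ih => rw [pow_succ, ih]; push_cast; rw [fourier_add]
  have hint : ∀ p : Polynomial ℂ, Integrable (fun x : UnitAddCircle => p.eval (fourier 1 x))
      haarAddCircle := fun p =>
    (Continuous.integrable_of_hasCompactSupport (by fun_prop) (HasCompactSupport.of_compactSpace _))
  induction p using Polynomial.induction_on' with
  | add p q hp hq =>
    simp only [Polynomial.eval_add]
    rw [integral_add (hint p) (hint q), hp, hq]
  | monomial n a =>
    simp only [Polynomial.eval_monomial]
    rw [integral_const_mul]
    congr 1
    have h := congrFun (fourierCoeff_fourier (T := 1) (n : ℤ)) 0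
    simp only [fourierCoeff, neg_zero, fourier_zero, one_smul] at h
    simp_rw [hpow]
    rw [h]
    rcases Nat.eq_zero_or_pos n with rfl | hn
    · simp
    · simp [hn.ne']

/-- Continuity of translations in `L²`, combined with Cauchy–Schwarz. -/
theorem tendsto_integral_translate_sub_mul {f g : UnitAddCircle → ℂ} (hf : MemLp f 2 haarAddCircle)
    (hg : MemLp g 2 haarAddCircle) {h : ℕ → UnitAddCircle} (hh : Tendsto h atTop (𝓝 0)) :
    Tendsto (fun n => ∫ x, ‖f (x + h n) - f x‖ * ‖g x‖ ∂haarAddCircle) atTop (𝓝 0) := by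
  have hft : ∀ y, MemLp (fun x => f (x + y)) 2 (haarAddCircle : Measure UnitAddCircle) := fun y =>
    hf.comp_measurePreserving (measurePreserving_add_right _ y)
  have : Fact ((2 : ENNReal) ≠ ⊤) := ⟨by simp⟩
  have h1 : Tendsto (fun n => DomAddAct.mk (h n) +ᵥ hf.toLp) atTop (𝓝 (hf.toLp)) := by
    have hc : Continuous fun y : UnitAddCircle => DomAddAct.mk y +ᵥ hf.toLp := by
      have := DomAddAct.continuous_mk (M := UnitAddCircle)
      fun_prop
    have := (hc.tendsto 0).comp hh
    rw [DomAddAct.mk_zero, zero_vadd] at this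
    exact this
  have h2 : Tendsto (fun n => ‖(DomAddAct.mk (h n) +ᵥ hf.toLp) - hf.toLp‖ * ‖hg.toLp‖) atTop
      (𝓝 0) := by
    have := (tendsto_iff_norm_sub_tendsto_zero.1 h1).mul_const ‖hg.toLp‖
    simpa using this
  refine squeeze_zero (fun n => integral_nonneg fun x => by positivity) (fun n => ?_) h2
  have hs : MemLp (fun x => f (x + h n) - f x) 2 (haarAddCircle : Measure UnitAddCircle) :=
    (hft _).sub hf
  have h3 := integral_mul_norm_le_Lp_mul_Lq (μ := (haarAddCircle : Measure UnitAddCircle))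
    (f := fun x => f (x + h n) - f x) (g := g) (Real.HolderConjugate.two_two)
    (by simpa using hs) (by simpa using hg)
  refine h3.trans (le_of_eq ?_)
  have hnorm : ∀ {u : UnitAddCircle → ℂ} (hu : MemLp u 2 (haarAddCircle : Measure UnitAddCircle)),
      (∫ x, ‖u x‖ ^ (2 : ℝ) ∂haarAddCircle) ^ (1 / (2 : ℝ)) = ‖hu.toLp‖ := by
    intro u hu
    rw [Lp.norm_toLp, hu.eLpNorm_eq_integral_rpow_norm (by simp) (by simp)]
    rw [ENNReal.toReal_ofReal (by positivity)]
    simp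
  rw [hnorm hs, hnorm hg]
  congr 2
  have e : MemLp.toLp (fun x => f (x + h n) - f x) hs = (hft (h n)).toLp - hf.toLp :=
    MemLp.toLp_sub (hft _) hf
  rw [e, DomAddAct.mk_vadd_toLp]
  congr 2
  simp only [vadd_eq_add, add_comm]

namespace ExtendedHarper

open ComplexConjugate Polynomial

/-! ### Aubry duality -/

/-- The half-step phase `exp(πiα)`. -/
noncomputable def halfPhase (α : ℝ) : ℂ := fourier 1 ((α / 2 : ℝ) : UnitAddCircle)

theorem halfPhase_mul_conj (α : ℝ) : halfPhase α * conj (halfPhase α) = 1 := by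
  rw [Complex.mul_conj, Complex.normSq_eq_norm_sq, halfPhase, norm_fourier_one]; simp

theorem norm_halfPhase (α : ℝ) : ‖halfPhase α‖ = 1 := norm_fourier_one _

theorem fourier_one_coe_eq (α : ℝ) : fourier 1 (α : UnitAddCircle) = halfPhase α ^ 2 := by
  rw [halfPhase, sq, ← fourier_one_add, ← AddCircle.coe_add, add_halves]

theorem fourier_one_mul_conj (x : UnitAddCircle) : fourier 1 x * conj (fourier 1 x) = 1 := by
  rw [Complex.mul_conj, Complex.normSq_eq_norm_sq, norm_fourier_one]; simp

theorem fourier_one_neg (x : UnitAddCircle) : fourier 1 (-x) = conj (fourier 1 x) := by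
  rw [← fourier_neg, fourier_apply, fourier_apply]; simp

theorem fourier_one_sub (x y : UnitAddCircle) :
    fourier 1 (x - y) = fourier 1 x * conj (fourier 1 y) := by
  rw [sub_eq_add_neg, fourier_one_add, fourier_one_neg]

theorem hopping_eq (lam : Coupling) (α : ℝ) (x : UnitAddCircle) :
    hopping lam α x = lam.l1 * conj (halfPhase α * fourier 1 x) + lam.l2 +
      lam.l3 * (halfPhase α * fourier 1 x) := by
  induction x using QuotientAddGroup.induction_on with
  | H x =>
    change hoppingReal lam α x = lam.l1 * conj (halfPhase α * fourier 1 (x : UnitAddCircle)) +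
      lam.l2 + lam.l3 * (halfPhase α * fourier 1 (x : UnitAddCircle))
    have h : halfPhase α * fourier 1 (x : UnitAddCircle) =
        Complex.exp (2 * Real.pi * Complex.I * ((x + α / 2 : ℝ) : ℂ)) := by
      rw [halfPhase, ← fourier_one_add, ← AddCircle.coe_add, fourier_coe_apply]
      congr 1
      push_cast
      ring
    rw [h, hoppingReal, ← Complex.exp_conj]
    congr 4
    simp [map_ofNat (starRingEnd ℂ) 2]

theorem potential_eq (x : UnitAddCircle) :
    (potential x : ℂ) = fourier 1 x + conj (fourier 1 x) := by
  induction x using QuotientAddGroup.induction_on with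
  | H x =>
    change ((2 * Real.cos (2 * Real.pi * x) : ℝ) : ℂ) =
      fourier 1 (x : UnitAddCircle) + conj (fourier 1 (x : UnitAddCircle))
    rw [fourier_coe_apply, ← Complex.exp_conj]
    push_cast
    rw [Complex.two_cos]
    congr 2
    · ring
    · simp [map_ofNat (starRingEnd ℂ) 2]; ring

theorem continuous_hopping (lam : Coupling) (α : ℝ) : Continuous (hopping lam α) := by
  have : hopping lam α = fun x => lam.l1 * conj (halfPhase α * fourier 1 x) + lam.l2 +
      lam.l3 * (halfPhase α * fourier 1 x) := funext (hopping_eq lam α)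
  rw [this]
  have := Complex.continuous_conj
  fun_prop

theorem continuous_potential : Continuous fun x => (potential x : ℂ) := by
  have : (fun x => (potential x : ℂ)) = fun x => fourier 1 x + conj (fourier 1 x) :=
    funext potential_eq
  rw [this]
  have := Complex.continuous_conj
  fun_prop

/-- On the Fourier side a character becomes an index shift and a translation becomes a phase. This
exchange is the mechanism of Aubry duality. -/
theorem fourierCoeff_fourier_mul_translate (u : UnitAddCircle → ℂ) (m k : ℤ) (y : UnitAddCircle) :
    fourierCoeff (fun x => fourier m x * u (x + y)) k =
      fourier (k - m) y * fourierCoeff u (k - m) := by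
  simp only [fourierCoeff, smul_eq_mul]
  rw [← integral_const_mul, ← integral_add_right_eq_self
    (fun x => fourier (k - m) y * (fourier (-(k - m)) x * u x)) y]
  refine integral_congr_ae (ae_of_all _ fun x => ?_)
  have h1 : fourier (-k) x * (fourier m x * u (x + y)) = fourier (m - k) x * u (x + y) := by
    rw [← mul_assoc, ← fourier_add]; congr 2; ring_nf
  have h2 : fourier (-(k - m)) (x + y) = fourier (m - k) x * fourier (m - k) y := by
    rw [neg_sub]
    simp only [fourier_apply, smul_add, toCircle_add, Circle.coe_mul]
  have h3 : (fourier (k - m) y : ℂ) * fourier (m - k) y = 1 := by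
    rw [← fourier_add]; simp
  simp only [h1]
  rw [h2]
  linear_combination (-(fourier (m - k) x * u (x + y))) * h3

theorem memLp_fourier_mul_translate {u : UnitAddCircle → ℂ} (hu : MemLp u 2 haarAddCircle) (m : ℤ)
    (y : UnitAddCircle) :
    MemLp (fun x => fourier m x * u (x + y)) 2 (haarAddCircle : Measure UnitAddCircle) := by
  have h1 : MemLp (fun x => u (x + y)) 2 (haarAddCircle : Measure UnitAddCircle) :=
    hu.comp_measurePreserving (measurePreserving_add_right _ y)
  refine h1.mono (((map_continuous (fourier m)).aestronglyMeasurable).mul h1.1)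
    (ae_of_all _ fun x => ?_)
  rw [norm_mul, fourier_apply, Circle.norm_coe, one_mul]

theorem ae_eq_zero_of_fourierCoeff {G : UnitAddCircle → ℂ} (hG : MemLp G 2 haarAddCircle)
    (h : ∀ k, fourierCoeff G k = 0) : G =ᵐ[haarAddCircle] 0 := by
  have h1 : hG.toLp = 0 := by
    apply fourierBasis.repr.injective
    ext k
    rw [fourierBasis_repr, fourierCoeff_congr_ae hG.coeFn_toLp, h k]
    simp
  have h2 := hG.coeFn_toLp
  rw [h1] at h2
  exact h2.symm.trans (Lp.coeFn_zero _ _ _)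

/-- The coupling `σ(λ) = (λ₃, 1, λ₁) / λ₂` dual to `λ`. -/
noncomputable def Coupling.dual (lam : Coupling) : Coupling := ⟨lam.l3 / lam.l2, 1 / lam.l2, lam.l1 / lam.l2⟩

/-- A function `u` on the circle solves the dual equation if the sequences
`n ↦ exp(2πinθ) u(x + nα)` are generalized eigenfunctions for almost every phase `x`. -/
def SolvesDual (lam : Coupling) (α : ℝ) (θ : UnitAddCircle) (E : ℂ) (u : UnitAddCircle → ℂ) :
    Prop :=
  ∀ᵐ x ∂(haarAddCircle : Measure UnitAddCircle),
    hopping lam α x * (fourier 1 θ * u (x + α)) + potential x * u x +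
      conj (hopping lam α (x - α)) * (conj (fourier 1 θ) * u (x - α)) = E * u x

theorem exists_solvesDual {lam : Coupling} (h2 : lam.l2 ≠ 0) {α : ℝ} {θ : UnitAddCircle} {E : ℂ}
    {ψ : EllTwo} (hψ : ψ ≠ 0) (hE : harper lam α θ ψ = E • ψ) :
    ∃ u : UnitAddCircle → ℂ, MemLp u 2 haarAddCircle ∧ ¬ (u =ᵐ[haarAddCircle] 0) ∧
      SolvesDual lam.dual α θ (E / lam.l2) u := by
  set U : Lp ℂ 2 (haarAddCircle : Measure UnitAddCircle) := fourierBasis.repr.symm ψ with hU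
  have hcoef : ∀ k, fourierCoeff U k = ψ k := by
    intro k
    rw [← fourierBasis_repr, hU, LinearIsometryEquiv.apply_symm_apply]
  have hmem : MemLp U 2 (haarAddCircle : Measure UnitAddCircle) := Lp.memLp U
  refine ⟨U, hmem, ?_, ?_⟩
  · intro h0
    have : U = 0 := Lp.eq_zero_iff_ae_eq_zero.2 h0
    exact hψ (by simpa [hU] using this)
  set e : ℂ := fourier 1 θ with he
  set η : ℂ := halfPhase α with hη
  have hηη : η * conj η = 1 := halfPhase_mul_conj α
  have h2' : (lam.l2 : ℂ) ≠ 0 := by exact_mod_cast h2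
  set a : UnitAddCircle := (α : UnitAddCircle) with ha
  -- The dual equation multiplied by `lam.l2`, expanded into characters times translates of `U`. Its
  -- `k`-th Fourier coefficient is the eigenvalue equation at site `k`.
  set c : Fin 9 → ℂ := ![e * lam.l3 * conj η, e, e * lam.l1 * η, lam.l2, lam.l2,
    conj e * lam.l3 * conj η, conj e, conj e * lam.l1 * η, -E] with hc
  set m : Fin 9 → ℤ := ![-1, 0, 1, 1, -1, 1, 0, -1, 0] with hm
  set y : Fin 9 → UnitAddCircle := ![a, a, a, 0, 0, -a, -a, -a, 0] with hy
  set G : UnitAddCircle → ℂ := ∑ i, c i • fun x => fourier (m i) x * U (x + y i) with hG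
  have hterm : ∀ i, MemLp (c i • fun x => fourier (m i) x * U (x + y i)) 2
      (haarAddCircle : Measure UnitAddCircle) := fun i =>
    (memLp_fourier_mul_translate hmem (m i) (y i)).const_smul (c i)
  have hGmem : MemLp G 2 haarAddCircle := memLp_finsetSum' _ fun i _ => hterm i
  have hG0 : G =ᵐ[haarAddCircle] 0 := by
    refine ae_eq_zero_of_fourierCoeff hGmem fun k => ?_
    rw [hG, fourierCoeff.sum _ _ fun i _ => (hterm i).integrable (by norm_num), Finset.sum_apply]
    simp_rw [fourierCoeff.const_smul, fourierCoeff_fourier_mul_translate, hcoef]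
    have hk := congrArg (fun f : EllTwo => f k) hE
    simp only [lp.coeFn_smul, Pi.smul_apply, smul_eq_mul] at hk
    rw [harper_apply, potential_eq, hopping_eq, hopping_eq] at hk
    have horb : ∀ j : ℤ, fourier 1 (orbit α θ j) = e * fourier j a := by
      intro j
      rw [orbit, fourier_one_add, he]
      congr 1
      rw [ha, fourier_coe_apply, fourier_coe_apply]
      congr 1
      push_cast
      ring
    have hneg : ∀ j : ℤ, fourier j (-a) = conj (fourier j a) := by
      intro j
      rw [← fourier_neg, fourier_apply, fourier_apply]; simp
    have hsucc : fourier (k + 1) a = fourier k a * η ^ 2 := by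
      rw [fourier_add, ← fourier_one_coe_eq]
    rw [horb, horb] at hk
    simp only [hc, hm, hy, Fin.sum_univ_succ, Matrix.cons_val_zero, Matrix.cons_val_succ,
      Finset.univ_eq_empty, Finset.sum_empty, hneg, fourier_eval_zero,
      sub_zero, sub_neg_eq_add, hsucc, smul_eq_mul, Matrix.cons_val_fin_one]
    simp only [map_mul, map_add, map_pow, Complex.conj_ofReal, Complex.conj_conj] at hk ⊢
    linear_combination hk + (e * lam.l3 * η * fourier k a * ψ (k + 1) +
      conj e * lam.l1 * conj η * conj (fourier k a) * ψ (k + 1)) * hηη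
  have hz : ∀ x : UnitAddCircle, fourier (-1) x = conj (fourier 1 x) := fun x => fourier_neg
  filter_upwards [hG0] with x hx
  simp only [hG, hc, hm, hy, Fin.sum_univ_succ, Matrix.cons_val_zero, Matrix.cons_val_succ,
      Finset.univ_eq_empty, Finset.sum_empty, Pi.add_apply, Pi.smul_apply,
      Pi.zero_apply, fourier_zero, hz, smul_eq_mul, add_zero, ← sub_eq_add_neg,
      Matrix.cons_val_fin_one, one_mul] at hx
  rw [hopping_eq, hopping_eq, potential_eq, fourier_one_sub, fourier_one_coe_eq]
  simp only [Coupling.dual, map_mul, map_add, map_pow, Complex.conj_ofReal, Complex.conj_conj]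
  rw [← hη]
  push_cast
  field_simp
  linear_combination hx + (conj e * U (x - a) * (lam.l3 * fourier 1 x * conj η +
      lam.l1 * conj (fourier 1 x) * η)) * hηη

/-! ### The self-dual region and the factorization of the hopping function -/

theorem dual_mem_selfDualRegion {lam : Coupling} (h : lam ∈ selfDualRegion) :
    lam.l2 ≠ 0 ∧ lam.dual ∈ selfDualRegion := by
  rcases h with ⟨h1, h2⟩ | ⟨h1, h2, h3⟩
  · have h4 := (le_max_left _ _).trans h1
    have h5 := (le_max_right _ _).trans h1
    refine ⟨h2.ne', Or.inl ⟨?_, by simpa [Coupling.dual] using h2⟩⟩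
    simp only [Coupling.dual]
    rw [← add_div, max_le_iff, one_le_div h2, div_le_div_iff_of_pos_right h2]
    constructor <;> linarith
  · refine ⟨by rw [h3]; exact one_ne_zero, Or.inr ⟨?_, ?_, ?_⟩⟩ <;>
      simp only [Coupling.dual, h3] <;> linarith

/-- The real quadratics with both roots in the closed unit disc. -/
theorem exists_roots_norm_le_one {B C : ℝ} (hC : C ≤ 1) (hB : |B| ≤ 1 + C) :
    ∃ a b : ℂ, a + b = -B ∧ a * b = C ∧ ‖a‖ ≤ 1 ∧ ‖b‖ ≤ 1 := by
  obtain ⟨hB1, hB2⟩ := abs_le.1 hB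
  rcases le_or_gt 0 (B ^ 2 - 4 * C) with h | h
  · set r := √(B ^ 2 - 4 * C) with hr
    have hr2 : r ^ 2 = B ^ 2 - 4 * C := Real.sq_sqrt h
    have hr0 : 0 ≤ r := Real.sqrt_nonneg _
    -- After squaring, this and the next inequality say that the quadratic `t² + B t + C` is
    -- nonnegative at `1` and `-1`, which holds because `|B| ≤ 1 + C`.
    have h1 : r ≤ 2 + B := Real.sqrt_le_iff.2 ⟨by linarith, by nlinarith⟩
    have h2 : r ≤ 2 - B := Real.sqrt_le_iff.2 ⟨by linarith, by nlinarith⟩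
    refine ⟨(((-B + r) / 2 : ℝ) : ℂ), (((-B - r) / 2 : ℝ) : ℂ), ?_, ?_, ?_, ?_⟩
    · push_cast; ring
    · rw [← Complex.ofReal_mul]; congr 1; linear_combination -(1 / 4) * hr2
    · rw [Complex.norm_real, Real.norm_eq_abs, abs_le]; constructor <;> linarith
    · rw [Complex.norm_real, Real.norm_eq_abs, abs_le]; constructor <;> linarith
  · set r := √(4 * C - B ^ 2) with hr
    have hr2 : r ^ 2 = 4 * C - B ^ 2 := Real.sq_sqrt (by linarith)
    have hr2' : (r : ℂ) ^ 2 = 4 * C - B ^ 2 := by exact_mod_cast hr2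
    have hn : ∀ s : ℝ, s ^ 2 = r ^ 2 → ‖(⟨-B / 2, s / 2⟩ : ℂ)‖ ≤ 1 := by
      intro s hs
      rw [← sq_le_one_iff₀ (norm_nonneg _), ← Complex.normSq_eq_norm_sq, Complex.normSq_apply]
      simp only
      nlinarith
    refine ⟨⟨-B / 2, r / 2⟩, ⟨-B / 2, -r / 2⟩, ?_, ?_, hn r rfl, hn (-r) (by ring)⟩
    · apply Complex.ext <;> simp; ring
    · apply Complex.ext <;> simp
      · nlinarith
      · ring

/-- The hopping function factorizes, up to a phase, into two factors whose zeros lie outside the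
open unit disc. The constant `ρ` is its geometric mean. -/
structure HoppingFactorization (lam : Coupling) where
  (ρ : ℝ) (a b : ℂ)
  ρ_pos : 0 < ρ
  norm_a : ‖a‖ ≤ 1
  norm_b : ‖b‖ ≤ 1
  norm_eq : ∀ w : ℂ, ‖w‖ = 1 →
    ‖lam.l1 * conj w + lam.l2 + lam.l3 * w‖ = ρ * (‖1 - a * w‖ * ‖1 - b * w‖)
  dichotomy : |lam.l1| = ρ ∨ |lam.l3| = ρ ∨ ∃ ν ≤ ρ, ρ + ν = 1 ∧ ρ * ν = lam.l1 * lam.l3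

theorem norm_one_sub_mul_conj (a w : ℂ) : ‖1 - a * conj w‖ = ‖1 - conj a * w‖ := by
  rw [← Complex.norm_conj]; simp

/-- In region III, `|l1 conj w + l2 + l3 w|` is the modulus of a quadratic in `w` or `conj w` whose
constant term is the larger of `l1`, `l3`; the condition `l2 ≤ l1 + l3` puts both reciprocal roots
in the unit disc, and `ρ` is that larger coupling. On the segment, `ρ` is the larger root of `t² - t
+ l1 l3`; then `-ρ` and `-ν` are the eigenvalues of `transferLead`. -/
theorem exists_hoppingFactorization {lam : Coupling} (h : lam ∈ selfDualRegion) :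
    Nonempty (HoppingFactorization lam) := by
  obtain ⟨l1, l2, l3⟩ := lam
  have hw : ∀ w : ℂ, ‖w‖ = 1 → w * conj w = 1 := fun w hw => by
    rw [Complex.mul_conj, Complex.normSq_eq_norm_sq, hw]; simp
  rcases h with ⟨h1, h2⟩ | ⟨h1, h2, h3⟩
  · simp only at h1 h2
    have h4 := (le_max_left _ _).trans h1
    have h5 := (le_max_right _ _).trans h1
    rcases le_total |l3| l1 with h | h
    · have hpos : 0 < l1 := by
        rcases (abs_nonneg l3).trans h |>.lt_or_eq with h6 | h6
        · exact h6
        · rw [← h6, abs_nonpos_iff] at h; linarith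
      obtain ⟨a, b, hab, hab', ha, hb⟩ := exists_roots_norm_le_one (B := l2 / l1) (C := l3 / l1)
        (by rw [div_le_one hpos]; exact (le_abs_self _).trans h)
        (by rw [abs_of_pos (by positivity), div_le_iff₀ hpos]; field_simp; linarith)
      refine ⟨⟨l1, a, b, hpos, ha, hb, fun w hw1 => ?_, Or.inl (abs_of_pos hpos)⟩⟩
      have hl : (l1 : ℂ) ≠ 0 := by exact_mod_cast hpos.ne'
      have e : l1 * ((1 - a * w) * (1 - b * w)) = w * (l1 * conj w + l2 + l3 * w) := by
        have e2 : (l2 : ℂ) = -l1 * (a + b) := by rw [hab]; push_cast; field_simp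
        have e3 : (l3 : ℂ) = l1 * (a * b) := by rw [hab']; push_cast; field_simp
        rw [e2, e3]
        linear_combination -l1 * hw w hw1
      have := congrArg norm e
      rw [norm_mul, norm_mul, norm_mul, hw1, one_mul, Complex.norm_of_nonneg hpos.le] at this
      exact this.symm
    · have h' : |l1| ≤ l3 := by
        rcases le_total 0 l3 with h6 | h6
        · rw [abs_of_nonneg h6] at h
          rw [abs_le]; constructor <;> linarith
        · rw [abs_of_nonpos h6] at h; linarith
      have hpos : 0 < l3 := by
        rcases (abs_nonneg l1).trans h' |>.lt_or_eq with h6 | h6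
        · exact h6
        · rw [← h6, abs_nonpos_iff] at h'; linarith
      obtain ⟨a, b, hab, hab', ha, hb⟩ := exists_roots_norm_le_one (B := l2 / l3) (C := l1 / l3)
        (by rw [div_le_one hpos]; exact (le_abs_self _).trans h')
        (by rw [abs_of_pos (by positivity), div_le_iff₀ hpos]; field_simp; linarith)
      refine ⟨⟨l3, conj a, conj b, hpos, by rwa [Complex.norm_conj], by rwa [Complex.norm_conj],
        fun w hw1 => ?_, Or.inr (Or.inl (abs_of_pos hpos))⟩⟩
      have hl : (l3 : ℂ) ≠ 0 := by exact_mod_cast hpos.ne'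
      have e : l3 * ((1 - a * conj w) * (1 - b * conj w)) =
          conj w * (l1 * conj w + l2 + l3 * w) := by
        have e2 : (l2 : ℂ) = -l3 * (a + b) := by rw [hab]; push_cast; field_simp
        have e3 : (l1 : ℂ) = l3 * (a * b) := by rw [hab']; push_cast; field_simp
        rw [e2, e3]
        linear_combination -l3 * hw w hw1
      have := congrArg norm e
      rw [norm_mul, norm_mul, norm_mul, Complex.norm_conj, hw1, one_mul,
        Complex.norm_of_nonneg hpos.le, norm_one_sub_mul_conj, norm_one_sub_mul_conj] at this
      exact this.symm
  · simp only at h1 h2 h3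
    subst h3
    have hd : 0 ≤ 1 - 4 * (l1 * l3) := by nlinarith [sq_nonneg (l1 - l3)]
    set r := √(1 - 4 * (l1 * l3)) with hr
    have hr2 : r ^ 2 = 1 - 4 * (l1 * l3) := Real.sq_sqrt hd
    have hr0 : 0 ≤ r := Real.sqrt_nonneg _
    have hpos : 0 < (1 + r) / 2 := by linarith
    -- Squared, the claim reads `s (s + t) ≤ |s|`, which holds because `0 ≤ s + t ≤ 1`.
    have key : ∀ s t : ℝ, s * t = l1 * l3 → s + t = l1 + l3 → |s| ≤ (1 + r) / 2 := by
      intro s t hst hst'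
      suffices H : 2 * |s| - 1 ≤ r by linarith
      rcases le_or_gt (2 * |s| - 1) 0 with h6 | h6
      · linarith
      · refine Real.le_sqrt_of_sq_le ?_
        rw [← hst]
        rcases le_total 0 s with h7 | h7
        · rw [abs_of_nonneg h7] at h6 ⊢; nlinarith
        · rw [abs_of_nonpos h7] at h6 ⊢; nlinarith
    refine ⟨⟨(1 + r) / 2, ((-(l1 / ((1 + r) / 2)) : ℝ) : ℂ), ((-(l3 / ((1 + r) / 2)) : ℝ) : ℂ), hpos,
      ?_, ?_, fun w hw1 => ?_, Or.inr (Or.inr ⟨(1 - r) / 2, by linarith, by ring, ?_⟩)⟩⟩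
    · rw [Complex.norm_real, Real.norm_eq_abs, abs_neg, abs_div, abs_of_pos hpos, div_le_one hpos]
      exact key l1 l3 rfl rfl
    · rw [Complex.norm_real, Real.norm_eq_abs, abs_neg, abs_div, abs_of_pos hpos, div_le_one hpos]
      exact key l3 l1 (mul_comm _ _) (add_comm _ _)
    · set ρ := (1 + r) / 2 with hρ
      have hρ2 : ρ + l1 * l3 / ρ = 1 := by
        field_simp
        rw [hρ]; linear_combination (1 / 4) * hr2
      have hρ2' : (ρ : ℂ) + l1 * l3 / ρ = 1 := by exact_mod_cast hρ2
      have hl : (ρ : ℂ) ≠ 0 := by exact_mod_cast hpos.ne'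
      have e : (l1 * conj w + (1 : ℝ) + l3 * w : ℂ) =
          ρ * ((1 - ((-(l1 / ρ) : ℝ) : ℂ) * conj w) * (1 - ((-(l3 / ρ) : ℝ) : ℂ) * w)) := by
        push_cast
        have : (ρ : ℂ) * ((1 - -((l1 : ℂ) / ρ) * conj w) * (1 - -((l3 : ℂ) / ρ) * w)) =
          ρ + l1 * conj w + l3 * w + l1 * l3 / ρ * (w * conj w) := by field_simp; ring
        rw [this, hw w hw1]
        linear_combination -hρ2'
      simp only
      rw [e, norm_mul, norm_mul, norm_one_sub_mul_conj, Complex.conj_ofReal,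
        Complex.norm_of_nonneg hpos.le]
    · simp only; linear_combination -(1 / 4) * hr2

/-! ### Products of the hopping function along the rotation -/

/-- The product of the hopping function along `n` steps of the rotation. -/
noncomputable def hoppingProd (lam : Coupling) (α : ℝ) (n : ℕ) (x : UnitAddCircle) : ℂ :=
  ∏ j ∈ Finset.range n, hopping lam α (x + j • (α : UnitAddCircle))

theorem continuous_hoppingProd (lam : Coupling) (α : ℝ) (n : ℕ) :
    Continuous (hoppingProd lam α n) :=
  continuous_finsetProd _ fun _ _ => (continuous_hopping lam α).comp (continuous_add_const _)

theorem HoppingFactorization.norm_hopping {lam : Coupling} (F : HoppingFactorization lam) (α : ℝ)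
    (x : UnitAddCircle) : ‖hopping lam α x‖ = F.ρ * (‖1 - F.a * halfPhase α * fourier 1 x‖ *
      ‖1 - F.b * halfPhase α * fourier 1 x‖) := by
  rw [hopping_eq, F.norm_eq _ (by rw [norm_mul, norm_halfPhase, norm_fourier_one, one_mul]),
    mul_assoc, mul_assoc]

theorem HoppingFactorization.norm_hoppingProd {lam : Coupling} (F : HoppingFactorization lam)
    (α : ℝ) (n : ℕ) (x : UnitAddCircle) : ‖hoppingProd lam α n x‖ = F.ρ ^ n *
      ((∏ j ∈ Finset.range n, ‖1 - F.a * halfPhase α * fourier 1 (x + j • (α : UnitAddCircle))‖) *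
      ∏ j ∈ Finset.range n, ‖1 - F.b * halfPhase α * fourier 1 (x + j • (α : UnitAddCircle))‖) := by
  rw [hoppingProd, norm_prod]
  simp_rw [F.norm_hopping]
  rw [Finset.prod_mul_distrib, Finset.prod_mul_distrib, Finset.prod_const, Finset.card_range]

theorem fourier_one_add_nsmul (x y : UnitAddCircle) (j : ℕ) :
    fourier 1 (x + j • y) = fourier 1 x * fourier 1 y ^ j := by
  rw [fourier_one_add]
  congr 1
  induction j with
  | zero => simp
  | succ j ih => rw [succ_nsmul, fourier_one_add, ih, pow_succ]

/-- After division by `ρ ^ n`, the modulus is that of a polynomial in `fourier 1 x` with value one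
at the origin, whose mean over the circle is therefore one. -/
theorem HoppingFactorization.le_integral_norm_hoppingProd {lam : Coupling}
    (F : HoppingFactorization lam) (α : ℝ) (n : ℕ) :
    F.ρ ^ n ≤ ∫ x, ‖hoppingProd lam α n x‖ ∂haarAddCircle := by
  set p : ℂ[X] := ∏ j ∈ Finset.range n,
    ((1 - C (F.a * halfPhase α * fourier 1 (α : UnitAddCircle) ^ j) * X) *
      (1 - C (F.b * halfPhase α * fourier 1 (α : UnitAddCircle) ^ j) * X)) with hp
  have h0 : p.eval 0 = 1 := by
    rw [hp, eval_prod]; simp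
  have hn : ∀ x, ‖hoppingProd lam α n x‖ = F.ρ ^ n * ‖p.eval (fourier 1 x)‖ := by
    intro x
    rw [F.norm_hoppingProd, hp, eval_prod, norm_prod, ← Finset.prod_mul_distrib]
    congr 1
    refine Finset.prod_congr rfl fun j _ => ?_
    rw [fourier_one_add_nsmul]
    simp only [eval_mul, eval_sub, eval_one, eval_C, eval_X, norm_mul]
    ring_nf
  simp_rw [hn]
  rw [integral_const_mul]
  have := norm_integral_le_integral_norm (μ := (haarAddCircle : Measure UnitAddCircle))
    fun x : UnitAddCircle => p.eval (fourier 1 x)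
  rw [integral_eval_fourier_one, h0, norm_one] at this
  exact le_mul_of_one_le_right (pow_pos F.ρ_pos n).le this

/-! ### The transfer matrices and their extreme Fourier coefficients -/

/-- The unnormalized one-step transfer matrix. -/
noncomputable def transfer (lam : Coupling) (α : ℝ) (E : ℂ) (x : UnitAddCircle) :
    Matrix (Fin 2) (Fin 2) ℂ :=
  !![E - potential x, -conj (hopping lam α (x - α)); hopping lam α x, 0]

/-- The product of `n` consecutive transfer matrices. -/
noncomputable def transferProd (lam : Coupling) (α : ℝ) (E : ℂ) :
    ℕ → UnitAddCircle → Matrix (Fin 2) (Fin 2) ℂ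
  | 0, _ => 1
  | n + 1, x => transfer lam α E (x + n • (α : UnitAddCircle)) * transferProd lam α E n x

/-- The leading coefficient of the transfer matrix as a trigonometric polynomial. -/
noncomputable def transferLead (lam : Coupling) (α : ℝ) : Matrix (Fin 2) (Fin 2) ℂ :=
  !![-1, -(lam.l3 * halfPhase α); lam.l1 * conj (halfPhase α), 0]

/-- The transfer matrix at `x + jα`, multiplied by `exp(2πix)`, as a polynomial in `exp(2πix)`. -/
noncomputable def transferPoly (lam : Coupling) (α : ℝ) (E : ℂ) (j : ℕ) :
    Matrix (Fin 2) (Fin 2) ℂ[X] :=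
  let w : ℂ := fourier 1 (α : UnitAddCircle) ^ j
  !![C E * X - C w * X ^ 2 - C (conj w),
    -(C (lam.l1 * w * conj (halfPhase α)) * X ^ 2 + C (lam.l2 : ℂ) * X +
      C (lam.l3 * conj w * halfPhase α));
    C (lam.l1 * conj (halfPhase α * w)) + C (lam.l2 : ℂ) * X +
      C (lam.l3 * halfPhase α * w) * X ^ 2, 0]

/-- The product of the matrices `transferPoly`. -/
noncomputable def transferPolyProd (lam : Coupling) (α : ℝ) (E : ℂ) :
    ℕ → Matrix (Fin 2) (Fin 2) ℂ[X]
  | 0 => 1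
  | n + 1 => transferPoly lam α E n * transferPolyProd lam α E n

theorem fourier_one_mul_hopping (lam : Coupling) (α : ℝ) (x : UnitAddCircle) (j : ℕ) :
    fourier 1 x * hopping lam α (x + j • (α : UnitAddCircle)) =
      lam.l1 * conj (halfPhase α * fourier 1 (α : UnitAddCircle) ^ j) + lam.l2 * fourier 1 x +
        lam.l3 * halfPhase α * fourier 1 (α : UnitAddCircle) ^ j * fourier 1 x ^ 2 := by
  rw [hopping_eq, fourier_one_add_nsmul]
  simp only [map_mul, map_pow]
  linear_combination (lam.l1 * conj (halfPhase α) * conj (fourier 1 (α : UnitAddCircle)) ^ j) *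
    fourier_one_mul_conj x

theorem fourier_one_mul_conj_hopping (lam : Coupling) (α : ℝ) (x : UnitAddCircle) (j : ℕ) :
    fourier 1 x * conj (hopping lam α (x + j • (α : UnitAddCircle) - α)) =
      lam.l1 * fourier 1 (α : UnitAddCircle) ^ j * conj (halfPhase α) * fourier 1 x ^ 2 +
        lam.l2 * fourier 1 x +
        lam.l3 * conj (fourier 1 (α : UnitAddCircle) ^ j) * halfPhase α := by
  rw [hopping_eq, fourier_one_sub, fourier_one_add_nsmul]
  simp only [map_mul, map_add, map_pow, Complex.conj_ofReal, Complex.conj_conj]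
  set w := fourier 1 (α : UnitAddCircle) ^ j
  set w' := conj (fourier 1 (α : UnitAddCircle)) ^ j
  rw [fourier_one_coe_eq]
  simp only [map_pow]
  have h := halfPhase_mul_conj α
  linear_combination (lam.l1 * fourier 1 x ^ 2 * w * conj (halfPhase α) +
    lam.l3 * fourier 1 x * conj (fourier 1 x) * w' * halfPhase α) * h +
    lam.l3 * w' * halfPhase α * fourier_one_mul_conj x

theorem mapMatrix_eval_transferPoly (lam : Coupling) (α : ℝ) (E : ℂ) (j : ℕ) (x : UnitAddCircle) :
    (evalRingHom (fourier 1 x)).mapMatrix (transferPoly lam α E j) =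
      (fourier 1 x : ℂ) • transfer lam α E (x + j • (α : UnitAddCircle)) := by
  have h1 := fourier_one_mul_hopping lam α x j
  have h2 := fourier_one_mul_conj_hopping lam α x j
  have h3 := fourier_one_mul_conj x
  ext i k
  fin_cases i <;> fin_cases k
  · simp [-fourier_apply, transferPoly, transfer, potential_eq, fourier_one_add_nsmul]
    linear_combination (conj (fourier 1 (α : UnitAddCircle)) ^ j) * h3
  · simp only [transferPoly, transfer, RingHom.mapMatrix_apply, Matrix.map_apply, Matrix.smul_apply,
      Fin.mk_one, Fin.zero_eta, Matrix.of_apply, Matrix.cons_val_zero, Matrix.cons_val_one,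
      Matrix.cons_val_fin_one, Matrix.cons_val', smul_eq_mul, mul_neg, h2]
    simp
  · simp only [transferPoly, transfer, RingHom.mapMatrix_apply, Matrix.map_apply, Matrix.smul_apply,
      Fin.mk_one, Fin.zero_eta, Matrix.of_apply, Matrix.cons_val_zero, Matrix.cons_val_one,
      Matrix.cons_val_fin_one, Matrix.cons_val', smul_eq_mul, h1]
    simp
  · simp [transferPoly, transfer]

theorem mapMatrix_eval_transferPolyProd (lam : Coupling) (α : ℝ) (E : ℂ) (n : ℕ)
    (x : UnitAddCircle) :
    (evalRingHom (fourier 1 x)).mapMatrix (transferPolyProd lam α E n) =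
      (fourier 1 x ^ n : ℂ) • transferProd lam α E n x := by
  induction n with
  | zero => rw [transferPolyProd, transferProd, map_one, pow_zero, one_smul]
  | succ n ih =>
    rw [transferPolyProd, transferProd, map_mul, ih, mapMatrix_eval_transferPoly, Matrix.smul_mul,
      Matrix.mul_smul, smul_smul, pow_succ']

/-- At the origin every factor is a phase times the same matrix, so the ordered product collapses to
a power. The energy drops out here, which makes the exceptional set of phases independent of it. -/
theorem mapMatrix_eval_zero_transferPolyProd (lam : Coupling) (α : ℝ) (E : ℂ) (n : ℕ) :
    (evalRingHom 0).mapMatrix (transferPolyProd lam α E n) =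
      (∏ j ∈ Finset.range n, conj (fourier 1 (α : UnitAddCircle) ^ j)) • transferLead lam α ^ n := by
  have h : ∀ j, (evalRingHom 0).mapMatrix (transferPoly lam α E j) =
      conj (fourier 1 (α : UnitAddCircle) ^ j) • transferLead lam α := by
    intro j
    ext i k
    fin_cases i <;> fin_cases k <;> simp [transferPoly, transferLead] <;> ring
  induction n with
  | zero => rw [transferPolyProd, map_one, pow_zero, Finset.range_zero, Finset.prod_empty, one_smul]
  | succ n ih =>
    rw [transferPolyProd, map_mul, ih, h, Matrix.smul_mul, Matrix.mul_smul, smul_smul, pow_succ',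
      Finset.prod_range_succ, mul_comm (conj _)]

theorem eval_trace (M : Matrix (Fin 2) (Fin 2) ℂ[X]) (z : ℂ) :
    M.trace.eval z = ((evalRingHom z).mapMatrix M).trace := by
  simp [Matrix.trace_fin_two]

/-- The phase accumulated by the extreme Fourier coefficients. -/
noncomputable def leadPhase (α : ℝ) (n : ℕ) : ℂ :=
  ∏ j ∈ Finset.range n, conj (fourier 1 (α : UnitAddCircle) ^ j)

theorem norm_leadPhase (α : ℝ) (n : ℕ) : ‖leadPhase α n‖ = 1 := by
  rw [leadPhase, norm_prod]
  refine Finset.prod_eq_one fun j _ => ?_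
  rw [Complex.norm_conj, norm_pow, norm_fourier_one, one_pow]

theorem integral_pow_mul_trace (lam : Coupling) (α : ℝ) (E : ℂ) (n : ℕ) :
    ∫ x, fourier 1 x ^ n * (transferProd lam α E n x).trace ∂haarAddCircle =
      leadPhase α n * (transferLead lam α ^ n).trace := by
  have h := integral_eval_fourier_one (transferPolyProd lam α E n).trace
  rw [eval_trace, mapMatrix_eval_zero_transferPolyProd, Matrix.trace_smul, smul_eq_mul] at h
  rw [leadPhase, ← h]
  refine integral_congr_ae (ae_of_all _ fun x => ?_)
  simp only
  rw [eval_trace, mapMatrix_eval_transferPolyProd, Matrix.trace_smul, smul_eq_mul]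

theorem norm_integral_pow_mul_hoppingProd (lam : Coupling) (α : ℝ) (n : ℕ) :
    ‖∫ x, fourier 1 x ^ n * hoppingProd lam α n x ∂haarAddCircle‖ = |lam.l1| ^ n := by
  set p : ℂ[X] := ∏ j ∈ Finset.range n,
    (C (lam.l1 * conj (halfPhase α * fourier 1 (α : UnitAddCircle) ^ j)) + C (lam.l2 : ℂ) * X +
      C (lam.l3 * halfPhase α * fourier 1 (α : UnitAddCircle) ^ j) * X ^ 2) with hp
  have h : ∀ x, fourier 1 x ^ n * hoppingProd lam α n x = p.eval (fourier 1 x) := by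
    intro x
    rw [hp, hoppingProd, eval_prod]
    conv_lhs => rw [← Finset.card_range n, ← Finset.prod_const, Finset.card_range]
    rw [← Finset.prod_mul_distrib]
    refine Finset.prod_congr rfl fun j _ => ?_
    rw [fourier_one_mul_hopping]; simp
  simp_rw [h]
  rw [integral_eval_fourier_one, hp, eval_prod, norm_prod, ← Finset.card_range n,
    ← Finset.prod_const, Finset.card_range]
  refine Finset.prod_congr rfl fun j _ => ?_
  simp [-fourier_apply, norm_halfPhase, norm_fourier_one]

theorem norm_integral_pow_mul_conj_hoppingProd (lam : Coupling) (α : ℝ) (n : ℕ) :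
    ‖∫ x, fourier 1 x ^ n * conj (hoppingProd lam α n (x - (α : UnitAddCircle))) ∂haarAddCircle‖ = |lam.l3| ^ n := by
  set p : ℂ[X] := ∏ j ∈ Finset.range n,
    (C (lam.l1 * fourier 1 (α : UnitAddCircle) ^ j * conj (halfPhase α)) * X ^ 2 +
      C (lam.l2 : ℂ) * X +
      C (lam.l3 * conj (fourier 1 (α : UnitAddCircle) ^ j) * halfPhase α)) with hp
  have h : ∀ x, fourier 1 x ^ n * conj (hoppingProd lam α n (x - (α : UnitAddCircle))) = p.eval (fourier 1 x) := by
    intro x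
    rw [hp, hoppingProd, eval_prod, map_prod]
    conv_lhs => rw [← Finset.card_range n, ← Finset.prod_const, Finset.card_range]
    rw [← Finset.prod_mul_distrib]
    refine Finset.prod_congr rfl fun j _ => ?_
    rw [sub_add_eq_add_sub, fourier_one_mul_conj_hopping]; simp
  simp_rw [h]
  rw [integral_eval_fourier_one, hp, eval_prod, norm_prod, ← Finset.card_range n,
    ← Finset.prod_const, Finset.card_range]
  refine Finset.prod_congr rfl fun j _ => ?_
  simp [-fourier_apply, norm_halfPhase, norm_fourier_one]

/-- By Cayley–Hamilton the traces satisfy the two-term recurrence with characteristic roots `-ρ` and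
`-ν`. -/
theorem trace_transferLead_pow {lam : Coupling} {ρ ν : ℝ} (h1 : ρ + ν = 1)
    (h2 : ρ * ν = lam.l1 * lam.l3) (α : ℝ) (n : ℕ) :
    (transferLead lam α ^ n).trace = (-ρ : ℂ) ^ n + (-ν : ℂ) ^ n := by
  have h1' : (ρ : ℂ) + ν = 1 := by exact_mod_cast h1
  have h2' : (ρ : ℂ) * ν = lam.l1 * lam.l3 := by exact_mod_cast h2
  have hsq : transferLead lam α ^ 2 =
      -transferLead lam α - ((ρ : ℂ) * ν) • (1 : Matrix (Fin 2) (Fin 2) ℂ) := by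
    rw [sq, h2']
    have := halfPhase_mul_conj α
    ext i k
    fin_cases i <;> fin_cases k <;> simp [transferLead, Matrix.mul_apply] <;>
      first
      | linear_combination (lam.l1 * lam.l3 : ℂ) * this
      | linear_combination -(lam.l1 * lam.l3 : ℂ) * this
  have hrec : ∀ n, (transferLead lam α ^ (n + 2)).trace =
      -(transferLead lam α ^ (n + 1)).trace - ρ * ν * (transferLead lam α ^ n).trace := by
    intro n
    rw [pow_add, hsq, mul_sub, mul_neg, ← pow_succ, Matrix.mul_smul, mul_one, Matrix.trace_sub,
      Matrix.trace_neg, Matrix.trace_smul, smul_eq_mul]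
  induction n using Nat.twoStepInduction with
  | zero => simp; norm_num
  | one => simp [transferLead, Matrix.trace_fin_two]; linear_combination h1'
  | more n ih1 ih2 =>
    rw [hrec, ih1, ih2]
    rw [pow_succ _ (n + 1), pow_succ _ (n + 1), pow_succ _ n, pow_succ _ n]
    linear_combination ((-ρ : ℂ) ^ n * (-ρ) + (-ν : ℂ) ^ n * (-ν)) * h1'

/-! ### The conserved current of a square-integrable dual solution -/

theorem ae_translate {p : UnitAddCircle → Prop} (h : ∀ᵐ x ∂(haarAddCircle : Measure UnitAddCircle), p x)
    (y : UnitAddCircle) : ∀ᵐ x ∂(haarAddCircle : Measure UnitAddCircle), p (x + y) :=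
  (measurePreserving_add_right (haarAddCircle : Measure UnitAddCircle) y).quasiMeasurePreserving.ae h

theorem ae_translate_sub {p : UnitAddCircle → Prop}
    (h : ∀ᵐ x ∂(haarAddCircle : Measure UnitAddCircle), p x) (y : UnitAddCircle) :
    ∀ᵐ x ∂(haarAddCircle : Measure UnitAddCircle), p (x - y) := by
  simpa only [sub_eq_add_neg] using ae_translate h (-y)

theorem memLp_translate {u : UnitAddCircle → ℂ} (hu : MemLp u 2 haarAddCircle) (y : UnitAddCircle) :
    MemLp (fun x => u (x + y)) 2 (haarAddCircle : Measure UnitAddCircle) :=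
  hu.comp_measurePreserving (measurePreserving_add_right _ y)

theorem memLp_translate_sub {u : UnitAddCircle → ℂ} (hu : MemLp u 2 haarAddCircle)
    (y : UnitAddCircle) : MemLp (fun x => u (x - y)) 2 (haarAddCircle : Measure UnitAddCircle) := by
  simpa only [sub_eq_add_neg] using memLp_translate hu (-y)

theorem memLp_conj {u : UnitAddCircle → ℂ} (hu : MemLp u 2 haarAddCircle) :
    MemLp (fun x => conj (u x)) 2 (haarAddCircle : Measure UnitAddCircle) :=
  hu.mono (Complex.continuous_conj.comp_aestronglyMeasurable hu.1)
    (ae_of_all _ fun x => by rw [Complex.norm_conj])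

theorem memLp_continuous_mul {f u : UnitAddCircle → ℂ} (hf : Continuous f)
    (hu : MemLp u 2 haarAddCircle) :
    MemLp (fun x => f x * u x) 2 (haarAddCircle : Measure UnitAddCircle) := by
  obtain ⟨K, hK⟩ := (isCompact_range hf).isBounded.exists_norm_le
  refine hu.of_le_mul (c := K) (hf.aestronglyMeasurable.mul hu.1) (ae_of_all _ fun x => ?_)
  rw [norm_mul]
  gcongr
  exact hK _ ⟨x, rfl⟩

/-- The current of `u`, conserved along the rotation. -/
noncomputable def current (lam : Coupling) (α : ℝ) (θ : UnitAddCircle) (u : UnitAddCircle → ℂ)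
    (x : UnitAddCircle) : ℝ :=
  (hopping lam α x * (fourier 1 θ * u (x + (α : UnitAddCircle))) * conj (u x)).im

theorem integrable_current (lam : Coupling) (α : ℝ) (θ : UnitAddCircle) {u : UnitAddCircle → ℂ}
    (hu : MemLp u 2 haarAddCircle) : Integrable (current lam α θ u) haarAddCircle := by
  have h1 : MemLp (fun x => hopping lam α x * (fourier 1 θ * u (x + (α : UnitAddCircle)))) 2
      (haarAddCircle : Measure UnitAddCircle) :=
    memLp_continuous_mul (continuous_hopping lam α) ((memLp_translate hu _).const_mul _)
  exact (h1.integrable_mul (memLp_conj hu)).im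

/-- Multiply the equation by `conj (u x)` and take imaginary parts: the potential term is real, and
the two hopping terms are currents at neighbouring points. -/
theorem ae_im_mul_sq_eq_current_sub {lam : Coupling} {α : ℝ} {θ : UnitAddCircle} {E : ℂ}
    {u : UnitAddCircle → ℂ} (h : SolvesDual lam α θ E u) :
    ∀ᵐ x ∂(haarAddCircle : Measure UnitAddCircle), E.im * ‖u x‖ ^ 2 =
      current lam α θ u x - current lam α θ u (x - (α : UnitAddCircle)) := by
  filter_upwards [h] with x hx
  have h1 := congrArg (fun w => (w * conj (u x)).im) hx
  have h2 : E * u x * conj (u x) = E * ((‖u x‖ ^ 2 : ℝ) : ℂ) := by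
    rw [mul_assoc, Complex.mul_conj, Complex.normSq_eq_norm_sq]
  rw [h2, Complex.im_mul_ofReal] at h1
  rw [← h1, current, current, sub_add_cancel]
  have h3 : (potential x : ℂ) * u x * conj (u x) = ((potential x * ‖u x‖ ^ 2 : ℝ) : ℂ) := by
    rw [mul_assoc, Complex.mul_conj, Complex.normSq_eq_norm_sq, Complex.ofReal_mul]
  have h4 : conj (hopping lam α (x - (α : UnitAddCircle))) *
      (conj (fourier 1 θ) * u (x - (α : UnitAddCircle))) * conj (u x) =
      conj (hopping lam α (x - (α : UnitAddCircle)) * (fourier 1 θ * u x) *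
        conj (u (x - (α : UnitAddCircle)))) := by
    simp only [map_mul, Complex.conj_conj]; ring
  rw [add_mul, add_mul, h3, h4, Complex.add_im, Complex.add_im, Complex.ofReal_im, Complex.conj_im]
  ring

theorem im_eq_zero_of_solvesDual {lam : Coupling} {α : ℝ} {θ : UnitAddCircle} {E : ℂ}
    {u : UnitAddCircle → ℂ} (hu : MemLp u 2 haarAddCircle) (hu0 : ¬ (u =ᵐ[haarAddCircle] 0))
    (h : SolvesDual lam α θ E u) : E.im = 0 := by
  have h1 := integral_congr_ae (ae_im_mul_sq_eq_current_sub h)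
  have hi := integrable_current lam α θ hu
  have hi' : Integrable (fun x => current lam α θ u (x - (α : UnitAddCircle)))
      (haarAddCircle : Measure UnitAddCircle) := hi.comp_sub_right _
  rw [integral_const_mul, integral_sub hi hi', integral_sub_right_eq_self, sub_self] at h1
  rcases mul_eq_zero.1 h1 with h2 | h2
  · exact h2
  · exfalso
    have hsq : Integrable (fun x => ‖u x‖ ^ 2) (haarAddCircle : Measure UnitAddCircle) :=
      hu.integrable_norm_pow (by norm_num)
    rw [integral_eq_zero_iff_of_nonneg (fun x => by positivity) hsq] at h2
    refine hu0 ?_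
    filter_upwards [h2] with x hx
    simpa using hx

theorem ae_current_eq_const {lam : Coupling} {α : ℝ} (hα : Irrational α) {θ : UnitAddCircle} {E : ℂ}
    {u : UnitAddCircle → ℂ} (hu : MemLp u 2 haarAddCircle) (hE : E.im = 0)
    (h : SolvesDual lam α θ E u) :
    ∃ c : ℝ, ∀ᵐ x ∂(haarAddCircle : Measure UnitAddCircle), current lam α θ u x = c := by
  have h1 : current lam α θ u ∘ (fun x => x + (α : UnitAddCircle)) =ᵐ[haarAddCircle]
      current lam α θ u := by
    filter_upwards [ae_translate (ae_im_mul_sq_eq_current_sub h) (α : UnitAddCircle)] with x hx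
    rw [hE, zero_mul, add_sub_cancel_right] at hx
    simp only [Function.comp]
    linarith
  exact (ergodic_add_irrational hα).ae_eq_const_of_ae_eq_comp₀
    (integrable_current lam α θ hu).1.aemeasurable.nullMeasurable h1

/-! ### Invariant sections of the transfer cocycle -/

/-- The section of the cocycle given by a dual solution. -/
noncomputable def sectionU (α : ℝ) (θ : UnitAddCircle) (u : UnitAddCircle → ℂ) (x : UnitAddCircle) :
    Fin 2 → ℂ :=
  ![u x, conj (fourier 1 θ) * u (x - (α : UnitAddCircle))]

/-- The section of the cocycle given by the complex conjugate of a dual solution. -/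
noncomputable def sectionV (lam : Coupling) (α : ℝ) (θ : UnitAddCircle) (u : UnitAddCircle → ℂ)
    (x : UnitAddCircle) : Fin 2 → ℂ :=
  ![conj (hopping lam α (x - (α : UnitAddCircle))) * conj (u x),
    hopping lam α (x - (α : UnitAddCircle)) * (fourier 1 θ * conj (u (x - (α : UnitAddCircle))))]

theorem hoppingProd_succ (lam : Coupling) (α : ℝ) (n : ℕ) (x : UnitAddCircle) :
    hoppingProd lam α (n + 1) x =
      hoppingProd lam α n x * hopping lam α (x + n • (α : UnitAddCircle)) :=
  Finset.prod_range_succ _ _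

theorem ae_forall_translate {lam : Coupling} {α : ℝ} {θ : UnitAddCircle} {E : ℂ}
    {u : UnitAddCircle → ℂ} (h : SolvesDual lam α θ E u) :
    ∀ᵐ x ∂(haarAddCircle : Measure UnitAddCircle), ∀ j : ℕ,
      hopping lam α (x + j • (α : UnitAddCircle)) *
          (fourier 1 θ * u (x + (j + 1) • (α : UnitAddCircle))) +
        potential (x + j • (α : UnitAddCircle)) * u (x + j • (α : UnitAddCircle)) +
      conj (hopping lam α (x + j • (α : UnitAddCircle) - α)) *
        (conj (fourier 1 θ) * u (x + j • (α : UnitAddCircle) - α)) =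
      E * u (x + j • (α : UnitAddCircle)) := by
  rw [ae_all_iff]
  intro j
  filter_upwards [ae_translate h (j • (α : UnitAddCircle))] with x hx
  rw [succ_nsmul, ← add_assoc]
  exact hx

theorem transferProd_mulVec_sectionU {lam : Coupling} {α : ℝ} {θ : UnitAddCircle} {E : ℂ}
    {u : UnitAddCircle → ℂ} {x : UnitAddCircle} (h : ∀ j : ℕ,
      hopping lam α (x + j • (α : UnitAddCircle)) *
          (fourier 1 θ * u (x + (j + 1) • (α : UnitAddCircle))) +
        potential (x + j • (α : UnitAddCircle)) * u (x + j • (α : UnitAddCircle)) +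
      conj (hopping lam α (x + j • (α : UnitAddCircle) - α)) *
        (conj (fourier 1 θ) * u (x + j • (α : UnitAddCircle) - α)) =
      E * u (x + j • (α : UnitAddCircle))) (n : ℕ) :
    (transferProd lam α E n x).mulVec (sectionU α θ u x) =
      (fourier 1 θ ^ n * hoppingProd lam α n x) • sectionU α θ u (x + n • (α : UnitAddCircle)) := by
  induction n with
  | zero => simp [transferProd, hoppingProd]
  | succ n ih =>
    suffices key : (transfer lam α E (x + n • (α : UnitAddCircle))).mulVec
        (sectionU α θ u (x + n • (α : UnitAddCircle))) =
        (fourier 1 θ * hopping lam α (x + n • (α : UnitAddCircle))) •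
          sectionU α θ u (x + (n + 1) • (α : UnitAddCircle)) by
      rw [transferProd, ← Matrix.mulVec_mulVec, ih, Matrix.mulVec_smul, key, smul_smul,
        hoppingProd_succ, pow_succ, mul_mul_mul_comm]
    have h1 := h n
    have h2 := fourier_one_mul_conj θ
    have h3 : x + (n + 1) • (α : UnitAddCircle) - (α : UnitAddCircle) =
        x + n • (α : UnitAddCircle) := by rw [succ_nsmul]; abel
    ext i
    fin_cases i
    · simp only [transfer, sectionU, Matrix.mulVec, dotProduct, Fin.sum_univ_two, Fin.zero_eta,
        Matrix.of_apply, Matrix.cons_val_zero, Matrix.cons_val_one, Matrix.cons_val', Pi.smul_apply,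
        Matrix.cons_val_fin_one, smul_eq_mul]
      linear_combination -h1
    · simp only [transfer, sectionU, Matrix.mulVec, dotProduct, Fin.sum_univ_two, Fin.mk_one,
        Matrix.of_apply, Matrix.cons_val_zero, Matrix.cons_val_one, Matrix.cons_val', Pi.smul_apply,
        Matrix.cons_val_fin_one, smul_eq_mul, h3]
      linear_combination (-(hopping lam α (x + n • (α : UnitAddCircle)) *
        u (x + n • (α : UnitAddCircle)))) * h2

/-- For real energy `conj u` solves the conjugate equation. The hopping factors in `sectionV` turn
this into a section of the original cocycle without any division by the hopping function, which may
vanish. -/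
theorem transferProd_mulVec_sectionV {lam : Coupling} {α : ℝ} {θ : UnitAddCircle} {E : ℂ}
    (hE : E.im = 0) {u : UnitAddCircle → ℂ} {x : UnitAddCircle} (h : ∀ j : ℕ,
      hopping lam α (x + j • (α : UnitAddCircle)) *
          (fourier 1 θ * u (x + (j + 1) • (α : UnitAddCircle))) +
        potential (x + j • (α : UnitAddCircle)) * u (x + j • (α : UnitAddCircle)) +
      conj (hopping lam α (x + j • (α : UnitAddCircle) - α)) *
        (conj (fourier 1 θ) * u (x + j • (α : UnitAddCircle) - α)) =
      E * u (x + j • (α : UnitAddCircle))) (n : ℕ) :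
    (transferProd lam α E n x).mulVec (sectionV lam α θ u x) =
      (conj (fourier 1 θ) ^ n * conj (hoppingProd lam α n (x - (α : UnitAddCircle)))) •
        sectionV lam α θ u (x + n • (α : UnitAddCircle)) := by
  have hEc : conj E = E := Complex.conj_eq_iff_im.2 hE
  induction n with
  | zero => simp [transferProd, hoppingProd]
  | succ n ih =>
    suffices key : (transfer lam α E (x + n • (α : UnitAddCircle))).mulVec
        (sectionV lam α θ u (x + n • (α : UnitAddCircle))) =
        (conj (fourier 1 θ) *
          conj (hopping lam α (x - (α : UnitAddCircle) + n • (α : UnitAddCircle)))) •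
          sectionV lam α θ u (x + (n + 1) • (α : UnitAddCircle)) by
      rw [transferProd, ← Matrix.mulVec_mulVec, ih, Matrix.mulVec_smul, key, smul_smul,
        hoppingProd_succ, pow_succ, map_mul, mul_mul_mul_comm]
    have h1 := congrArg conj (h n)
    simp only [map_mul, map_add, Complex.conj_conj, Complex.conj_ofReal, hEc] at h1
    have h2 := fourier_one_mul_conj θ
    have h3 : x + (n + 1) • (α : UnitAddCircle) - (α : UnitAddCircle) =
        x + n • (α : UnitAddCircle) := by rw [succ_nsmul]; abel
    have h4 : x - (α : UnitAddCircle) + n • (α : UnitAddCircle) =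
        x + n • (α : UnitAddCircle) - (α : UnitAddCircle) := by abel
    rw [h4]
    ext i
    fin_cases i
    · simp only [transfer, sectionV, Matrix.mulVec, dotProduct, Fin.sum_univ_two, Fin.zero_eta,
        Matrix.of_apply, Matrix.cons_val_zero, Matrix.cons_val_one, Matrix.cons_val', Pi.smul_apply,
        Matrix.cons_val_fin_one, smul_eq_mul, h3]
      linear_combination -conj (hopping lam α (x + n • (α : UnitAddCircle) - α)) * h1
    · simp only [transfer, sectionV, Matrix.mulVec, dotProduct, Fin.sum_univ_two, Fin.mk_one,
        Matrix.of_apply, Matrix.cons_val_zero, Matrix.cons_val_one, Matrix.cons_val', Pi.smul_apply,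
        Matrix.cons_val_fin_one, smul_eq_mul, h3]
      linear_combination (-(hopping lam α (x + n • (α : UnitAddCircle)) *
        conj (hopping lam α (x + n • (α : UnitAddCircle) - α)) *
        conj (u (x + n • (α : UnitAddCircle))))) * h2

/-- The determinant of two plane vectors. -/
def det2 (v w : Fin 2 → ℂ) : ℂ := v 0 * w 1 - v 1 * w 0

/-- It recovers the trace from the action on two vectors, without passing to a basis adapted to
them. -/
theorem trace_mul_det2 (M : Matrix (Fin 2) (Fin 2) ℂ) (v w : Fin 2 → ℂ) :
    M.trace * det2 v w = det2 (M.mulVec v) w + det2 v (M.mulVec w) := by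
  simp only [det2, Matrix.trace_fin_two, Matrix.mulVec, dotProduct, Fin.sum_univ_two]
  ring

/-- The current measures the independence of the two sections; this is why its vanishing separates
the two cases. -/
theorem det2_sectionU_sectionV (lam : Coupling) (α : ℝ) (θ : UnitAddCircle) (u : UnitAddCircle → ℂ)
    (x : UnitAddCircle) : det2 (sectionU α θ u x) (sectionV lam α θ u x) =
      2 * Complex.I * current lam α θ u (x - (α : UnitAddCircle)) := by
  rw [current, sub_add_cancel]
  set w := hopping lam α (x - (α : UnitAddCircle)) * (fourier 1 θ * u x) *
    conj (u (x - (α : UnitAddCircle))) with hw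
  have h1 : 2 * Complex.I * (w.im : ℂ) = w - conj w := by
    rw [Complex.sub_conj]; push_cast; ring
  rw [h1, hw]
  simp only [det2, sectionU, sectionV, Matrix.cons_val_zero, Matrix.cons_val_one,
    Matrix.cons_val_fin_one, map_mul, Complex.conj_conj]
  ring

/-! ### Nonvanishing current -/

theorem fourier_natCast (n : ℕ) (x : UnitAddCircle) : fourier (n : ℤ) x = fourier 1 x ^ n := by
  induction n with
  | zero => simp
  | succ n ih => rw [pow_succ, ← ih]; push_cast; rw [fourier_add]

theorem det2_sub_left (v v' w : Fin 2 → ℂ) : det2 v w - det2 v' w = det2 (v - v') w := by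
  simp only [det2, Pi.sub_apply]; ring

theorem det2_sub_right (v w w' : Fin 2 → ℂ) : det2 v w - det2 v w' = det2 v (w - w') := by
  simp only [det2, Pi.sub_apply]; ring

theorem norm_det2_le (v w : Fin 2 → ℂ) : ‖det2 v w‖ ≤ ‖v 0‖ * ‖w 1‖ + ‖v 1‖ * ‖w 0‖ := by
  rw [det2, ← norm_mul, ← norm_mul]; exact norm_sub_le _ _

theorem memLp_sectionU (α : ℝ) (θ : UnitAddCircle) {u : UnitAddCircle → ℂ}
    (hu : MemLp u 2 haarAddCircle) (i : Fin 2) :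
    MemLp (fun x => sectionU α θ u x i) 2 (haarAddCircle : Measure UnitAddCircle) := by
  fin_cases i
  · exact hu
  · exact (memLp_translate_sub hu _).const_mul _

theorem memLp_sectionV (lam : Coupling) (α : ℝ) (θ : UnitAddCircle) {u : UnitAddCircle → ℂ}
    (hu : MemLp u 2 haarAddCircle) (i : Fin 2) :
    MemLp (fun x => sectionV lam α θ u x i) 2 (haarAddCircle : Measure UnitAddCircle) := by
  have hc : Continuous fun x : UnitAddCircle => hopping lam α (x - (α : UnitAddCircle)) :=
    (continuous_hopping lam α).comp (continuous_sub_right _)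
  fin_cases i
  · exact memLp_continuous_mul (Complex.continuous_conj.comp hc) (memLp_conj hu)
  · exact memLp_continuous_mul hc ((memLp_conj (memLp_translate_sub hu _)).const_mul _)

theorem continuous_transferProd_trace (lam : Coupling) (α : ℝ) (E : ℂ) (n : ℕ) :
    Continuous fun x => (transferProd lam α E n x).trace := by
  have h1 : Continuous fun x => transfer lam α E x := by
    refine continuous_matrix fun i j => ?_
    have h2 := continuous_hopping lam α
    have h3 := continuous_potential
    have h4 : Continuous fun x : UnitAddCircle => conj (hopping lam α (x - (α : UnitAddCircle))) :=
      Complex.continuous_conj.comp (h2.comp (continuous_sub_right _))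
    fin_cases i <;> fin_cases j <;> simp [transfer] <;> fun_prop
  have h2 : Continuous fun x => transferProd lam α E n x := by
    induction n with
    | zero => exact continuous_const
    | succ n ih => exact (h1.comp (continuous_add_const _)).matrix_mul ih
  exact h2.matrix_trace

/-- Were the sections unchanged by translation by `n α`, they would be eigenvectors and the trace
would be the sum of the two multipliers. The right side bounds the defect. -/
theorem norm_trace_sub_le {lam : Coupling} {α : ℝ} {θ : UnitAddCircle} {E : ℂ} (hE : E.im = 0)
    {u : UnitAddCircle → ℂ} (h : SolvesDual lam α θ E u) {c : ℝ}
    (hc : ∀ᵐ x ∂(haarAddCircle : Measure UnitAddCircle), current lam α θ u x = c) (n : ℕ) {B : ℝ}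
    (hB : ∀ x, ‖hoppingProd lam α n x‖ ≤ B) :
    ∀ᵐ x ∂(haarAddCircle : Measure UnitAddCircle), 2 * |c| *
      ‖(transferProd lam α E n x).trace - fourier 1 θ ^ n * hoppingProd lam α n x -
        conj (fourier 1 θ) ^ n * conj (hoppingProd lam α n (x - (α : UnitAddCircle)))‖ ≤
      B * (‖sectionU α θ u (x + n • (α : UnitAddCircle)) 0 - sectionU α θ u x 0‖ *
          ‖sectionV lam α θ u x 1‖ +
        ‖sectionU α θ u (x + n • (α : UnitAddCircle)) 1 - sectionU α θ u x 1‖ *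
          ‖sectionV lam α θ u x 0‖) +
      B * (‖sectionV lam α θ u (x + n • (α : UnitAddCircle)) 1 - sectionV lam α θ u x 1‖ *
          ‖sectionU α θ u x 0‖ +
        ‖sectionV lam α θ u (x + n • (α : UnitAddCircle)) 0 - sectionV lam α θ u x 0‖ *
          ‖sectionU α θ u x 1‖) := by
  filter_upwards [ae_forall_translate h, ae_translate_sub hc (α : UnitAddCircle)] with x hx hcx
  have h1 := trace_mul_det2 (transferProd lam α E n x) (sectionU α θ u x) (sectionV lam α θ u x)
  rw [transferProd_mulVec_sectionU hx, transferProd_mulVec_sectionV hE hx] at h1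
  have h2 := det2_sectionU_sectionV lam α θ u x
  rw [hcx] at h2
  set U := sectionU α θ u x
  set U' := sectionU α θ u (x + n • (α : UnitAddCircle))
  set V := sectionV lam α θ u x
  set V' := sectionV lam α θ u (x + n • (α : UnitAddCircle))
  set p := hoppingProd lam α n x with hp
  set p' := hoppingProd lam α n (x - (α : UnitAddCircle)) with hp'
  set e := fourier 1 θ with he
  have h3 : (2 * Complex.I * c) * ((transferProd lam α E n x).trace - e ^ n * p -
      conj e ^ n * conj p') =
      e ^ n * p * det2 (U' - U) V + conj e ^ n * conj p' * det2 U (V' - V) := by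
    rw [← det2_sub_left, ← det2_sub_right, h2, mul_sub, mul_sub, mul_comm _ (Matrix.trace _),
      ← h2, h1]
    simp only [det2, Pi.smul_apply, smul_eq_mul]
    ring
  have h4 := congrArg norm h3
  have hne : ‖(2 * Complex.I * c : ℂ)‖ = 2 * |c| := by simp
  have hn1 : ‖e ^ n‖ = 1 := by rw [norm_pow, he, norm_fourier_one, one_pow]
  have hn2 : ‖conj e ^ n‖ = 1 := by
    rw [norm_pow, Complex.norm_conj, he, norm_fourier_one, one_pow]
  rw [norm_mul, hne] at h4
  rw [h4]
  refine (norm_add_le _ _).trans ?_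
  rw [norm_mul, norm_mul, norm_mul, norm_mul, hn1, hn2, Complex.norm_conj, one_mul, one_mul]
  have hB0 : 0 ≤ B := (norm_nonneg _).trans (hB x)
  refine add_le_add (mul_le_mul (hB x) (norm_det2_le _ _) (norm_nonneg _) hB0)
    (mul_le_mul (hB _) ((norm_det2_le _ _).trans (le_of_eq ?_)) (norm_nonneg _) hB0)
  simp only [Pi.sub_apply]
  ring

/-- The trace formula is integrated against `fourier 1 x ^ q n`, leaving only extreme Fourier
coefficients; its error vanishes by `L²` continuity of translations. -/
theorem tendsto_of_current_ne_zero {lam : Coupling} {α : ℝ} {θ : UnitAddCircle} {E : ℂ}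
    (hE : E.im = 0) {u : UnitAddCircle → ℂ} (hu : MemLp u 2 haarAddCircle)
    (h : SolvesDual lam α θ E u) {c : ℝ} (hc0 : c ≠ 0)
    (hc : ∀ᵐ x ∂(haarAddCircle : Measure UnitAddCircle), current lam α θ u x = c)
    {q : ℕ → ℕ} (hq : Tendsto (fun n => q n • (α : UnitAddCircle)) atTop (𝓝 0)) {K ρ : ℝ}
    (hρ : 0 < ρ) (hK : ∀ n x, ‖hoppingProd lam α (q n) x‖ ≤ K * ρ ^ q n) :
    Tendsto (fun n => leadPhase α (q n) * (transferLead lam α ^ q n).trace / ρ ^ q n +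
      -(∫ x, fourier 1 x ^ q n * hoppingProd lam α (q n) x ∂haarAddCircle) / ρ ^ q n *
        fourier (q n : ℤ) θ +
      -(∫ x, fourier 1 x ^ q n * conj (hoppingProd lam α (q n) (x - (α : UnitAddCircle)))
        ∂haarAddCircle) / ρ ^ q n * fourier (-(q n : ℤ)) θ) atTop (𝓝 0) := by
  have hU := memLp_sectionU α θ hu
  have hV := memLp_sectionV lam α θ hu
  set f1 : ℕ → UnitAddCircle → ℝ := fun n x =>
    ‖sectionU α θ u (x + q n • (α : UnitAddCircle)) 0 - sectionU α θ u x 0‖ *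
          ‖sectionV lam α θ u x 1‖ with hf1
  set f2 : ℕ → UnitAddCircle → ℝ := fun n x =>
    ‖sectionU α θ u (x + q n • (α : UnitAddCircle)) 1 - sectionU α θ u x 1‖ *
          ‖sectionV lam α θ u x 0‖ with hf2
  set f3 : ℕ → UnitAddCircle → ℝ := fun n x =>
    ‖sectionV lam α θ u (x + q n • (α : UnitAddCircle)) 1 - sectionV lam α θ u x 1‖ *
          ‖sectionU α θ u x 0‖ with hf3
  set f4 : ℕ → UnitAddCircle → ℝ := fun n x =>
    ‖sectionV lam α θ u (x + q n • (α : UnitAddCircle)) 0 - sectionV lam α θ u x 0‖ *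
          ‖sectionU α θ u x 1‖ with hf4
  have hint : ∀ {f g : UnitAddCircle → ℂ}, MemLp f 2 haarAddCircle → MemLp g 2 haarAddCircle →
      ∀ y, Integrable (fun x => ‖f (x + y) - f x‖ * ‖g x‖)
        (haarAddCircle : Measure UnitAddCircle) := fun hf hg y =>
    ((memLp_translate hf y).sub hf).norm.integrable_mul hg.norm
  have hlim : Tendsto (fun n => K / (2 * |c|) * ((∫ x, f1 n x ∂haarAddCircle) +
      (∫ x, f2 n x ∂haarAddCircle) + (∫ x, f3 n x ∂haarAddCircle) +
      (∫ x, f4 n x ∂haarAddCircle))) atTop (𝓝 0) := by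
    have h1 := tendsto_integral_translate_sub_mul (hU 0) (hV 1) hq
    have h2 := tendsto_integral_translate_sub_mul (hU 1) (hV 0) hq
    have h3 := tendsto_integral_translate_sub_mul (hV 1) (hU 0) hq
    have h4 := tendsto_integral_translate_sub_mul (hV 0) (hU 1) hq
    have := (((h1.add h2).add h3).add h4).const_mul (K / (2 * |c|))
    simpa using this
  refine squeeze_zero_norm (fun n => ?_) hlim
  have hzc : Continuous fun x : UnitAddCircle => (fourier 1 x : ℂ) ^ q n := by fun_prop
  have hPc := continuous_hoppingProd lam α (q n)
  have hPc' : Continuous fun x : UnitAddCircle =>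
      conj (hoppingProd lam α (q n) (x - (α : UnitAddCircle))) :=
    Complex.continuous_conj.comp (hPc.comp (continuous_sub_right _))
  have hTc := continuous_transferProd_trace lam α E (q n)
  have hci : ∀ {f : UnitAddCircle → ℂ}, Continuous f → Integrable f haarAddCircle := fun hf =>
    hf.integrable_of_hasCompactSupport (HasCompactSupport.of_compactSpace _)
  have hcpos : 0 < 2 * |c| := by positivity
  have hρn : (0 : ℝ) < ρ ^ q n := by positivity
  have e1 : leadPhase α (q n) * (transferLead lam α ^ q n).trace / ρ ^ q n +
      -(∫ x, fourier 1 x ^ q n * hoppingProd lam α (q n) x ∂haarAddCircle) / ρ ^ q n *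
        fourier (q n : ℤ) θ +
      -(∫ x, fourier 1 x ^ q n * conj (hoppingProd lam α (q n) (x - (α : UnitAddCircle)))
        ∂haarAddCircle) / ρ ^ q n * fourier (-(q n : ℤ)) θ =
      (∫ x, fourier 1 x ^ q n * ((transferProd lam α E (q n) x).trace -
        fourier 1 θ ^ q n * hoppingProd lam α (q n) x - conj (fourier 1 θ) ^ q n *
          conj (hoppingProd lam α (q n) (x - (α : UnitAddCircle)))) ∂haarAddCircle) / ρ ^ q n := by
    rw [fourier_neg, fourier_natCast, ← integral_pow_mul_trace lam α E, map_pow]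
    have e2 : ∀ x : UnitAddCircle, fourier 1 x ^ q n * ((transferProd lam α E (q n) x).trace -
        fourier 1 θ ^ q n * hoppingProd lam α (q n) x - conj (fourier 1 θ) ^ q n *
          conj (hoppingProd lam α (q n) (x - (α : UnitAddCircle)))) =
        fourier 1 x ^ q n * (transferProd lam α E (q n) x).trace -
        fourier 1 θ ^ q n * (fourier 1 x ^ q n * hoppingProd lam α (q n) x) -
        conj (fourier 1 θ) ^ q n * (fourier 1 x ^ q n *
          conj (hoppingProd lam α (q n) (x - (α : UnitAddCircle)))) := fun x => by ring
    simp_rw [e2]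
    have i1 : Integrable (fun x => fourier 1 x ^ q n * (transferProd lam α E (q n) x).trace)
        haarAddCircle := hci (hzc.mul hTc)
    have i2 : Integrable (fun x => fourier 1 θ ^ q n * (fourier 1 x ^ q n *
        hoppingProd lam α (q n) x)) haarAddCircle := hci (continuous_const.mul (hzc.mul hPc))
    have i3 : Integrable (fun x => conj (fourier 1 θ) ^ q n * (fourier 1 x ^ q n *
          conj (hoppingProd lam α (q n) (x - (α : UnitAddCircle))))) haarAddCircle :=
      hci (continuous_const.mul (hzc.mul hPc'))
    have i12 : Integrable (fun x => fourier 1 x ^ q n * (transferProd lam α E (q n) x).trace -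
        fourier 1 θ ^ q n * (fourier 1 x ^ q n * hoppingProd lam α (q n) x)) haarAddCircle :=
      i1.sub i2
    rw [integral_sub i12 i3, integral_sub i1 i2, integral_const_mul, integral_const_mul]
    ring
  rw [e1, norm_div, norm_pow, Complex.norm_real, Real.norm_of_nonneg hρ.le, div_le_iff₀ hρn]
  refine (norm_integral_le_integral_norm _).trans ?_
  have hb : ∀ᵐ x ∂(haarAddCircle : Measure UnitAddCircle),
      ‖fourier 1 x ^ q n * ((transferProd lam α E (q n) x).trace -
        fourier 1 θ ^ q n * hoppingProd lam α (q n) x - conj (fourier 1 θ) ^ q n *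
          conj (hoppingProd lam α (q n) (x - (α : UnitAddCircle))))‖ ≤
      K * ρ ^ q n / (2 * |c|) * (f1 n x + f2 n x + f3 n x + f4 n x) := by
    filter_upwards [norm_trace_sub_le hE h hc (q n) (hK n)] with x hx
    rw [norm_mul, norm_pow, norm_fourier_one, one_pow, one_mul, div_mul_eq_mul_div,
      le_div_iff₀ hcpos]
    simp only [hf1, hf2, hf3, hf4]
    linarith
  have i1 := hint (hU 0) (hV 1) (q n • (α : UnitAddCircle))
  have i2 := hint (hU 1) (hV 0) (q n • (α : UnitAddCircle))
  have i3 := hint (hV 1) (hU 0) (q n • (α : UnitAddCircle))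
  have i4 := hint (hV 0) (hU 1) (q n • (α : UnitAddCircle))
  have i12 : Integrable (fun x => f1 n x + f2 n x) haarAddCircle := i1.add i2
  have i123 : Integrable (fun x => f1 n x + f2 n x + f3 n x) haarAddCircle := i12.add i3
  have i1234 : Integrable (fun x => f1 n x + f2 n x + f3 n x + f4 n x) haarAddCircle := i123.add i4
  refine (integral_mono_of_nonneg (ae_of_all _ fun x => norm_nonneg _)
    (i1234.const_mul _) hb).trans (le_of_eq ?_)
  rw [integral_const_mul, integral_add i123 i4, integral_add i12 i3, integral_add i1 i2]
  ring

/-! ### Vanishing current -/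

/-- For fixed `x` these quantities obey a second-order recurrence with real coefficients. The
initial values are `|u x|²` and one whose imaginary part is the current, so both are real. -/
theorem ae_im_eq_zero_of_current_eq_zero {lam : Coupling} {α : ℝ} {θ : UnitAddCircle} {E : ℂ}
    (hE : E.im = 0) {u : UnitAddCircle → ℂ} (h : SolvesDual lam α θ E u)
    (hc : ∀ᵐ x ∂(haarAddCircle : Measure UnitAddCircle), current lam α θ u x = 0) :
    ∀ᵐ x ∂(haarAddCircle : Measure UnitAddCircle), ∀ n : ℕ,
      (fourier 1 θ ^ n * hoppingProd lam α n x * u (x + n • (α : UnitAddCircle)) *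
        conj (u x)).im = 0 := by
  filter_upwards [ae_forall_translate h, hc] with x hx hcx
  set X : ℕ → ℂ := fun n => fourier 1 θ ^ n * hoppingProd lam α n x *
    u (x + n • (α : UnitAddCircle)) * conj (u x) with hX
  have hEr : E = E.re := (Complex.conj_eq_iff_re.1 (Complex.conj_eq_iff_im.2 hE)).symm
  have hrec : ∀ n, X (n + 2) = ((E.re - potential (x + (n + 1) • (α : UnitAddCircle)) : ℝ) : ℂ) *
      X (n + 1) - ((‖hopping lam α (x + n • (α : UnitAddCircle))‖ ^ 2 : ℝ) : ℂ) * X n := by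
    intro n
    have h1 := hx (n + 1)
    have h2 : x + (n + 1) • (α : UnitAddCircle) - (α : UnitAddCircle) =
        x + n • (α : UnitAddCircle) := by rw [succ_nsmul]; abel
    rw [h2, hEr] at h1
    have h3 := fourier_one_mul_conj θ
    simp only [hX]
    rw [hoppingProd_succ lam α (n + 1), hoppingProd_succ lam α n]
    have h4 : ((‖hopping lam α (x + n • (α : UnitAddCircle))‖ ^ 2 : ℝ) : ℂ) =
        hopping lam α (x + n • (α : UnitAddCircle)) *
          conj (hopping lam α (x + n • (α : UnitAddCircle))) := by
      rw [Complex.mul_conj, Complex.normSq_eq_norm_sq]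
    rw [h4, show n + 2 = n + 1 + 1 from rfl]
    push_cast
    rw [pow_succ _ (n + 1), pow_succ _ n]
    set P := hoppingProd lam α n x
    set c0 := hopping lam α (x + n • (α : UnitAddCircle))
    set e := fourier 1 θ
    linear_combination (e ^ n * e * P * c0 * conj (u x)) * h1 -
      e ^ n * P * c0 * conj (u x) * conj c0 * u (x + n • (α : UnitAddCircle)) * h3
  have key : ∀ n, (X n).im = 0 ∧ (X (n + 1)).im = 0 := by
    intro n
    induction n with
    | zero =>
      refine ⟨?_, ?_⟩
      · simp only [hX, pow_zero, hoppingProd, Finset.range_zero, Finset.prod_empty, zero_smul,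
          add_zero, one_mul]
        rw [Complex.mul_conj, Complex.ofReal_im]
      · rw [current] at hcx
        simp only [hX, hoppingProd, zero_add, pow_one, Finset.range_one, Finset.prod_singleton,
          zero_smul, add_zero, one_smul]
        rw [← hcx]
        congr 1
        ring
    | succ n ih =>
      refine ⟨ih.2, ?_⟩
      rw [hrec, Complex.sub_im, Complex.im_ofReal_mul, Complex.im_ofReal_mul, ih.1, ih.2]
      ring
  exact fun n => (key n).1

theorem nullSingletonClass_haarAddCircle :
    NullSingletonClass (haarAddCircle : Measure UnitAddCircle) := by
  have : Nontrivial UnitAddCircle := ⟨((1 / 2 : ℝ) : UnitAddCircle), 0, by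
    rw [ne_eq, AddCircle.coe_eq_zero_iff]
    rintro ⟨n, hn⟩
    have h2 : (2 * n : ℝ) = 1 := by rw [zsmul_eq_mul, mul_one] at hn; linarith
    have : 2 * n = 1 := by exact_mod_cast h2
    omega⟩
  have : (𝓝[≠] (0 : UnitAddCircle)).NeBot := inferInstance
  infer_instance

theorem ae_hopping_ne_zero {lam : Coupling} (F : HoppingFactorization lam) (α : ℝ) :
    ∀ᵐ x ∂(haarAddCircle : Measure UnitAddCircle), hopping lam α x ≠ 0 := by
  have key : ∀ a : ℂ, ∀ᵐ x ∂(haarAddCircle : Measure UnitAddCircle), 1 - a * fourier 1 x ≠ 0 := by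
    intro a
    have hs : {x : UnitAddCircle | ¬ (1 - a * fourier 1 x ≠ 0)}.Subsingleton := by
      intro x hx y hy
      simp only [ne_eq, not_not, Set.mem_ofPred_eq] at hx hy
      have ha : a ≠ 0 := by rintro rfl; simp at hx
      have h1 : a * fourier 1 x = a * fourier 1 y := by linear_combination hy - hx
      have h2 := mul_left_cancel₀ ha h1
      rw [fourier_one, fourier_one] at h2
      exact AddCircle.injective_toCircle one_ne_zero (Circle.coe_injective h2)
    have := nullSingletonClass_haarAddCircle
    rw [ae_iff]
    exact hs.measure_zero _
  filter_upwards [key (F.a * halfPhase α), key (F.b * halfPhase α)] with x ha hb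
  rw [← norm_ne_zero_iff, F.norm_hopping]
  have h1 := norm_ne_zero_iff.2 ha
  have h2 := norm_ne_zero_iff.2 hb
  have h3 := F.ρ_pos.ne'
  positivity

/-- Both `hopping x * Π_n (x + α)` and `Π_n x * hopping (x + nα)` equal `Π_{n+1} x`. Hence `Π_n` is
almost invariant under the rotation when `nα` is near zero. -/
theorem hopping_mul_hoppingProd_sub (lam : Coupling) (α : ℝ) (n : ℕ) (x : UnitAddCircle) :
    hopping lam α x * (hoppingProd lam α n (x + (α : UnitAddCircle)) - hoppingProd lam α n x) =
      hoppingProd lam α n x * (hopping lam α (x + n • (α : UnitAddCircle)) - hopping lam α x) := by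
  have h1 : hopping lam α x * hoppingProd lam α n (x + (α : UnitAddCircle)) =
      hoppingProd lam α (n + 1) x := by
    rw [hoppingProd, hoppingProd, Finset.prod_range_succ', zero_smul, add_zero, mul_comm]
    congr 1
    refine Finset.prod_congr rfl fun j _ => ?_
    rw [succ_nsmul', add_assoc]
  rw [hoppingProd_succ] at h1
  linear_combination h1

/-- Realness of `e^{2πi q_n θ} Π(x) u(x + q_n α) conj (u x)` and `q_n α → 0` make `|A n| |u|²` small
in `L¹`. This says nothing where `u` vanishes; almost invariance of `A n` and ergodicity spread the
convergence to the whole circle. -/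
theorem tendsto_integral_sq_of_current_eq_zero {lam : Coupling} (F : HoppingFactorization lam)
    {α : ℝ} (hα : Irrational α) {θ : UnitAddCircle} {E : ℂ}
    (hE : E.im = 0) {u : UnitAddCircle → ℂ} (hu : MemLp u 2 haarAddCircle)
    (hu0 : ¬ (u =ᵐ[haarAddCircle] 0)) (h : SolvesDual lam α θ E u)
    (hc : ∀ᵐ x ∂(haarAddCircle : Measure UnitAddCircle), current lam α θ u x = 0)
    {q : ℕ → ℕ} (hq : Tendsto (fun n => q n • (α : UnitAddCircle)) atTop (𝓝 0)) {K : ℝ}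
    (hK : ∀ n x, ‖hoppingProd lam α (q n) x‖ ≤ K * F.ρ ^ q n) :
    Tendsto (fun n => ∫ x, (fourier 1 θ ^ q n *
      (hoppingProd lam α (q n) x / F.ρ ^ q n)).im ^ 2 ∂haarAddCircle) atTop (𝓝 0) := by
  set A : ℕ → UnitAddCircle → ℝ := fun n x =>
    (fourier 1 θ ^ q n * (hoppingProd lam α (q n) x / F.ρ ^ q n)).im with hA
  have hρ := F.ρ_pos
  have hp : ∀ n x, ‖hoppingProd lam α (q n) x / F.ρ ^ q n‖ ≤ K := by
    intro n x
    rw [norm_div, norm_pow, Complex.norm_real, Real.norm_of_nonneg hρ.le,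
      div_le_iff₀ (pow_pos hρ _)]
    exact hK n x
  have hK0 : 0 ≤ K := (norm_nonneg _).trans (hp 0 0)
  have he : ∀ n, ‖(fourier 1 θ : ℂ) ^ n‖ = 1 := fun n => by
    rw [norm_pow, norm_fourier_one, one_pow]
  have hAb : ∀ n x, |A n x| ≤ K := by
    intro n x
    refine (Complex.abs_im_le_norm _).trans ?_
    rw [norm_mul, he, one_mul]
    exact hp n x
  have hAc : ∀ n, Continuous (A n) := by
    intro n
    have := continuous_hoppingProd lam α (q n)
    exact Complex.continuous_im.comp (continuous_const.mul (this.div_const _))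
  have hL1 : Tendsto (fun n => ∫ x, |A n x| * ‖u x‖ ^ 2 ∂haarAddCircle) atTop (𝓝 0) := by
    have h1 := (tendsto_integral_translate_sub_mul hu hu hq).const_mul K
    rw [mul_zero] at h1
    refine squeeze_zero (fun n => integral_nonneg fun x => by positivity) (fun n => ?_) h1
    rw [← integral_const_mul]
    have hi : Integrable (fun x => K * (‖u (x + q n • (α : UnitAddCircle)) - u x‖ * ‖u x‖))
        (haarAddCircle : Measure UnitAddCircle) :=
      ((((memLp_translate hu _).sub hu).norm).integrable_mul hu.norm).const_mul K
    refine integral_mono_of_nonneg (ae_of_all _ fun x => by positivity) hi ?_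
    filter_upwards [ae_im_eq_zero_of_current_eq_zero hE h hc] with x hx
    have h2 := hx (q n)
    have h3 : A n x * ‖u x‖ ^ 2 = -(fourier 1 θ ^ q n * (hoppingProd lam α (q n) x / F.ρ ^ q n) *
        ((u (x + q n • (α : UnitAddCircle)) - u x) * conj (u x))).im := by
      have h4 : (fourier 1 θ ^ q n * (hoppingProd lam α (q n) x / F.ρ ^ q n) *
          (u (x + q n • (α : UnitAddCircle)) * conj (u x))).im = 0 := by
        have h5 : fourier 1 θ ^ q n * (hoppingProd lam α (q n) x / F.ρ ^ q n) *
            (u (x + q n • (α : UnitAddCircle)) * conj (u x)) =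
            (fourier 1 θ ^ q n * hoppingProd lam α (q n) x *
              u (x + q n • (α : UnitAddCircle)) * conj (u x)) / ((F.ρ ^ q n : ℝ) : ℂ) := by
          push_cast; ring
        rw [h5, Complex.div_ofReal_im, h2, zero_div]
      rw [sub_mul, mul_sub, Complex.sub_im, h4, Complex.mul_conj, Complex.normSq_eq_norm_sq,
        Complex.im_mul_ofReal]
      simp only [hA]
      ring
    have h6 : |A n x| * ‖u x‖ ^ 2 = |A n x * ‖u x‖ ^ 2| := by
      rw [abs_mul, abs_of_nonneg (by positivity : 0 ≤ ‖u x‖ ^ 2)]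
    rw [h6, h3, abs_neg]
    refine (Complex.abs_im_le_norm _).trans ?_
    rw [norm_mul, norm_mul, norm_mul, he, one_mul, Complex.norm_conj]
    gcongr
    exact hp n x
  have hshift : ∀ᵐ x ∂(haarAddCircle : Measure UnitAddCircle),
      Tendsto (fun n => A n (x + (α : UnitAddCircle)) - A n x) atTop (𝓝 0) := by
    filter_upwards [ae_hopping_ne_zero F α] with x hx
    have hx' : 0 < ‖hopping lam α x‖ := norm_pos_iff.2 hx
    have h1 : Tendsto (fun n => hopping lam α (x + q n • (α : UnitAddCircle)) - hopping lam α x)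
        atTop (𝓝 0) := by
      have h2 := ((continuous_hopping lam α).tendsto (x + 0)).comp (hq.const_add x)
      rw [add_zero] at h2
      simpa using h2.sub_const (hopping lam α x)
    have h3 := (h1.norm.const_mul (K / ‖hopping lam α x‖))
    rw [norm_zero, mul_zero] at h3
    refine squeeze_zero_norm (fun n => ?_) h3
    rw [Real.norm_eq_abs]
    simp only [hA]
    rw [← Complex.sub_im, ← mul_sub, ← sub_div]
    refine (Complex.abs_im_le_norm _).trans ?_
    rw [norm_mul, he, one_mul, div_mul_eq_mul_div, le_div_iff₀ hx', norm_div, norm_pow,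
      Complex.norm_real, Real.norm_of_nonneg hρ.le, div_mul_eq_mul_div,
      div_le_iff₀ (pow_pos hρ _), mul_comm, ← norm_mul, hopping_mul_hoppingProd_sub, norm_mul]
    calc _ ≤ K * F.ρ ^ q n * ‖hopping lam α (x + q n • (α : UnitAddCircle)) - hopping lam α x‖ := by
          gcongr; exact hK n x
      _ = _ := by ring
  -- Convergence in `L¹` gives pointwise convergence only along subsequences, so the limit is proved
  -- by extracting one from an arbitrary subsequence.
  refine tendsto_of_subseq_tendsto fun ns hns => ?_
  obtain ⟨ms, hms, hlim⟩ : ∃ ms : ℕ → ℕ, StrictMono ms ∧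
      ∀ᵐ x ∂(haarAddCircle : Measure UnitAddCircle),
        Tendsto (fun k => |A (ns (ms k)) x| * ‖u x‖ ^ 2) atTop (𝓝 0) := by
    have hmeas : ∀ n, AEStronglyMeasurable (fun x => |A n x| * ‖u x‖ ^ 2)
        (haarAddCircle : Measure UnitAddCircle) := fun n =>
      ((hAc n).abs.aestronglyMeasurable).mul (hu.1.norm.pow 2)
    have hint : ∀ n, Integrable (fun x => |A n x| * ‖u x‖ ^ 2)
        (haarAddCircle : Measure UnitAddCircle) := fun n =>
      (hu.integrable_norm_pow (by norm_num)).bdd_mul (hAc n).abs.aestronglyMeasurable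
        (ae_of_all _ fun x => by rw [Real.norm_eq_abs, abs_abs]; exact hAb n x)
    have h1 : TendstoInMeasure (haarAddCircle : Measure UnitAddCircle)
        (fun k x => |A (ns k) x| * ‖u x‖ ^ 2) atTop (fun _ => 0) := by
      refine tendstoInMeasure_of_tendsto_eLpNorm one_ne_zero (fun k => hmeas _)
        aestronglyMeasurable_const ?_
      have h2 := ENNReal.tendsto_ofReal (hL1.comp hns)
      rw [ENNReal.ofReal_zero] at h2
      refine h2.congr fun k => ?_
      simp only [Function.comp]
      rw [eLpNorm_one_eq_lintegral_enorm, ← ofReal_integral_norm_eq_lintegral_enorm]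
      · congr 1
        refine integral_congr_ae (ae_of_all _ fun x => ?_)
        simp
      · simpa [Pi.sub_def] using hint (ns k)
    exact h1.exists_seq_tendsto_ae
  refine ⟨ms, ?_⟩
  have hns' : Tendsto (fun k => ns (ms k)) atTop atTop := hns.comp hms.tendsto_atTop
  set Z : Set UnitAddCircle := {x | Tendsto (fun k => A (ns (ms k)) x) atTop (𝓝 0)} with hZ
  have hZm : MeasurableSet Z := measurableSet_tendsto _ fun k => (hAc _).measurable
  -- The convergence set is invariant up to a null set, so it is null or conull; null would force `u
  -- = 0` almost everywhere.
  have hZinv : (fun x : UnitAddCircle => x + (α : UnitAddCircle)) ⁻¹' Z =ᵐ[haarAddCircle] Z := by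
    filter_upwards [hshift] with x hx
    have hx' := hx.comp hns'
    refine propext ⟨fun hz => ?_, fun hz => ?_⟩
    · have := (show Tendsto (fun k => A (ns (ms k)) (x + (α : UnitAddCircle))) atTop (𝓝 0)
        from hz).sub hx'
      rw [sub_zero] at this
      exact this.congr fun k => by simp only [Function.comp]; ring
    · have := hx'.add (show Tendsto (fun k => A (ns (ms k)) x) atTop (𝓝 0) from hz)
      rw [zero_add] at this
      exact this.congr fun k => by simp only [Function.comp]; ring
  have hZae : ∀ᵐ x ∂(haarAddCircle : Measure UnitAddCircle), x ∈ Z := by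
    rcases (ergodic_add_irrational hα).quasiErgodic.ae_mem_or_ae_notMem₀ hZm.nullMeasurableSet
      hZinv with h1 | h1
    · exact h1
    · refine absurd ?_ hu0
      filter_upwards [h1, hlim] with x hx1 hx2
      by_contra hne
      refine hx1 ?_
      have hpos : ‖u x‖ ^ 2 ≠ 0 := by
        have := norm_ne_zero_iff.2 hne
        positivity
      have h3 := hx2.mul_const (‖u x‖ ^ 2)⁻¹
      rw [zero_mul] at h3
      have h4 : Tendsto (fun k => |A (ns (ms k)) x|) atTop (𝓝 0) :=
        h3.congr fun k => mul_inv_cancel_right₀ hpos _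
      exact tendsto_zero_iff_abs_tendsto_zero _ |>.2 h4
  rw [← integral_zero UnitAddCircle ℝ (μ := haarAddCircle)]
  refine tendsto_integral_of_dominated_convergence (fun _ => K ^ 2)
    (fun k => ((hAc _).pow 2).aestronglyMeasurable) (integrable_const _)
    (fun k => ae_of_all _ fun x => ?_) ?_
  · rw [Real.norm_eq_abs, abs_pow]
    exact pow_le_pow_left₀ (abs_nonneg _) (hAb _ x) 2
  · filter_upwards [hZae] with x hx
    have := (show Tendsto (fun k => A (ns (ms k)) x) atTop (𝓝 0) from hx).pow 2
    rw [zero_pow two_ne_zero] at this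
    exact this

/-! ### Absence of eigenvalues -/

theorem norm_ratio_le {C : ℂ} {B K ρ : ℝ} (hρ : 0 < ρ) {n : ℕ} (h : ‖C‖ = B) (hB : B ≤ K * ρ ^ n) :
    ‖-C / (ρ : ℂ) ^ n‖ ≤ K := by
  rw [norm_div, norm_neg, norm_pow, Complex.norm_real, Real.norm_of_nonneg hρ.le,
    div_le_iff₀ (pow_pos hρ _), h]
  exact hB

theorem norm_integral_le_const {f : UnitAddCircle → ℂ} {B : ℝ} (h : ∀ x, ‖f x‖ ≤ B) :
    ‖∫ x, f x ∂haarAddCircle‖ ≤ B := by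
  have := norm_integral_le_of_norm_le_const (μ := (haarAddCircle : Measure UnitAddCircle))
    (Eventually.of_forall h)
  simpa using this

theorem norm_fourier_eq_one (m : ℤ) (θ : UnitAddCircle) : ‖fourier m θ‖ = 1 := by
  rw [fourier_apply]; exact Circle.norm_coe _

/-- The modulus is `|1 + (ν/ρ) ^ n|`, and `ρ + ν = 1 > 0` keeps `ν/ρ` strictly above `-1`. -/
theorem exists_le_norm_trace_div {lam : Coupling} {ρ ν : ℝ} (hρ : 0 < ρ) (hν : ν ≤ ρ)
    (h1 : ρ + ν = 1) (h2 : ρ * ν = lam.l1 * lam.l3) (α : ℝ) :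
    ∃ δ > 0, ∀ n ≠ 0, δ ≤ ‖leadPhase α n * (transferLead lam α ^ n).trace / (ρ : ℂ) ^ n‖ := by
  have hx : |ν / ρ| ≤ 1 := by
    rw [abs_div, abs_of_pos hρ, div_le_one hρ, abs_le]
    exact ⟨by linarith, hν⟩
  have hx' : -1 < ν / ρ := by
    rw [lt_div_iff₀ hρ]; linarith
  have hnorm : ∀ n : ℕ, ‖leadPhase α n * (transferLead lam α ^ n).trace / (ρ : ℂ) ^ n‖ =
      |1 + (ν / ρ) ^ n| := by
    intro n
    have hρ' : (ρ : ℂ) ≠ 0 := by exact_mod_cast hρ.ne'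
    have : (transferLead lam α ^ n).trace / (ρ : ℂ) ^ n =
        (-1) ^ n * ((1 + (ν / ρ) ^ n : ℝ) : ℂ) := by
      rw [trace_transferLead_pow h1 h2, neg_pow, neg_pow (ν : ℂ)]
      push_cast
      rw [div_pow]
      field_simp
    rw [mul_div_assoc, this, norm_mul, norm_leadPhase, one_mul, norm_mul, norm_pow, norm_neg,
      norm_one, one_pow, one_mul, Complex.norm_real, Real.norm_eq_abs]
  rcases le_total 0 (ν / ρ) with h0 | h0
  · refine ⟨1, one_pos, fun n _ => ?_⟩
    rw [hnorm]
    exact (le_add_of_nonneg_right (pow_nonneg h0 n)).trans (le_abs_self _)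
  · refine ⟨1 - |ν / ρ|, ?_, fun n hn => ?_⟩
    · rw [abs_of_nonpos h0]; linarith
    · rw [hnorm]
      refine le_trans ?_ (le_abs_self _)
      have h3 := neg_abs_le ((ν / ρ) ^ n)
      rw [abs_pow] at h3
      have h4 := pow_le_of_le_one (abs_nonneg _) hx hn
      linarith

theorem not_tendsto_of_le_norm {f : ℕ → ℂ} {δ : ℝ} (hδ : 0 < δ)
    (h : ∀ᶠ n in atTop, δ ≤ ‖f n‖) : ¬ Tendsto f atTop (𝓝 0) := fun hf => by
  have := ge_of_tendsto hf.norm h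
  rw [norm_zero] at this
  exact absurd this (not_le.2 hδ)

theorem measure_nonvanishing_current_eq_zero {lam : Coupling} (F : HoppingFactorization lam) (α : ℝ)
    {q : ℕ → ℕ} (hqt : Tendsto q atTop atTop) {K : ℝ}
    (hK : ∀ n x, ‖hoppingProd lam α (q n) x‖ ≤ K * F.ρ ^ q n) :
    (haarAddCircle : Measure UnitAddCircle) {θ | Tendsto (fun n =>
      leadPhase α (q n) * (transferLead lam α ^ q n).trace / F.ρ ^ q n +
      -(∫ x, fourier 1 x ^ q n * hoppingProd lam α (q n) x ∂haarAddCircle) / F.ρ ^ q n *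
        fourier (q n : ℤ) θ +
      -(∫ x, fourier 1 x ^ q n * conj (hoppingProd lam α (q n) (x - (α : UnitAddCircle)))
        ∂haarAddCircle) / F.ρ ^ q n * fourier (-(q n : ℤ)) θ) atTop (𝓝 0)} = 0 := by
  have hρ := F.ρ_pos
  have hb1 : ∀ n, |lam.l1| ^ q n ≤ K * F.ρ ^ q n := fun n => by
    rw [← norm_integral_pow_mul_hoppingProd lam α]
    refine norm_integral_le_const fun x => ?_
    rw [norm_mul, norm_pow, norm_fourier_one, one_pow, one_mul]
    exact hK n x
  have hb3 : ∀ n, |lam.l3| ^ q n ≤ K * F.ρ ^ q n := fun n => by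
    rw [← norm_integral_pow_mul_conj_hoppingProd lam α]
    refine norm_integral_le_const fun x => ?_
    rw [norm_mul, norm_pow, norm_fourier_one, one_pow, one_mul, Complex.norm_conj]
    exact hK n _
  by_contra hS
  set a : ℕ → ℂ := fun n => leadPhase α (q n) * (transferLead lam α ^ q n).trace / F.ρ ^ q n with ha
  set b : ℕ → ℂ := fun n =>
    -(∫ x, fourier 1 x ^ q n * hoppingProd lam α (q n) x ∂haarAddCircle) / F.ρ ^ q n with hb
  set c : ℕ → ℂ := fun n =>
    -(∫ x, fourier 1 x ^ q n * conj (hoppingProd lam α (q n) (x - (α : UnitAddCircle)))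
        ∂haarAddCircle) / F.ρ ^ q n with hc
  have hbK : ∀ n, ‖b n‖ ≤ K := fun n =>
    norm_ratio_le hρ (norm_integral_pow_mul_hoppingProd lam α (q n)) (hb1 n)
  have hcK : ∀ n, ‖c n‖ ≤ K := fun n =>
    norm_ratio_le hρ (norm_integral_pow_mul_conj_hoppingProd lam α (q n)) (hb3 n)
  -- No bound on the trace coefficient is known beforehand; it comes from convergence at a single
  -- phase, the other two coefficients being bounded.
  obtain ⟨θ, hθ⟩ := nonempty_of_measure_ne_zero hS
  obtain ⟨L, hL⟩ := (Metric.isBounded_range_of_tendsto _ hθ).exists_norm_le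
  have haK : ∀ n, ‖a n‖ ≤ L + K + K := by
    intro n
    have h1 := hL _ ⟨n, rfl⟩
    have h2 : a n = (a n + b n * fourier (q n : ℤ) θ + c n * fourier (-(q n : ℤ)) θ) -
      b n * fourier (q n : ℤ) θ - c n * fourier (-(q n : ℤ)) θ := by ring
    rw [h2]
    refine (norm_sub_le _ _).trans (add_le_add ((norm_sub_le _ _).trans (add_le_add h1 ?_)) ?_)
    · rw [norm_mul, norm_fourier_eq_one, mul_one]; exact hbK n
    · rw [norm_mul, norm_fourier_eq_one, mul_one]; exact hcK n
  have hL0 : 0 ≤ L := (norm_nonneg _).trans (hL _ ⟨0, rfl⟩)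
  have hK0 : 0 ≤ K := (norm_nonneg _).trans (hbK 0)
  have hm : Tendsto (fun n => (q n : ℤ)) atTop atTop := tendsto_natCast_atTop_atTop.comp hqt
  obtain ⟨ta, tb, tc⟩ := tendsto_zero_of_fourier_tendsto_zero hm haK
    (fun n => (hbK n).trans (by linarith)) (fun n => (hcK n).trans (by linarith)) hS
  have hone : ∀ {z : ℂ} {B : ℝ} {n : ℕ}, ‖z‖ = B ^ n → B = F.ρ → 1 ≤ ‖-z / (F.ρ : ℂ) ^ n‖ := by
    intro z B n hz hB
    rw [norm_div, norm_neg, hz, norm_pow, Complex.norm_real, Real.norm_of_nonneg hρ.le, hB,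
      div_self (pow_pos hρ _).ne']
  rcases F.dichotomy with h | h | ⟨ν, h0, h1, h2⟩
  · exact not_tendsto_of_le_norm one_pos (Eventually.of_forall fun n =>
      hone (norm_integral_pow_mul_hoppingProd lam α (q n)) h) tb
  · exact not_tendsto_of_le_norm one_pos (Eventually.of_forall fun n =>
      hone (norm_integral_pow_mul_conj_hoppingProd lam α (q n)) h) tc
  · obtain ⟨δ, hδ, h3⟩ := exists_le_norm_trace_div hρ h0 h1 h2 α
    exact not_tendsto_of_le_norm hδ
      ((hqt.eventually_ne_atTop 0).mono fun n hn => h3 _ hn) ta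

theorem four_mul_im_sq (y : ℂ) :
    ((4 * y.im ^ 2 : ℝ) : ℂ) = ((2 * ‖y‖ ^ 2 : ℝ) : ℂ) - y ^ 2 - conj y ^ 2 := by
  apply Complex.ext
  · rw [← Complex.normSq_eq_norm_sq, Complex.normSq_apply]
    simp [sq]; ring
  · rw [← Complex.normSq_eq_norm_sq, Complex.normSq_apply]
    simp [sq]; ring

/-- As a function of `θ` the `L²` norm has only the frequencies `0` and `±2n`, the shape required by
`tendsto_zero_of_fourier_tendsto_zero`. -/
theorem integral_four_mul_im_sq {p : UnitAddCircle → ℂ} (hp : Continuous p) (n : ℕ)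
    (θ : UnitAddCircle) :
    ((4 * ∫ x, (fourier 1 θ ^ n * p x).im ^ 2 ∂haarAddCircle : ℝ) : ℂ) =
      ((2 * ∫ x, ‖p x‖ ^ 2 ∂haarAddCircle : ℝ) : ℂ) +
        -(∫ x, p x ^ 2 ∂haarAddCircle) * fourier (2 * n : ℤ) θ +
        -(∫ x, conj (p x) ^ 2 ∂haarAddCircle) * fourier (-(2 * n : ℤ)) θ := by
  have hint : ∀ {f : UnitAddCircle → ℂ}, Continuous f → Integrable f haarAddCircle :=
    fun hf => hf.integrable_of_hasCompactSupport (HasCompactSupport.of_compactSpace _)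
  have h1 : ∀ x, ((4 * (fourier 1 θ ^ n * p x).im ^ 2 : ℝ) : ℂ) =
      ((2 * ‖p x‖ ^ 2 : ℝ) : ℂ) - fourier (2 * n : ℤ) θ * p x ^ 2 -
        fourier (-(2 * n : ℤ)) θ * conj (p x) ^ 2 := by
    intro x
    have h2 : fourier (2 * n : ℤ) θ = (fourier 1 θ ^ n) ^ 2 := by
      rw [← pow_mul, mul_comm n 2, ← fourier_natCast]; push_cast; rfl
    rw [four_mul_im_sq, fourier_neg, h2, norm_mul, norm_pow, norm_fourier_one, one_pow, one_mul]
    simp only [map_mul, map_pow]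
    ring
  rw [← integral_const_mul, ← integral_complex_ofReal, ← integral_const_mul,
    ← integral_complex_ofReal]
  simp_rw [h1]
  rw [integral_sub, integral_sub, integral_const_mul, integral_const_mul]
  · ring
  · exact hint (by fun_prop)
  · exact hint (by fun_prop)
  · exact hint (by fun_prop)
  · exact hint (by fun_prop)

theorem measure_vanishing_current_eq_zero {lam : Coupling} (F : HoppingFactorization lam) (α : ℝ)
    {q : ℕ → ℕ} (hqt : Tendsto q atTop atTop) {K : ℝ}
    (hK : ∀ n x, ‖hoppingProd lam α (q n) x‖ ≤ K * F.ρ ^ q n) :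
    (haarAddCircle : Measure UnitAddCircle) {θ | Tendsto (fun n => ∫ x, (fourier 1 θ ^ q n *
      (hoppingProd lam α (q n) x / F.ρ ^ q n)).im ^ 2 ∂haarAddCircle) atTop (𝓝 0)} = 0 := by
  have hρ := F.ρ_pos
  set p : ℕ → UnitAddCircle → ℂ := fun n x => hoppingProd lam α (q n) x / F.ρ ^ q n with hpd
  have hpc : ∀ n, Continuous (p n) := fun n => (continuous_hoppingProd lam α _).div_const _
  have hpn : ∀ n x, ‖p n x‖ = ‖hoppingProd lam α (q n) x‖ / F.ρ ^ q n := fun n x => by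
    rw [norm_div, norm_pow, Complex.norm_real, Real.norm_of_nonneg hρ.le]
  have hp : ∀ n x, ‖p n x‖ ≤ K := fun n x => by
    rw [hpn, div_le_iff₀ (pow_pos hρ _)]
    exact hK n x
  have hK0 : 0 ≤ K := (norm_nonneg _).trans (hp 0 0)
  have hint : ∀ {f : UnitAddCircle → ℝ}, Continuous f → Integrable f haarAddCircle :=
    fun hf => hf.integrable_of_hasCompactSupport (HasCompactSupport.of_compactSpace _)
  -- The mean of `‖p n‖` is at least one, and the second moment inherits this from `(‖p n‖ - 1)² ≥
  -- 0`. The frequency-zero coefficient therefore cannot tend to zero.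
  have hp1 : ∀ n, 1 ≤ ∫ x, ‖p n x‖ ^ 2 ∂haarAddCircle := by
    intro n
    have h1 : 1 ≤ ∫ x, ‖p n x‖ ∂haarAddCircle := by
      simp_rw [hpn]
      rw [integral_div, le_div_iff₀ (pow_pos hρ _), one_mul]
      exact F.le_integral_norm_hoppingProd α _
    have h2 : ∫ x, (2 * ‖p n x‖ - 1) ∂haarAddCircle ≤ ∫ x, ‖p n x‖ ^ 2 ∂haarAddCircle :=
      integral_mono (hint (by have := hpc n; fun_prop)) (hint (by have := hpc n; fun_prop))
        fun x => by nlinarith [sq_nonneg (‖p n x‖ - 1)]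
    rw [integral_sub (hint (by have := hpc n; fun_prop)) (integrable_const _),
      integral_const_mul] at h2
    simp only [integral_const, probReal_univ, one_smul] at h2
    linarith
  have hpK : ∀ n, ‖∫ x, p n x ^ 2 ∂haarAddCircle‖ ≤ K ^ 2 := fun n =>
    norm_integral_le_const fun x => by
      rw [norm_pow]; exact pow_le_pow_left₀ (norm_nonneg _) (hp n x) 2
  have hpK' : ∀ n, ‖∫ x, conj (p n x) ^ 2 ∂haarAddCircle‖ ≤ K ^ 2 := fun n =>
    norm_integral_le_const fun x => by
      rw [norm_pow, Complex.norm_conj]; exact pow_le_pow_left₀ (norm_nonneg _) (hp n x) 2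
  have hpa : ∀ n, ‖((2 * ∫ x, ‖p n x‖ ^ 2 ∂haarAddCircle : ℝ) : ℂ)‖ ≤ 2 * K ^ 2 := fun n => by
    have h1 := hp1 n
    rw [Complex.norm_real, Real.norm_of_nonneg (by linarith)]
    have h2 : ∫ x, ‖p n x‖ ^ 2 ∂haarAddCircle ≤ ∫ x : UnitAddCircle, K ^ 2 ∂haarAddCircle :=
      integral_mono (hint (by have := hpc n; fun_prop)) (integrable_const _)
        fun x => pow_le_pow_left₀ (norm_nonneg _) (hp n x) 2
    simp only [integral_const, probReal_univ, one_smul] at h2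
    linarith
  by_contra hS
  have hm : Tendsto (fun n => (2 * q n : ℤ)) atTop atTop :=
    (tendsto_natCast_atTop_atTop.comp hqt).const_mul_atTop' two_pos
  refine not_tendsto_of_le_norm (f := fun n => ((2 * ∫ x, ‖p n x‖ ^ 2 ∂haarAddCircle : ℝ) : ℂ))
    two_pos (Eventually.of_forall fun n => ?_)
    (tendsto_zero_of_fourier_tendsto_zero hm hpa
      (b := fun n => -(∫ x, p n x ^ 2 ∂haarAddCircle))
      (c := fun n => -(∫ x, conj (p n x) ^ 2 ∂haarAddCircle))
      (fun n => ?_) (fun n => ?_) ?_).1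
  · have h1 := hp1 n
    rw [Complex.norm_real, Real.norm_of_nonneg (by linarith)]
    linarith
  · rw [norm_neg]; exact (hpK n).trans (by nlinarith [sq_nonneg K])
  · rw [norm_neg]; exact (hpK' n).trans (by nlinarith [sq_nonneg K])
  · refine fun h0 => hS (measure_mono_null (fun θ hθ => ?_) h0)
    simp only [Set.mem_ofPred_eq] at hθ ⊢
    simp_rw [← integral_four_mul_im_sq (hpc _)]
    have := (Complex.continuous_ofReal.tendsto _).comp (hθ.const_mul 4)
    rw [mul_zero, Complex.ofReal_zero] at this
    exact this

end ExtendedHarper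

open ExtendedHarper

theorem theorem1p2 (α : ℝ) (hα : Irrational α) (lam : ExtendedHarper.Coupling)
    (hlam : lam ∈ ExtendedHarper.selfDualRegion) :
    ∀ᵐ θ : UnitAddCircle ∂(AddCircle.haarAddCircle : MeasureTheory.Measure UnitAddCircle),
      ExtendedHarper.pointSpectrum (ExtendedHarper.harper lam α θ) = ∅ := by
  obtain ⟨h2, hdual⟩ := dual_mem_selfDualRegion hlam
  -- The factorization is taken for the dual coupling, whose equation `u` satisfies.
  obtain ⟨F⟩ := exists_hoppingFactorization hdual
  obtain ⟨C, hC, q, hqt, hq0, hprod⟩ := exists_bounded_products hα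
  have hK : ∀ n x, ‖hoppingProd lam.dual α (q n) x‖ ≤ (C * C) * F.ρ ^ q n := by
    intro n x
    rw [F.norm_hoppingProd, mul_comm]
    refine mul_le_mul_of_nonneg_right (mul_le_mul (hprod n _ ?_ x) (hprod n _ ?_ x)
      (by positivity) hC.le) (pow_pos F.ρ_pos _).le
    · rw [norm_mul, norm_halfPhase, mul_one]; exact F.norm_a
    · rw [norm_mul, norm_halfPhase, mul_one]; exact F.norm_b
  -- Both null sets are fixed before any energy or eigenvector is introduced, so one good `θ`
  -- excludes all eigenvalues at once.
  filter_upwards [measure_eq_zero_iff_ae_notMem.1 (measure_nonvanishing_current_eq_zero F α hqt hK),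
    measure_eq_zero_iff_ae_notMem.1 (measure_vanishing_current_eq_zero F α hqt hK)] with θ h1 h3
  refine Set.eq_empty_of_forall_notMem fun E hE => ?_
  obtain ⟨ψ, hψ⟩ := Module.End.HasEigenvalue.exists_hasEigenvector hE
  obtain ⟨u, hu, hu0, hsol⟩ := exists_solvesDual h2 hψ.2 (E := E) hψ.apply_eq_smul
  have hEim := im_eq_zero_of_solvesDual hu hu0 hsol
  obtain ⟨c, hc⟩ := ae_current_eq_const hα hu hEim hsol
  by_cases hc0 : c = 0
  · subst hc0
    exact h3 (tendsto_integral_sq_of_current_eq_zero F hα hEim hu hu0 hsol hc hq0 hK)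
  · exact h1 (tendsto_of_current_ne_zero hEim hu hsol hc0 hc hq0 F.ρ_pos hK)
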